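/- **Conventions.** Let $\mathbb K$ be a field (for instance $\mathbb R$ or $\mathbb C$) and $[n]=\{1,\dots,n\}$. An *$\mathfrak S\times\mathfrak S^{op}$-module* is a family $X=(X(k,l))_{k,l\ge 0}$ of $\mathbb K$-vector spaces with commuting linear actions of $\mathfrak S_l$ on the left and of $\mathfrak S_k$ on the right of $X(k,l)$; its morphisms are the families of equivariant linear maps. A *TraP* is an $\mathfrak S\times\mathfrak S^{op}$-module $P$ with bilinear products $*:P(k,l)\times P(k',l')\to P(k+k',l+l')$ and linear partial trace maps $t_{i,j}:P(k,l)\to P(k-1,l-1)$ for $k,l\ge1$, $i\in[k]$, $j\in[l]$, such that: 1. $*$ is associative with a unit $I_0\in P(0,0)$; $(\sigma\cdot p\cdot\tau)*(\sigma'\cdot p'\cdot\tau')=(\sigma\otimes\sigma')\cdot(p*p')\cdot(\tau\otimes\tau')$; and $c_{l,l'}\cdot(p*p')=(p'*p)\cdot c_{k,k'}$ for $p\in P(k,l)$, $p'\in P(k',l')$. Here $\sigma\otimes\sigma'$ is the block permutation, and $c_{m,n}\in\mathfrak S_{m+n}$ maps $i$ to $i+n$ if $i\le m$ and to $i-m$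 if $i>m$. 2. Two partial traces commute up to reindexing: for $k,l\ge2$, $i\in[k]$, $j\in[l]$, $i'\in[k-1]$, $j'\in[l-1]$ one has $t_{i',j'}\circ t_{i,j}=t_{a,b}\circ t_{a',b'}$, where $(a,a')=(i-1,i')$ if $i'<i$ and $(a,a')=(i,i'+1)$ if $i'\ge i$, and $(b,b')$ is obtained in the same way from $(j,j')$. 3. $t_{i,j}(\sigma\cdot p\cdot\tau)=\sigma_{j}\cdot t_{\tau(i),\sigma^{-1}(j)}(p)\cdot\tau_{\tau(i)}$, where, for $\alpha\in\mathfrak S_n$ and $q\in[n]$, the word of $\alpha_q\in\mathfrak S_{n-1}$ is obtained from the word $\alpha(1)\cdots\alpha(n)$ by deleting the letter $q$ and subtracting $1$ from all the letters greater than $q$. 4. For $p\in P(k,l)$ and $p'\in P(k',l')$: $t_{i,j}(p*p')=t_{i,j}(p)*p'$ if $i\le k$, $j\le l$, and $t_{i,j}(p*p')=p*t_{i-k,j-l}(p')$ if $i>k$, $j>l$. 5. There is $I\in P(1,1)$ such that, for all $p\in P(k,l)$, $t_{1,j}(I*p)=(1,2,\dots,j-1)\cdot p$ and $t_{i,1}(I*p)=p\cdot(1,2,\dots,i-1)^{-1}$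 for $2\le j\le l+1$, $2\le i\le k+1$, and $t_{k+1,j}(p*I)=(j,j+1,\dots,l)^{-1}\cdot p$ and $t_{i,l+1}(p*I)=p\cdot(i,i+1,\dots,k)$ for $1\le j\le l$, $1\le i\le k$. A *morphism of TraPs* is a morphism of $\mathfrak S\times\mathfrak S^{op}$-modules which respects $*$ and all $t_{i,j}$ and maps $I_0$ and $I$ to $I_0$ and $I$. A *planar graph* is a finite directed graph (multiple edges are allowed) with finitely many vertices, internal edges (from a vertex to a vertex), input edges (ending at a vertex), output edges (starting at a vertex), input-output edges, and loops (edges without endpoints), with an indexation by $[k]$ of the input and input-output edges together, an indexation by $[l]$ of the output and input-output edges together, and a total order on the incoming edges and on the outgoing edges of each vertex. Isomorphisms respect all of this. For a vertex $v$ let $i(v)$ and $o(v)$ be its numbers of incoming and outgoing edges. For an $\mathfrak S\times\mathfrak S^{op}$-module $X$, let $\mathbf{PGr}^{\circlearrowright}(X)(k,l)$ be the $\mathbb K$-vector space generated by the isomorphism classes of planar graphs with $k$ inputs and $l$ outputs each of whose vertices $v$ is decorated by an element of $X(i(v),o(v))$, subject to linearity in the decoration of each vertex. The group actions reindex the outputs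 and the inputs ($\sigma\cdot G$ has output indexation $\sigma\circ\beta$ and $G\cdot\tau$ has input indexation $\tau^{-1}\circ\alpha$, if $\beta$ and $\alpha$ are those of $G$); $G*G'$ is the disjoint union with the inputs and outputs of $G'$ indexed after those of $G$; $t_{i,j}(G)$ is obtained by gluing the output $j$ to the input $i$ and reindexing increasingly (a loop arises if both belong to the same input-output edge); $I_0$ is the empty graph and $I$ consists of one input-output edge. Let $\iota:X\to\mathbf{PGr}^{\circlearrowright}(X)$ map $x\in X(k,l)$ to the graph with a single vertex, decorated by $x$, whose incoming (outgoing) edges in their order are the inputs $1,\dots,k$ (the outputs $1,\dots,l$), without further edges. **Theorem.** Let $X$ be an $\mathfrak S\times\mathfrak S^{op}$-module. Then $\mathbf{PGr}^{\circlearrowright}(X)$ is a TraP, each map $\iota:X(k,l)\to\mathbf{PGr}^{\circlearrowright}(X)(k,l)$ is injective, and for every TraP $P$ and every morphism $\varphi:X\to P$ of $\mathfrak S\times\mathfrak S^{op}$-modules there is a unique morphism of TraPs $\Phi:\mathbf{PGr}^{\circlearrowright}(X)\to P$ with $\Phi\circ\iota=\varphi$. -/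

import Mathlib

/-!
All indices are 0-based: the set `[n] = {1, …, n}` is `Fin n`, and `t_{i,j}` is defined for
`i : Fin (k + 1)`, `j : Fin (l + 1)` and maps `P(k+1,l+1)` to `P(k,l)`.
-/

universe u v w

/-! ### Permutations -/

namespace TraPPerm

/-- The permutation `σ ⊗ τ` of `[m + n]`: `σ` on the first `m` letters, `τ` on the last `n`. -/
def tensor {m n : ℕ} (σ : Equiv.Perm (Fin m)) (τ : Equiv.Perm (Fin n)) :
    Equiv.Perm (Fin (m + n)) :=
  (finSumFinEquiv.symm.trans (Equiv.sumCongr σ τ)).trans finSumFinEquiv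

/-- The permutation `c_{m,n}` of `[m + n]`: `i ↦ i + n` on the first `m` letters and
`i ↦ i - m` on the last `n` ones. -/
def comm (m n : ℕ) : Equiv.Perm (Fin (m + n)) :=
  finAddFlip.trans (finCongr (Nat.add_comm n m))

/-- The permutation `α_p`: remove the letter (the value) `p` from the word of `α` and standardize
the remaining letters. -/
def delete {n : ℕ} (α : Equiv.Perm (Fin (n + 1))) (p : Fin (n + 1)) : Equiv.Perm (Fin n) :=
  ((finSuccAboveEquiv (α.symm p)).trans
    (α.subtypeEquiv fun _ => not_congr (Equiv.eq_symm_apply α))).trans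
      (finSuccAboveEquiv p).symm

end TraPPerm

/-! ### Modules over the symmetric groups -/

/-- The data of an `𝔖 × 𝔖ᵒᵖ`-module over `K`: vector spaces `X(k,l)` with maps
`p ↦ σ·p` for `σ ∈ 𝔖_l` and `p ↦ p·τ` for `τ ∈ 𝔖_k`. -/
structure SymData (K : Type w) [Field K] where
  obj : ℕ → ℕ → Type u
  [addCommGroup : ∀ k l, AddCommGroup (obj k l)]
  [module : ∀ k l, Module K (obj k l)]
  lact : ∀ {k l : ℕ}, Equiv.Perm (Fin l) → obj k l →ₗ[K] obj k l
  ract : ∀ {k l : ℕ}, Equiv.Perm (Fin k) → obj k l →ₗ[K] obj k l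

attribute [instance] SymData.addCommGroup SymData.module

/-- Transport of an element along equalities of arities. -/
def SymData.cast {K : Type w} [Field K] (X : SymData.{u, w} K) {k k' l l' : ℕ}
    (hk : k = k') (hl : l = l') (x : X.obj k l) : X.obj k' l' :=
  hl ▸ hk ▸ x

/-- The axioms of `𝔖 × 𝔖ᵒᵖ`-modules. -/
structure SymData.IsSymModule {K : Type w} [Field K] (X : SymData.{u, w} K) : Prop where
  one_lact : ∀ {k l : ℕ} (p : X.obj k l), X.lact 1 p = p
  ract_one : ∀ {k l : ℕ} (p : X.obj k l), X.ract 1 p = p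
  mul_lact : ∀ {k l : ℕ} (σ σ' : Equiv.Perm (Fin l)) (p : X.obj k l),
    X.lact (σ * σ') p = X.lact σ (X.lact σ' p)
  ract_mul : ∀ {k l : ℕ} (τ τ' : Equiv.Perm (Fin k)) (p : X.obj k l),
    X.ract (τ * τ') p = X.ract τ' (X.ract τ p)
  lact_ract : ∀ {k l : ℕ} (σ : Equiv.Perm (Fin l)) (τ : Equiv.Perm (Fin k)) (p : X.obj k l),
    X.lact σ (X.ract τ p) = X.ract τ (X.lact σ p)

/-- An `𝔖 × 𝔖ᵒᵖ`-module over `K`. -/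
structure SymModule (K : Type w) [Field K] extends SymData.{u, w} K where
  isSymModule : toSymData.IsSymModule

/-- A morphism of `𝔖 × 𝔖ᵒᵖ`-modules. -/
structure SymData.Hom {K : Type w} [Field K] (X : SymData.{u, w} K) (Y : SymData.{v, w} K) where
  app : ∀ k l : ℕ, X.obj k l →ₗ[K] Y.obj k l
  map_lact : ∀ {k l : ℕ} (σ : Equiv.Perm (Fin l)) (p : X.obj k l),
    app k l (X.lact σ p) = Y.lact σ (app k l p)
  map_ract : ∀ {k l : ℕ} (τ : Equiv.Perm (Fin k)) (p : X.obj k l),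
    app k l (X.ract τ p) = Y.ract τ (app k l p)

/-! ### TraPs -/

/-- The data of a TraP: an `𝔖 × 𝔖ᵒᵖ`-module with a horizontal concatenation `mul`, its unit
`one = I₀`, the unit `unit = I` of the partial traces, and the partial trace maps `tr i j`. -/
structure TraPData (K : Type w) [Field K] extends SymData.{u, w} K where
  mul : ∀ {k l k' l' : ℕ}, obj k l →ₗ[K] obj k' l' →ₗ[K] obj (k + k') (l + l')
  one : obj 0 0
  unit : obj 1 1
  tr : ∀ {k l : ℕ}, Fin (k + 1) → Fin (l + 1) → obj (k + 1) (l + 1) →ₗ[K] obj k l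

/-- The axioms of TraPs. -/
structure TraPData.IsTraP {K : Type w} [Field K] (P : TraPData.{u, w} K) : Prop
    extends P.toSymData.IsSymModule where
  mul_assoc : ∀ {k l k' l' k'' l'' : ℕ} (p : P.obj k l) (p' : P.obj k' l') (p'' : P.obj k'' l''),
    P.cast (Nat.add_assoc k k' k'') (Nat.add_assoc l l' l'') (P.mul (P.mul p p') p'') =
      P.mul p (P.mul p' p'')
  one_mul : ∀ {k l : ℕ} (p : P.obj k l),
    P.cast (Nat.zero_add k) (Nat.zero_add l) (P.mul P.one p) = p
  mul_one : ∀ {k l : ℕ} (p : P.obj k l), P.mul p P.one = p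
  act_mul_act : ∀ {k l k' l' : ℕ} (p : P.obj k l) (p' : P.obj k' l')
    (σ : Equiv.Perm (Fin l)) (τ : Equiv.Perm (Fin k))
    (σ' : Equiv.Perm (Fin l')) (τ' : Equiv.Perm (Fin k')),
    P.mul (P.lact σ (P.ract τ p)) (P.lact σ' (P.ract τ' p')) =
      P.lact (TraPPerm.tensor σ σ') (P.ract (TraPPerm.tensor τ τ') (P.mul p p'))
  mul_comm : ∀ {k l k' l' : ℕ} (p : P.obj k l) (p' : P.obj k' l'),
    P.lact (TraPPerm.comm l l') (P.mul p p') =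
      P.ract (TraPPerm.comm k k')
        (P.cast (Nat.add_comm k' k) (Nat.add_comm l' l) (P.mul p' p))
  /- `i.succAbove i'` is `i'` if `i' < i` and `i' + 1` otherwise; accordingly `i'.predAbove i`
  is `i - 1` in the first case and `i` in the second one. -/
  tr_tr : ∀ {k l : ℕ} (i : Fin (k + 2)) (j : Fin (l + 2)) (i' : Fin (k + 1)) (j' : Fin (l + 1))
    (p : P.obj (k + 2) (l + 2)),
    P.tr i' j' (P.tr i j p) =
      P.tr (i'.predAbove i) (j'.predAbove j) (P.tr (i.succAbove i') (j.succAbove j') p)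
  tr_act : ∀ {k l : ℕ} (i : Fin (k + 1)) (j : Fin (l + 1))
    (σ : Equiv.Perm (Fin (l + 1))) (τ : Equiv.Perm (Fin (k + 1))) (p : P.obj (k + 1) (l + 1)),
    P.tr i j (P.lact σ (P.ract τ p)) =
      P.lact (TraPPerm.delete σ j)
        (P.ract (TraPPerm.delete τ (τ i)) (P.tr (τ i) (σ.symm j) p))
  tr_mul_left : ∀ {k l k' l' : ℕ} (i : Fin (k + 1)) (j : Fin (l + 1))
    (p : P.obj (k + 1) (l + 1)) (p' : P.obj k' l'),
    P.tr (Fin.cast (Nat.add_right_comm k 1 k') (Fin.castAdd k' i))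
        (Fin.cast (Nat.add_right_comm l 1 l') (Fin.castAdd l' j))
        (P.cast (Nat.add_right_comm k 1 k') (Nat.add_right_comm l 1 l') (P.mul p p')) =
      P.mul (P.tr i j p) p'
  tr_mul_right : ∀ {k l k' l' : ℕ} (i : Fin (k' + 1)) (j : Fin (l' + 1))
    (p : P.obj k l) (p' : P.obj (k' + 1) (l' + 1)),
    P.tr (k := k + k') (l := l + l') (Fin.natAdd k i) (Fin.natAdd l j) (P.mul p p') =
      P.mul p (P.tr i j p')
  /- `j.cycleRange` is the cycle `(0, 1, …, j)`. -/
  tr_unit_mul_left : ∀ {k l : ℕ} (j : Fin (l + 1)) (p : P.obj k (l + 1)),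
    P.tr 0 j.succ (P.cast (Nat.add_comm 1 k) (Nat.add_comm 1 (l + 1)) (P.mul P.unit p)) =
      P.lact j.cycleRange p
  tr_unit_mul_right : ∀ {k l : ℕ} (i : Fin (k + 1)) (p : P.obj (k + 1) l),
    P.tr i.succ 0 (P.cast (Nat.add_comm 1 (k + 1)) (Nat.add_comm 1 l) (P.mul P.unit p)) =
      P.ract (i.cycleRange)⁻¹ p
  /- `Fin.cycleIcc j (Fin.last l)` is the cycle `(j, j + 1, …, l)`. -/
  tr_mul_unit_left : ∀ {k l : ℕ} (j : Fin (l + 1)) (p : P.obj k (l + 1)),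
    P.tr (Fin.last k) j.castSucc (P.mul p P.unit) =
      P.lact (Fin.cycleIcc j (Fin.last l))⁻¹ p
  tr_mul_unit_right : ∀ {k l : ℕ} (i : Fin (k + 1)) (p : P.obj (k + 1) l),
    P.tr i.castSucc (Fin.last l) (P.mul p P.unit) =
      P.ract (Fin.cycleIcc i (Fin.last k)) p

/-- A TraP over `K`. -/
structure TraP (K : Type w) [Field K] extends TraPData.{u, w} K where
  isTraP : toTraPData.IsTraP

/-- A morphism of TraPs: linear maps which respect the actions of the symmetric groups, the
horizontal concatenation, the partial traces and the two units. -/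
structure TraPData.Hom {K : Type w} [Field K] (P : TraPData.{u, w} K) (Q : TraPData.{v, w} K)
    extends P.toSymData.Hom Q.toSymData where
  map_mul : ∀ {k l k' l' : ℕ} (p : P.obj k l) (p' : P.obj k' l'),
    app (k + k') (l + l') (P.mul p p') = Q.mul (app k l p) (app k' l' p')
  map_tr : ∀ {k l : ℕ} (i : Fin (k + 1)) (j : Fin (l + 1)) (p : P.obj (k + 1) (l + 1)),
    app k l (P.tr i j p) = Q.tr i j (app (k + 1) (l + 1) p)
  map_one : app 0 0 P.one = Q.one
  map_unit : app 1 1 P.unit = Q.unit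

/-! ### Planar graphs -/

/-- A planar graph with `k` inputs and `l` outputs.

`V` is the finite set of vertices. The total orders on the incoming and the outgoing edges of a
vertex `v` number them by `Fin (inn v)` and `Fin (out v)`. `loops` is the number of loops (edges
without endpoints). Every other edge begins either at an input index `i : Fin k` or at one of the
outgoing slots `⟨v, r⟩` of a vertex, and ends either at an output index or at one of the ingoing
slots of a vertex. Each beginning and each end belongs to exactly one edge, so an edge is named by
its beginning and `wire` maps the beginning of an edge to its end. Thus the internal edges,
the input edges, the output edges and the input-output edges are the edges from a vertex to a
vertex, from an input index to a vertex, from a vertex to an output index, and from an input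
index to an output index, respectively. -/
structure PlanarGraph (k l : ℕ) where
  V : Type
  finite : Finite V
  inn : V → ℕ
  out : V → ℕ
  loops : ℕ
  wire : Fin k ⊕ (Σ v, Fin (out v)) ≃ Fin l ⊕ (Σ v, Fin (inn v))

namespace PlanarGraph

/-- The bijection between the slots of two families of vertices that is induced by a bijection of
the vertices which respects the arities. -/
def slotEquiv {V V' : Type} {a : V → ℕ} {a' : V' → ℕ} (f : V ≃ V') (h : ∀ v, a v = a' (f v)) :
    (Σ v, Fin (a v)) ≃ Σ v', Fin (a' v') :=
  Equiv.sigmaCongr f fun v => finCongr (h v)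

/-- The left action `σ · G`: the output edge of index `j` gets the index `σ j`. -/
def lact {k l : ℕ} (σ : Equiv.Perm (Fin l)) (G : PlanarGraph k l) : PlanarGraph k l :=
  { G with wire := G.wire.trans (Equiv.sumCongr σ (Equiv.refl _)) }

/-- The right action `G · τ`: the input edge of index `i` in `G · τ` is the one of index `τ i`
in `G`. -/
def ract {k l : ℕ} (τ : Equiv.Perm (Fin k)) (G : PlanarGraph k l) : PlanarGraph k l :=
  { G with wire := (Equiv.sumCongr τ (Equiv.refl _)).trans G.wire }

/-- The edge ends of a disjoint union: those of the first graph and those of the second one, whose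
external indices are shifted. -/
def splitEnds {V V' : Type} (m n : ℕ) (a : V → ℕ) (a' : V' → ℕ) :
    Fin (m + n) ⊕ (Σ x : V ⊕ V', Fin (Sum.elim a a' x)) ≃
      (Fin m ⊕ Σ v, Fin (a v)) ⊕ (Fin n ⊕ Σ v, Fin (a' v)) where
  toFun
    | Sum.inl i => Sum.map Sum.inl Sum.inl (finSumFinEquiv.symm i)
    | Sum.inr ⟨Sum.inl v, r⟩ => Sum.inl (Sum.inr ⟨v, r⟩)
    | Sum.inr ⟨Sum.inr v, r⟩ => Sum.inr (Sum.inr ⟨v, r⟩)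
  invFun
    | Sum.inl (Sum.inl i) => Sum.inl (Fin.castAdd n i)
    | Sum.inl (Sum.inr ⟨v, r⟩) => Sum.inr ⟨Sum.inl v, r⟩
    | Sum.inr (Sum.inl i) => Sum.inl (Fin.natAdd m i)
    | Sum.inr (Sum.inr ⟨v, r⟩) => Sum.inr ⟨Sum.inr v, r⟩
  left_inv := by
    rintro (i | ⟨v | v, r⟩)
    · induction i using Fin.addCases <;> simp
    · rfl
    · rfl
  right_inv := by
    rintro ((i | ⟨v, r⟩) | (i | ⟨v, r⟩)) <;> simp

/-- The horizontal concatenation `G * G'`: the disjoint union, the inputs and outputs of `G'` being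
indexed after those of `G`. -/
def hmul {k l k' l' : ℕ} (G : PlanarGraph k l) (G' : PlanarGraph k' l') :
    PlanarGraph (k + k') (l + l') where
  V := G.V ⊕ G'.V
  finite := by
    have := G.finite
    have := G'.finite
    infer_instance
  inn := Sum.elim G.inn G'.inn
  out := Sum.elim G.out G'.out
  loops := G.loops + G'.loops
  wire := ((splitEnds k k' G.out G'.out).trans (Equiv.sumCongr G.wire G'.wire)).trans
    (splitEnds l l' G.inn G'.inn).symm

/-- Single out the external index `i`; the other ones are reindexed increasingly. -/
def extract {n : ℕ} (i : Fin (n + 1)) (S : Type) :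
    Fin (n + 1) ⊕ S ≃ Option (Fin n ⊕ S) where
  toFun := Sum.elim (fun a => (finSuccEquiv' i a).map Sum.inl) fun s => some (Sum.inr s)
  invFun := fun x => x.elim (Sum.inl i) (Sum.map i.succAbove id)
  left_inv := by
    rintro (a | s)
    · rcases Fin.eq_self_or_eq_succAbove i a with h | ⟨b, rfl⟩
      · simp [h]
      · simp
    · rfl
  right_inv := by
    rintro (_ | a | s) <;> simp

open Classical in
/-- The partial trace `t_{i,j}(G)`: the end of the edge leading to the output `j` is glued to the
beginning of the edge starting at the input `i`. In terms of `wire`, the new edge beginning at the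
beginning of the former ends at the end of the latter; this is what `Equiv.removeNone` does, where
`none` stands for the input `i` and for the output `j`. If both edges coincide then a loop is
created. -/
noncomputable def trace {k l : ℕ} (i : Fin (k + 1)) (j : Fin (l + 1))
    (G : PlanarGraph (k + 1) (l + 1)) : PlanarGraph k l where
  V := G.V
  finite := G.finite
  inn := G.inn
  out := G.out
  loops := if G.wire (Sum.inl i) = Sum.inl j then G.loops + 1 else G.loops
  wire := Equiv.removeNone (((extract i _).symm.trans G.wire).trans (extract j _))

/-- The empty graph `I₀`. -/
def empty : PlanarGraph 0 0 where
  V := Empty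
  finite := inferInstance
  inn := Empty.elim
  out := Empty.elim
  loops := 0
  wire := Equiv.refl _

/-- The graph `I` with one input-output edge and nothing else. -/
def edge : PlanarGraph 1 1 where
  V := Empty
  finite := inferInstance
  inn := Empty.elim
  out := Empty.elim
  loops := 0
  wire := Equiv.refl _

/-- The graph `PG_{k,l}` with one vertex, whose incoming (outgoing) edges are the inputs (outputs)
in their natural order. -/
def corolla (k l : ℕ) : PlanarGraph k l where
  V := Unit
  finite := inferInstance
  inn := fun _ => k
  out := fun _ => l
  loops := 0
  wire := (Equiv.sumComm _ _).trans
    (Equiv.sumCongr (Equiv.uniqueSigma fun _ : Unit => Fin l)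
      (Equiv.uniqueSigma fun _ : Unit => Fin k).symm)

end PlanarGraph

/-! ### Decorated planar graphs -/

/-- A planar graph `G` decorated by `X`: each vertex `v` carries an element of
`X(i(v), o(v))`. -/
structure DecGraph {K : Type w} [Field K] (X : SymData.{u, w} K) (k l : ℕ) where
  graph : PlanarGraph k l
  dec : ∀ v : graph.V, X.obj (graph.inn v) (graph.out v)

namespace DecGraph

variable {K : Type w} [Field K] {X : SymData.{u, w} K} {k l k' l' : ℕ}

/-- An isomorphism of decorated planar graphs: a bijection of the vertices which respects the
arities, the edges (with the orders around each vertex and the indices of inputs and outputs), the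
decorations, and the number of loops. -/
structure Iso (D D' : DecGraph X k l) where
  equiv : D.graph.V ≃ D'.graph.V
  inn_eq : ∀ v, D.graph.inn v = D'.graph.inn (equiv v)
  out_eq : ∀ v, D.graph.out v = D'.graph.out (equiv v)
  loops_eq : D.graph.loops = D'.graph.loops
  wire_eq : (Equiv.sumCongr (Equiv.refl _) (PlanarGraph.slotEquiv equiv out_eq)).trans
      D'.graph.wire =
    D.graph.wire.trans (Equiv.sumCongr (Equiv.refl _) (PlanarGraph.slotEquiv equiv inn_eq))
  dec_eq : ∀ v, X.cast (inn_eq v) (out_eq v) (D.dec v) = D'.dec (equiv v)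

/-- The left action on decorated graphs. -/
def lact (σ : Equiv.Perm (Fin l)) (D : DecGraph X k l) : DecGraph X k l :=
  ⟨D.graph.lact σ, D.dec⟩

/-- The right action on decorated graphs. -/
def ract (τ : Equiv.Perm (Fin k)) (D : DecGraph X k l) : DecGraph X k l :=
  ⟨D.graph.ract τ, D.dec⟩

/-- The horizontal concatenation of decorated graphs. -/
def hmul (D : DecGraph X k l) (D' : DecGraph X k' l') : DecGraph X (k + k') (l + l') :=
  ⟨D.graph.hmul D'.graph, fun v => Sum.rec D.dec D'.dec v⟩

/-- The partial traces of decorated graphs. -/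
noncomputable def trace (i : Fin (k + 1)) (j : Fin (l + 1)) (D : DecGraph X (k + 1) (l + 1)) :
    DecGraph X k l :=
  ⟨D.graph.trace i j, D.dec⟩

/-- The decorated graph `I₀`. -/
def empty (X : SymData.{u, w} K) : DecGraph X 0 0 :=
  ⟨PlanarGraph.empty, fun v => v.elim⟩

/-- The decorated graph `I`. -/
def edge (X : SymData.{u, w} K) : DecGraph X 1 1 :=
  ⟨PlanarGraph.edge, fun v => v.elim⟩

/-- The decorated graph `G(x)`: the graph `PG_{k,l}` whose only vertex is decorated by `x`. -/
def corolla (x : X.obj k l) : DecGraph X k l :=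
  ⟨PlanarGraph.corolla k l, fun _ => x⟩

/-- The relations which define `PGr(X)(k,l)`: isomorphic decorated graphs are identified, and a
decorated graph is linear in the decoration of each of its vertices. -/
inductive Rel : (DecGraph X k l →₀ K) → Prop
  | iso (D D' : DecGraph X k l) (f : Iso D D') :
      Rel (Finsupp.single D 1 - Finsupp.single D' 1)
  | add (G : PlanarGraph k l) [DecidableEq G.V]
      (d : ∀ v : G.V, X.obj (G.inn v) (G.out v)) (v : G.V)
      (x y : X.obj (G.inn v) (G.out v)) :
      Rel (Finsupp.single ⟨G, Function.update d v (x + y)⟩ 1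
        - Finsupp.single ⟨G, Function.update d v x⟩ 1
        - Finsupp.single ⟨G, Function.update d v y⟩ 1)
  | smul (G : PlanarGraph k l) [DecidableEq G.V]
      (d : ∀ v : G.V, X.obj (G.inn v) (G.out v)) (v : G.V)
      (a : K) (x : X.obj (G.inn v) (G.out v)) :
      Rel (Finsupp.single ⟨G, Function.update d v (a • x)⟩ 1
        - Finsupp.single ⟨G, Function.update d v x⟩ a)

/-- The subspace spanned by the relations. -/
noncomputable def relSpan (X : SymData.{u, w} K) (k l : ℕ) : Submodule K (DecGraph X k l →₀ K) :=
  Submodule.span K {r | Rel r}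

/-! The operations respect isomorphisms. -/

theorem _root_.Equiv.removeNone_conj {α β γ δ : Type*} (a : α ≃ β) (e : Option β ≃ Option γ)
    (b : γ ≃ δ) :
    Equiv.removeNone ((a.optionCongr.trans e).trans b.optionCongr) =
      (a.trans (Equiv.removeNone e)).trans b := by
  ext x
  apply Option.some_injective
  rcases h : e (some (a x)) with _ | y
  · rw [Equiv.removeNone_none _ (by simp [h])]
    simp only [Equiv.trans_apply, Equiv.optionCongr_apply, Option.map_none]
    rw [← Equiv.removeNone_none _ h]
    rfl
  · rw [Equiv.removeNone_some _ ⟨b y, by simp [h]⟩]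
    simp only [Equiv.trans_apply, Equiv.optionCongr_apply, Option.map_some, h]
    have e1 := Equiv.removeNone_some e ⟨y, h⟩
    rw [h] at e1
    exact congrArg (Option.map b) e1.symm

theorem _root_.PlanarGraph.extract_sumCongr {n : ℕ} (i : Fin (n + 1)) {S T : Type} (f : S ≃ T) :
    (Equiv.sumCongr (Equiv.refl _) f).trans (PlanarGraph.extract i T) =
      (PlanarGraph.extract i S).trans (Equiv.sumCongr (Equiv.refl _) f).optionCongr := by
  ext1 x
  rcases x with a | s
  · rcases Fin.eq_self_or_eq_succAbove i a with h | ⟨b, rfl⟩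
    · simp [h, PlanarGraph.extract]
    · simp [PlanarGraph.extract]
  · rfl

/-- `σ · D ≅ σ · D'` if `D ≅ D'`. -/
def Iso.lact {D D' : DecGraph X k l} (σ : Equiv.Perm (Fin l)) (f : Iso D D') :
    Iso (D.lact σ) (D'.lact σ) where
  equiv := f.equiv
  inn_eq := f.inn_eq
  out_eq := f.out_eq
  loops_eq := f.loops_eq
  wire_eq := by
    have h := f.wire_eq
    simp only [DecGraph.lact, PlanarGraph.lact]
    rw [← Equiv.trans_assoc]
    refine (congrArg (fun e => Equiv.trans e (Equiv.sumCongr σ (Equiv.refl _))) h).trans ?_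
    rw [Equiv.trans_assoc, Equiv.trans_assoc]
    congr 1
    ext1 (x | x) <;> rfl
  dec_eq := f.dec_eq

/-- `D · τ ≅ D' · τ` if `D ≅ D'`. -/
def Iso.ract {D D' : DecGraph X k l} (τ : Equiv.Perm (Fin k)) (f : Iso D D') :
    Iso (D.ract τ) (D'.ract τ) where
  equiv := f.equiv
  inn_eq := f.inn_eq
  out_eq := f.out_eq
  loops_eq := f.loops_eq
  wire_eq := by
    have h := f.wire_eq
    simp only [DecGraph.ract, PlanarGraph.ract]
    refine Eq.trans ?_
      (congrArg (fun e => Equiv.trans (Equiv.sumCongr τ (Equiv.refl _)) e) h)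
    ext1 (x | x) <;> rfl
  dec_eq := f.dec_eq

/-- `t_{i,j}(D) ≅ t_{i,j}(D')` if `D ≅ D'`. -/
noncomputable def Iso.trace {D D' : DecGraph X (k + 1) (l + 1)} (i : Fin (k + 1))
    (j : Fin (l + 1)) (f : Iso D D') : Iso (D.trace i j) (D'.trace i j) where
  equiv := f.equiv
  inn_eq := f.inn_eq
  out_eq := f.out_eq
  loops_eq := by
    have h := Equiv.congr_fun f.wire_eq (Sum.inl i)
    have h' : D'.graph.wire (Sum.inl i) = Sum.map id (PlanarGraph.slotEquiv f.equiv f.inn_eq)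
      (D.graph.wire (Sum.inl i)) := h
    have : D.graph.wire (Sum.inl i) = Sum.inl j ↔ D'.graph.wire (Sum.inl i) = Sum.inl j := by
      rw [h']
      rcases D.graph.wire (Sum.inl i) with a | a <;> simp
    classical
    unfold DecGraph.trace PlanarGraph.trace
    exact if_congr this (congrArg (· + 1) f.loops_eq) f.loops_eq
  wire_eq := by
    have h := f.wire_eq
    simp only [DecGraph.trace, PlanarGraph.trace]
    have key := Equiv.removeNone_conj
      (Equiv.sumCongr (Equiv.refl (Fin k)) (PlanarGraph.slotEquiv f.equiv f.out_eq))
      (((PlanarGraph.extract i _).symm.trans D'.graph.wire).trans (PlanarGraph.extract j _))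
      (Equiv.refl _)
    have key' := Equiv.removeNone_conj (Equiv.refl _)
      (((PlanarGraph.extract i _).symm.trans D.graph.wire).trans (PlanarGraph.extract j _))
      (Equiv.sumCongr (Equiv.refl (Fin l)) (PlanarGraph.slotEquiv f.equiv f.inn_eq))
    refine key.symm.trans (Eq.trans (congrArg _ ?_) key')
    have h1 := PlanarGraph.extract_sumCongr i (PlanarGraph.slotEquiv f.equiv f.out_eq)
    have h2 := PlanarGraph.extract_sumCongr j (PlanarGraph.slotEquiv f.equiv f.inn_eq)
    ext1 x
    obtain ⟨y, rfl⟩ := (PlanarGraph.extract i _).surjective x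
    have e1 := Equiv.congr_fun h1 y
    have e2 := Equiv.congr_fun h2 (D.graph.wire y)
    have e3 := Equiv.congr_fun h y
    simp only [Equiv.trans_apply] at e1 e2 e3
    simp only [Equiv.trans_apply, ← e1, Equiv.symm_apply_apply, e3, Equiv.optionCongr_refl,
      Equiv.refl_apply]
    exact e2
  dec_eq := f.dec_eq

theorem _root_.PlanarGraph.splitEnds_sumCongr (m n : ℕ) {V V' W W' : Type} {a : V → ℕ}
    {a' : V' → ℕ} {b : W → ℕ} {b' : W' → ℕ} (f : V ≃ W) (g : V' ≃ W')
    (hf : ∀ v, a v = b (f v)) (hg : ∀ v, a' v = b' (g v))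
    (h : ∀ x : V ⊕ V', Sum.elim a a' x = Sum.elim b b' (Equiv.sumCongr f g x)) :
    (Equiv.sumCongr (Equiv.refl _) (PlanarGraph.slotEquiv (Equiv.sumCongr f g) h)).trans
        (PlanarGraph.splitEnds m n b b') =
      (PlanarGraph.splitEnds m n a a').trans
        (Equiv.sumCongr (Equiv.sumCongr (Equiv.refl _) (PlanarGraph.slotEquiv f hf))
          (Equiv.sumCongr (Equiv.refl _) (PlanarGraph.slotEquiv g hg))) := by
  ext1 x
  rcases x with x | ⟨v | v, r⟩
  · obtain ⟨y, rfl⟩ := finSumFinEquiv.surjective x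
    rcases y with y | y <;> simp [PlanarGraph.splitEnds]
  · rfl
  · rfl

/-- `D * E ≅ D' * E'` if `D ≅ D'` and `E ≅ E'`. -/
def Iso.hmul {D D' : DecGraph X k l} {E E' : DecGraph X k' l'} (f : Iso D D') (g : Iso E E') :
    Iso (D.hmul E) (D'.hmul E') where
  equiv := Equiv.sumCongr f.equiv g.equiv
  inn_eq := by rintro (v | v); exacts [f.inn_eq v, g.inn_eq v]
  out_eq := by rintro (v | v); exacts [f.out_eq v, g.out_eq v]
  loops_eq := congrArg₂ (· + ·) f.loops_eq g.loops_eq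
  wire_eq := by
    have ho : ∀ x, Sum.elim D.graph.out E.graph.out x =
        Sum.elim D'.graph.out E'.graph.out (Equiv.sumCongr f.equiv g.equiv x) := by
      rintro (v | v); exacts [f.out_eq v, g.out_eq v]
    have hi : ∀ x, Sum.elim D.graph.inn E.graph.inn x =
        Sum.elim D'.graph.inn E'.graph.inn (Equiv.sumCongr f.equiv g.equiv x) := by
      rintro (v | v); exacts [f.inn_eq v, g.inn_eq v]
    have h1 := PlanarGraph.splitEnds_sumCongr k k' f.equiv g.equiv f.out_eq g.out_eq ho
    have h2 := PlanarGraph.splitEnds_sumCongr l l' f.equiv g.equiv f.inn_eq g.inn_eq hi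
    ext1 x
    obtain ⟨y, rfl⟩ := (PlanarGraph.splitEnds k k' _ _).symm.surjective x
    have e1 := Equiv.congr_fun h1 ((PlanarGraph.splitEnds k k' _ _).symm y)
    have e2 := Equiv.congr_fun h2 ((PlanarGraph.splitEnds l l' _ _).symm
      (Equiv.sumCongr D.graph.wire E.graph.wire y))
    have ef := Equiv.congr_fun f.wire_eq
    have eg := Equiv.congr_fun g.wire_eq
    simp only [Equiv.trans_apply, Equiv.apply_symm_apply] at e1 e2 ef eg
    have e3 : (PlanarGraph.splitEnds l l' D'.graph.inn E'.graph.inn).symm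
        (Equiv.sumCongr D'.graph.wire E'.graph.wire
          (PlanarGraph.splitEnds k k' D'.graph.out E'.graph.out
            (Equiv.sumCongr (Equiv.refl _) (PlanarGraph.slotEquiv _ ho)
              ((PlanarGraph.splitEnds k k' D.graph.out E.graph.out).symm y)))) =
        Equiv.sumCongr (Equiv.refl _) (PlanarGraph.slotEquiv _ hi)
          ((PlanarGraph.splitEnds l l' D.graph.inn E.graph.inn).symm
            (Equiv.sumCongr D.graph.wire E.graph.wire y)) := by
      rw [Equiv.symm_apply_eq]
      refine (congrArg _ e1).trans (Eq.trans ?_ e2.symm)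
      rcases y with y | y
      · exact congrArg Sum.inl (ef y)
      · exact congrArg Sum.inr (eg y)
    have e4 : (PlanarGraph.splitEnds k k' D.graph.out E.graph.out)
      ((PlanarGraph.splitEnds k k' D.graph.out E.graph.out).symm y) = y :=
        Equiv.apply_symm_apply _ _
    refine e3.trans ?_
    refine congrArg (fun z => Equiv.sumCongr (Equiv.refl _) (PlanarGraph.slotEquiv _ hi)
      ((PlanarGraph.splitEnds l l' D.graph.inn E.graph.inn).symm
        (Equiv.sumCongr D.graph.wire E.graph.wire z))) e4.symm
  dec_eq := by rintro (v | v); exacts [f.dec_eq v, g.dec_eq v]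

/-- The trivial isomorphism. -/
def Iso.refl (D : DecGraph X k l) : Iso D D where
  equiv := Equiv.refl _
  inn_eq := fun _ => rfl
  out_eq := fun _ => rfl
  loops_eq := rfl
  wire_eq := by
    have h : ∀ {V : Type} (a : V → ℕ),
        PlanarGraph.slotEquiv (a := a) (a' := a) (Equiv.refl V) (fun _ => rfl) =
          Equiv.refl _ := fun _ => rfl
    rw [h, h, Equiv.sumCongr_refl, Equiv.sumCongr_refl]
    rfl
  dec_eq := fun _ => rfl

/-! The operations respect the relations. -/

theorem Rel.lact (σ : Equiv.Perm (Fin l)) {r : DecGraph X k l →₀ K}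
    (h : Rel r) : Rel (Finsupp.lmapDomain K K (DecGraph.lact σ) r) := by
  cases h with
  | iso D D' f =>
    simp only [map_sub, Finsupp.lmapDomain_apply, Finsupp.mapDomain_single]
    exact Rel.iso _ _ (f.lact σ)
  | @add G inst d v x y =>
    simp only [map_sub, Finsupp.lmapDomain_apply, Finsupp.mapDomain_single]
    exact @Rel.add _ _ _ _ _ (G.lact σ) inst d v x y
  | @smul G inst d v a x =>
    simp only [map_sub, Finsupp.lmapDomain_apply, Finsupp.mapDomain_single]
    exact @Rel.smul _ _ _ _ _ (G.lact σ) inst d v a x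

theorem Rel.ract (τ : Equiv.Perm (Fin k)) {r : DecGraph X k l →₀ K}
    (h : Rel r) : Rel (Finsupp.lmapDomain K K (DecGraph.ract τ) r) := by
  cases h with
  | iso D D' f =>
    simp only [map_sub, Finsupp.lmapDomain_apply, Finsupp.mapDomain_single]
    exact Rel.iso _ _ (f.ract τ)
  | @add G inst d v x y =>
    simp only [map_sub, Finsupp.lmapDomain_apply, Finsupp.mapDomain_single]
    exact @Rel.add _ _ _ _ _ (G.ract τ) inst d v x y
  | @smul G inst d v a x =>
    simp only [map_sub, Finsupp.lmapDomain_apply, Finsupp.mapDomain_single]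
    exact @Rel.smul _ _ _ _ _ (G.ract τ) inst d v a x

theorem Rel.trace (i : Fin (k + 1)) (j : Fin (l + 1)) {r : DecGraph X (k + 1) (l + 1) →₀ K}
    (h : Rel r) : Rel (Finsupp.lmapDomain K K (DecGraph.trace i j) r) := by
  cases h with
  | iso D D' f =>
    simp only [map_sub, Finsupp.lmapDomain_apply, Finsupp.mapDomain_single]
    exact Rel.iso _ _ (f.trace i j)
  | @add G inst d v x y =>
    simp only [map_sub, Finsupp.lmapDomain_apply, Finsupp.mapDomain_single]
    exact @Rel.add _ _ _ _ _ (G.trace i j) inst d v x y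
  | @smul G inst d v a x =>
    simp only [map_sub, Finsupp.lmapDomain_apply, Finsupp.mapDomain_single]
    exact @Rel.smul _ _ _ _ _ (G.trace i j) inst d v a x

theorem _root_.Sum.rec_update_inl {α β : Type*} {γ : α ⊕ β → Type*} [DecidableEq α]
    [DecidableEq (α ⊕ β)] (f : ∀ a, γ (Sum.inl a)) (g : ∀ b, γ (Sum.inr b)) (a : α)
    (x : γ (Sum.inl a)) :
    (fun s => Sum.rec (Function.update f a x) g s : ∀ s, γ s) =
      Function.update (fun s => Sum.rec f g s) (Sum.inl a) x := by
  funext s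
  rcases s with s | s
  · by_cases h : s = a
    · subst h
      simp
    · simp [h]
  · simp

theorem _root_.Sum.rec_update_inr {α β : Type*} {γ : α ⊕ β → Type*} [DecidableEq β]
    [DecidableEq (α ⊕ β)] (f : ∀ a, γ (Sum.inl a)) (g : ∀ b, γ (Sum.inr b)) (b : β)
    (x : γ (Sum.inr b)) :
    (fun s => Sum.rec f (Function.update g b x) s : ∀ s, γ s) =
      Function.update (fun s => Sum.rec f g s) (Sum.inr b) x := by
  funext s
  rcases s with s | s
  · simp
  · by_cases h : s = b
    · subst h
      simp
    · simp [h]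

theorem hmul_update_left (G : PlanarGraph k l) (E : DecGraph X k' l') [DecidableEq G.V]
    [inst : DecidableEq (G.hmul E.graph).V] (d : ∀ v : G.V, X.obj (G.inn v) (G.out v)) (v : G.V)
    (x : X.obj (G.inn v) (G.out v)) :
    (⟨G, Function.update d v x⟩ : DecGraph X k l).hmul E =
      ⟨G.hmul E.graph,
        Function.update ((⟨G, d⟩ : DecGraph X k l).hmul E).dec (Sum.inl v) x⟩ :=
  congrArg (DecGraph.mk (G.hmul E.graph))
    (@Sum.rec_update_inl G.V E.graph.V
      (fun s => X.obj ((G.hmul E.graph).inn s) ((G.hmul E.graph).out s))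
      _ inst d E.dec v x)

theorem hmul_update_right (D : DecGraph X k l) (G : PlanarGraph k' l') [DecidableEq G.V]
    [inst : DecidableEq (D.graph.hmul G).V] (d : ∀ v : G.V, X.obj (G.inn v) (G.out v)) (v : G.V)
    (x : X.obj (G.inn v) (G.out v)) :
    D.hmul (⟨G, Function.update d v x⟩ : DecGraph X k' l') =
      ⟨D.graph.hmul G,
        Function.update (D.hmul (⟨G, d⟩ : DecGraph X k' l')).dec (Sum.inr v) x⟩ :=
  congrArg (DecGraph.mk (D.graph.hmul G))
    (@Sum.rec_update_inr D.graph.V G.V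
      (fun s => X.obj ((D.graph.hmul G).inn s) ((D.graph.hmul G).out s))
      _ inst D.dec d v x)

theorem Rel.hmul_left {r : DecGraph X k l →₀ K} (h : Rel r) (E : DecGraph X k' l') :
    Rel (Finsupp.lmapDomain K K (fun D => DecGraph.hmul D E) r) := by
  classical
  cases h with
  | iso D D' f =>
    simp only [map_sub, Finsupp.lmapDomain_apply, Finsupp.mapDomain_single]
    exact Rel.iso _ _ (f.hmul (Iso.refl E))
  | add G d v x y =>
    simp only [map_sub, Finsupp.lmapDomain_apply, Finsupp.mapDomain_single, hmul_update_left]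
    exact Rel.add (G.hmul E.graph) _ (Sum.inl v) x y
  | smul G d v a x =>
    simp only [map_sub, Finsupp.lmapDomain_apply, Finsupp.mapDomain_single, hmul_update_left]
    exact Rel.smul (G.hmul E.graph) _ (Sum.inl v) a x

theorem Rel.hmul_right (D : DecGraph X k l) {r : DecGraph X k' l' →₀ K} (h : Rel r) :
    Rel (Finsupp.lmapDomain K K (fun E => DecGraph.hmul D E) r) := by
  classical
  cases h with
  | iso E E' f =>
    simp only [map_sub, Finsupp.lmapDomain_apply, Finsupp.mapDomain_single]
    exact Rel.iso _ _ ((Iso.refl D).hmul f)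
  | add G d v x y =>
    simp only [map_sub, Finsupp.lmapDomain_apply, Finsupp.mapDomain_single, hmul_update_right]
    exact Rel.add (D.graph.hmul G) _ (Sum.inr v) x y
  | smul G d v a x =>
    simp only [map_sub, Finsupp.lmapDomain_apply, Finsupp.mapDomain_single, hmul_update_right]
    exact Rel.smul (D.graph.hmul G) _ (Sum.inr v) a x

/-- The linear map which is induced by a map of decorated graphs that respects the relations. -/
noncomputable def mapLin (F : DecGraph X k l → DecGraph X k' l')
    (hF : ∀ r, Rel r → Rel (Finsupp.lmapDomain K K F r)) :
    ((DecGraph X k l →₀ K) ⧸ relSpan X k l) →ₗ[K] ((DecGraph X k' l' →₀ K) ⧸ relSpan X k' l') :=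
  (relSpan X k l).mapQ (relSpan X k' l') (Finsupp.lmapDomain K K F)
    (Submodule.span_le.mpr fun r hr => Submodule.subset_span (hF r hr))

/-- The class of a decorated graph. -/
noncomputable def cls (D : DecGraph X k l) : (DecGraph X k l →₀ K) ⧸ relSpan X k l :=
  Submodule.Quotient.mk (Finsupp.single D 1)

theorem mapLin_cls (F : DecGraph X k l → DecGraph X k' l')
    (hF : ∀ r, Rel r → Rel (Finsupp.lmapDomain K K F r)) (D : DecGraph X k l) :
    mapLin F hF D.cls = (F D).cls :=
  congrArg (Submodule.Quotient.mk (p := relSpan X k' l')) Finsupp.mapDomain_single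

theorem cls_eq_of_iso {D D' : DecGraph X k l} (f : Iso D D') : D.cls = D'.cls :=
  (Submodule.Quotient.eq _).mpr (Submodule.subset_span (Rel.iso D D' f))

theorem cls_update_add (G : PlanarGraph k l) [DecidableEq G.V]
    (d : ∀ v : G.V, X.obj (G.inn v) (G.out v)) (v : G.V) (x y : X.obj (G.inn v) (G.out v)) :
    cls (⟨G, Function.update d v (x + y)⟩ : DecGraph X k l) =
      cls ⟨G, Function.update d v x⟩ + cls ⟨G, Function.update d v y⟩ := by
  refine (Submodule.Quotient.eq _).mpr ?_
  rw [← sub_sub]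
  exact Submodule.subset_span (Rel.add G d v x y)

theorem cls_update_smul (G : PlanarGraph k l) [DecidableEq G.V]
    (d : ∀ v : G.V, X.obj (G.inn v) (G.out v)) (v : G.V) (a : K)
    (x : X.obj (G.inn v) (G.out v)) :
    cls (⟨G, Function.update d v (a • x)⟩ : DecGraph X k l) =
      a • cls ⟨G, Function.update d v x⟩ := by
  refine (Submodule.Quotient.eq _).mpr ?_
  have h := Rel.smul G d v a x
  rw [← mul_one a, ← smul_eq_mul, ← Finsupp.smul_single, smul_eq_mul, mul_one] at h
  exact Submodule.subset_span h

theorem update_corolla [DecidableEq (PlanarGraph.corolla k l).V]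
    (d : ∀ v, X.obj ((PlanarGraph.corolla k l).inn v) ((PlanarGraph.corolla k l).out v))
    (v : (PlanarGraph.corolla k l).V) (x : X.obj k l) :
    (⟨PlanarGraph.corolla k l, Function.update d v x⟩ : DecGraph X k l) = corolla x :=
  congrArg (DecGraph.mk (PlanarGraph.corolla k l)) (funext fun _ => Function.update_self v _ d)

theorem cls_corolla_add (x y : X.obj k l) :
    (corolla (x + y)).cls = (corolla x).cls + (corolla y).cls := by
  have : DecidableEq (PlanarGraph.corolla k l).V := inferInstanceAs (DecidableEq Unit)
  have h := cls_update_add (X := X) (PlanarGraph.corolla k l) (fun _ => x) () x y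
  have e := fun z : X.obj k l => congrArg cls (update_corolla (X := X) (fun _ => x) () z)
  exact (e (x + y)).symm.trans (h.trans (congrArg₂ (· + ·) (e x) (e y)))

theorem cls_corolla_smul (a : K) (x : X.obj k l) :
    (corolla (a • x)).cls = a • (corolla x).cls := by
  have : DecidableEq (PlanarGraph.corolla k l).V := inferInstanceAs (DecidableEq Unit)
  have h := cls_update_smul (X := X) (PlanarGraph.corolla k l) (fun _ => x) () a x
  have e := fun z : X.obj k l => congrArg cls (update_corolla (X := X) (fun _ => x) () z)
  exact (e (a • x)).symm.trans (h.trans (congrArg (a • ·) (e x)))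

/-- The bilinear extension of the horizontal concatenation of decorated graphs. -/
noncomputable def mulLin (X : SymData.{u, w} K) (k l k' l' : ℕ) :
    ((DecGraph X k l →₀ K) ⧸ relSpan X k l) →ₗ[K] ((DecGraph X k' l' →₀ K) ⧸ relSpan X k' l') →ₗ[K]
      ((DecGraph X (k + k') (l + l') →₀ K) ⧸ relSpan X (k + k') (l + l')) :=
  (relSpan X k l).liftQ
    (Finsupp.linearCombination K fun D : DecGraph X k l =>
      mapLin (fun E : DecGraph X k' l' => D.hmul E) fun _ h => h.hmul_right D)
    (Submodule.span_le.mpr fun r hr => by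
      have key : ∀ (E : DecGraph X k' l') (r : DecGraph X k l →₀ K),
          (Finsupp.linearCombination K (fun D : DecGraph X k l =>
            mapLin (fun E : DecGraph X k' l' => D.hmul E) fun _ h => h.hmul_right D) r) E.cls =
          (relSpan X (k + k') (l + l')).mkQ
            (Finsupp.lmapDomain K K (fun D => DecGraph.hmul D E) r) := by
        intro E r
        induction r using Finsupp.induction_linear with
        | zero => simp
        | add f g hf hg => simp only [map_add, LinearMap.add_apply, hf, hg]
        | single D a =>
          rw [Finsupp.linearCombination_single, LinearMap.smul_apply, mapLin_cls,
            Finsupp.lmapDomain_apply, Finsupp.mapDomain_single, cls,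
            ← Submodule.mkQ_apply, ← map_smul, Finsupp.smul_single, smul_eq_mul, mul_one]
      rw [SetLike.mem_coe, LinearMap.mem_ker]
      refine Submodule.linearMap_qext _ (Finsupp.lhom_ext' fun E => LinearMap.ext_ring ?_)
      exact (key E r).trans
        ((Submodule.Quotient.mk_eq_zero _).mpr (Submodule.subset_span (Rel.hmul_left hr E))))

end DecGraph

/-! ### The TraP of decorated planar graphs -/

/-- `PGr(X)`: the space `PGr(X)(k,l)` is spanned by the isomorphism classes of planar graphs with
`k` inputs and `l` outputs that are decorated by `X`, the decorations being linear in each vertex;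
i.e. it is the direct sum, over the planar graphs `G` up to isomorphism, of the tensor
products of the spaces `X(i(v), o(v))` over the vertices `v` of `G` (up to the automorphisms of
`G`). The operations are those of graphs. -/
noncomputable def PGr {K : Type w} [Field K] (X : SymData.{u, w} K) :
    TraPData.{max 1 u w, w} K where
  obj k l := (DecGraph X k l →₀ K) ⧸ DecGraph.relSpan X k l
  lact σ := DecGraph.mapLin (DecGraph.lact σ) fun _ h => h.lact σ
  ract τ := DecGraph.mapLin (DecGraph.ract τ) fun _ h => h.ract τ
  mul := DecGraph.mulLin X _ _ _ _
  one := (DecGraph.empty X).cls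
  unit := (DecGraph.edge X).cls
  tr i j := DecGraph.mapLin (DecGraph.trace i j) fun _ h => h.trace i j

/-- The inclusion `ι : X → PGr(X)`, `x ↦ G(x)`. -/
noncomputable def PGr.incl {K : Type w} [Field K] (X : SymData.{u, w} K) (k l : ℕ) :
    X.obj k l →ₗ[K] (PGr X).obj k l where
  toFun x := (DecGraph.corolla x).cls
  map_add' := DecGraph.cls_corolla_add
  map_smul' := DecGraph.cls_corolla_smul

/-! All operations of `PGr X` come from graphs and are extended linearly, so each TraP axiom is an
equality or an isomorphism of decorated graphs. A partial trace acts on the bijection `wire` by a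
relational rule (`traceWire_eq_iff`): a new edge is an old one, or an old edge ending at the output
`j` continued by the old edge beginning at the input `i`. With this rule the axioms become case
checks on ends of edges, and the loops are counted separately.

Injectivity of `ι`: a corolla has one vertex, whose slots are ordered. Reading off the decoration of
corolla-shaped graphs, and sending every other graph to `0`, is therefore compatible with the
relations and gives a linear retraction of `ι`.

Existence: the value of a graph in `P` is forced. Multiply the images of all decorations, put beside
them one copy of `I` for each external input, rename the outputs of this product by `wire`, trace
over all ingoing slots of the vertices, and multiply by one traced copy of `I` for each loop
(`glue`, `labEval`). The difficulty is that `P` only knows numbered inputs and outputs, while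
vertices and edges have no order. Therefore the axioms are first restated for elements whose inputs
and outputs are labelled by arbitrary finite types (`Lab`); block permutations, deletions and cycles
become relabellings along bijections. Products and traces over a finite type are then independent of
the enumeration, because permutations are generated by exchanges of the two outermost steps.

The crux is `ltr_lmul_lunit`: tracing the input of one additional copy of `I` changes the renaming
of the outputs exactly as `Equiv.removeNone` does, and produces a loop in exactly the right case.
Compatibility of the evaluation with traces (`ltr_glue`) follows; `lmul_glue` handles products and
`glue_sumComm` shows that corollas receive the prescribed values.

Uniqueness: the operations generate every graph from corollas, `I` and `I₀`. A loop is a factor, the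
trace of `I`; an internal edge can be cut and is restored by a trace; an input-output edge is a
factor `I`; what remains is a disjoint union of corollas up to relabelling (`IsClosed.all`). -/

namespace PlanarGraph

/-! ### Wirings of partial traces as relations between ends -/

/-- The beginning or end of an edge, seen before the external index `i` has been removed. -/
def skip {n : ℕ} (i : Fin (n + 1)) {S : Type} : Fin n ⊕ S → Fin (n + 1) ⊕ S :=
  Sum.map i.succAbove id

@[simp] theorem skip_inl {n : ℕ} (i : Fin (n + 1)) {S : Type} (a : Fin n) :
    skip (S := S) i (Sum.inl a) = Sum.inl (i.succAbove a) := rfl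

@[simp] theorem skip_inr {n : ℕ} (i : Fin (n + 1)) {S : Type} (s : S) :
    skip i (Sum.inr s) = Sum.inr s := rfl

theorem skip_injective {n : ℕ} (i : Fin (n + 1)) {S : Type} :
    Function.Injective (skip i : Fin n ⊕ S → _) :=
  Sum.map_injective.mpr ⟨Fin.succAbove_right_injective, Function.injective_id⟩

theorem skip_ne {n : ℕ} (i : Fin (n + 1)) {S : Type} (x : Fin n ⊕ S) :
    skip i x ≠ Sum.inl i := by
  rcases x with x | x
  · simp
  · simp

theorem eq_inl_or_eq_skip {n : ℕ} (i : Fin (n + 1)) {S : Type} (x : Fin (n + 1) ⊕ S) :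
    x = Sum.inl i ∨ ∃ y, x = skip i y := by
  rcases x with x | x
  · rcases Fin.eq_self_or_eq_succAbove i x with rfl | ⟨y, rfl⟩
    · exact Or.inl rfl
    · exact Or.inr ⟨Sum.inl y, rfl⟩
  · exact Or.inr ⟨Sum.inr x, rfl⟩

theorem extract_symm_some {n : ℕ} (i : Fin (n + 1)) {S : Type} (x : Fin n ⊕ S) :
    (extract i S).symm (some x) = skip i x := rfl

theorem extract_symm_none {n : ℕ} (i : Fin (n + 1)) {S : Type} :
    (extract i S).symm none = Sum.inl i := rfl

@[simp] theorem extract_skip {n : ℕ} (i : Fin (n + 1)) {S : Type} (x : Fin n ⊕ S) :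
    extract i S (skip i x) = some x := by
  rw [← extract_symm_some, Equiv.apply_symm_apply]

@[simp] theorem extract_self {n : ℕ} (i : Fin (n + 1)) {S : Type} :
    extract i S (Sum.inl i) = none := by
  rw [← extract_symm_none, Equiv.apply_symm_apply]

/-- The wiring of a partial trace. -/
def traceWire {k l : ℕ} {S T : Type} (i : Fin (k + 1)) (j : Fin (l + 1))
    (w : Fin (k + 1) ⊕ S ≃ Fin (l + 1) ⊕ T) : Fin k ⊕ S ≃ Fin l ⊕ T :=
  Equiv.removeNone (((extract i _).symm.trans w).trans (extract j _))

/-- `Equiv.removeNone` sends a beginning whose image is the removed point to the image of that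
point. Since `w` is injective, the detour always succeeds: if another beginning leads to `j`, the
input `i` does not. In the relational form, iterated traces can be unfolded by rewriting. -/
theorem traceWire_eq_iff {k l : ℕ} {S T : Type} (i : Fin (k + 1)) (j : Fin (l + 1))
    (w : Fin (k + 1) ⊕ S ≃ Fin (l + 1) ⊕ T) (x : Fin k ⊕ S) (y : Fin l ⊕ T) :
    traceWire i j w x = y ↔
      w (skip i x) = skip j y ∨ w (skip i x) = Sum.inl j ∧ w (Sum.inl i) = skip j y := by
  rcases eq_inl_or_eq_skip j (w (skip i x)) with h | ⟨z, h⟩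
  · rcases eq_inl_or_eq_skip j (w (Sum.inl i)) with h' | ⟨z, h'⟩
    · exact absurd (w.injective (h.trans h'.symm)) (skip_ne i x)
    · have e := Equiv.removeNone_none (((extract i _).symm.trans w).trans (extract j _)) (x := x)
        (by simp [extract_symm_some, h])
      simp only [Equiv.trans_apply, extract_symm_none, h', extract_skip, Option.some.injEq] at e
      rw [traceWire, e, h, h']
      simp [(skip_ne j y).symm, (skip_injective j).eq_iff]
  · have e := Equiv.removeNone_some (((extract i _).symm.trans w).trans (extract j _)) (x := x)
      ⟨z, by simp [extract_symm_some, h]⟩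
    simp only [Equiv.trans_apply, extract_symm_some, h, extract_skip, Option.some.injEq] at e
    rw [traceWire, e, h]
    simp [skip_ne j z, (skip_injective j).eq_iff]

theorem traceWire_ext {k l : ℕ} {S T : Type} (i : Fin (k + 1)) (j : Fin (l + 1))
    (w : Fin (k + 1) ⊕ S ≃ Fin (l + 1) ⊕ T) (w' : Fin k ⊕ S ≃ Fin l ⊕ T)
    (h : ∀ x, w (skip i x) = skip j (w' x) ∨
      w (skip i x) = Sum.inl j ∧ w (Sum.inl i) = skip j (w' x)) : traceWire i j w = w' :=
  Equiv.ext fun x => (traceWire_eq_iff i j w x _).mpr (h x)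

/-- Transport of the external indices of a wiring. -/
def relabelWire {k l k' l' : ℕ} {S T : Type} (f : Fin k ≃ Fin k') (g : Fin l ≃ Fin l')
    (w : Fin k ⊕ S ≃ Fin l ⊕ T) : Fin k' ⊕ S ≃ Fin l' ⊕ T :=
  ((Equiv.sumCongr f (Equiv.refl _)).symm.trans w).trans (Equiv.sumCongr g (Equiv.refl _))

end PlanarGraph

/-! ### Reduction of `PGr X` to single graphs; the actions of the symmetric groups -/

namespace DecGraph

open PlanarGraph

variable {K : Type w} [Field K] {X : SymData.{u, w} K} {k l k' l' k'' l'' : ℕ}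

/-- Transport of the external indices of a decorated graph. -/
def relabel (f : Fin k ≃ Fin k') (g : Fin l ≃ Fin l') (D : DecGraph X k l) :
    DecGraph X k' l' where
  graph := { D.graph with wire := relabelWire f g D.graph.wire }
  dec := D.dec

/-- Replace the loops and the wiring of a decorated graph. -/
def rewire (D : DecGraph X k l) (n : ℕ)
    (w : Fin k' ⊕ (Σ v, Fin (D.graph.out v)) ≃ Fin l' ⊕ (Σ v, Fin (D.graph.inn v))) :
    DecGraph X k' l' where
  graph := ⟨D.graph.V, D.graph.finite, D.graph.inn, D.graph.out, n, w⟩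
  dec := D.dec

theorem relabel_refl (D : DecGraph X k l) :
    D.relabel (Equiv.refl _) (Equiv.refl _) = D := by
  have h : relabelWire (Equiv.refl _) (Equiv.refl _) D.graph.wire = D.graph.wire := by
    ext1 (x | x)
    · simp [relabelWire]
    · simp [relabelWire]
  exact congrArg (D.rewire D.graph.loops) h

/-- The class of a decorated graph as an element of `PGr X`. -/
noncomputable def toPGr (D : DecGraph X k l) : (PGr X).obj k l := D.cls

theorem toPGr_eq_of_iso {D D' : DecGraph X k l} (f : Iso D D') : D.toPGr = D'.toPGr :=
  cls_eq_of_iso f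

/-- On graphs, a change of arity along an equality affects only the external indices and leaves
vertices and slots alone. So the casts in the axioms become bijections of the same kind as the
permutations in the actions. -/
theorem cast_toPGr (hk : k = k') (hl : l = l') (D : DecGraph X k l) :
    (PGr X).cast hk hl D.toPGr = (D.relabel (finCongr hk) (finCongr hl)).toPGr := by
  subst hk hl
  exact congrArg toPGr (relabel_refl D).symm

theorem lact_eq_relabel (σ : Equiv.Perm (Fin l)) (D : DecGraph X k l) :
    D.lact σ = D.relabel (Equiv.refl _) σ :=
  congrArg (D.rewire D.graph.loops) (by ext1 (x | x) <;> rfl)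

/-- The inverse appears because the input formerly called `τ i` receives the name `i`. -/
theorem ract_eq_relabel (τ : Equiv.Perm (Fin k)) (D : DecGraph X k l) :
    D.ract τ = D.relabel τ.symm (Equiv.refl _) :=
  congrArg (D.rewire D.graph.loops) (by ext1 (x | x) <;> simp [relabelWire])

open Classical in
theorem trace_eq (i : Fin (k + 1)) (j : Fin (l + 1)) (D : DecGraph X (k + 1) (l + 1)) :
    D.trace i j = D.rewire
      (if D.graph.wire (Sum.inl i) = Sum.inl j then D.graph.loops + 1 else D.graph.loops)
      (traceWire i j D.graph.wire) := rfl

theorem PGr_lact (σ : Equiv.Perm (Fin l)) (D : DecGraph X k l) :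
    (PGr X).lact σ D.toPGr = (D.lact σ).toPGr :=
  mapLin_cls _ (fun _ h => h.lact σ) _

theorem PGr_ract (τ : Equiv.Perm (Fin k)) (D : DecGraph X k l) :
    (PGr X).ract τ D.toPGr = (D.ract τ).toPGr :=
  mapLin_cls _ (fun _ h => h.ract τ) _

theorem PGr_tr (i : Fin (k + 1)) (j : Fin (l + 1)) (D : DecGraph X (k + 1) (l + 1)) :
    (PGr X).tr i j D.toPGr = (D.trace i j).toPGr :=
  mapLin_cls _ (fun _ h => h.trace i j) _

theorem PGr_mul (D : DecGraph X k l) (E : DecGraph X k' l') :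
    (PGr X).mul D.toPGr E.toPGr = (D.hmul E).toPGr := by
  have h : (PGr X).mul D.toPGr = mapLin (fun E : DecGraph X k' l' => D.hmul E)
      fun _ h => h.hmul_right D :=
    (Finsupp.linearCombination_single K (1 : K) D).trans (one_smul _ _)
  exact (LinearMap.congr_fun h E.toPGr).trans (mapLin_cls _ _ _)

theorem PGr_induction {C : (PGr X).obj k l → Prop} (zero : C 0)
    (graph : ∀ D : DecGraph X k l, C D.toPGr) (add : ∀ p q, C p → C q → C (p + q))
    (smul : ∀ (a : K) p, C p → C (a • p)) (p : (PGr X).obj k l) : C p := by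
  obtain ⟨r, rfl⟩ := Submodule.Quotient.mk_surjective (relSpan X k l) p
  induction r using Finsupp.induction with
  | zero => exact zero
  | single_add D a r _ _ hr =>
    refine add (Submodule.Quotient.mk (p := relSpan X k l) (Finsupp.single D a))
      (Submodule.Quotient.mk (p := relSpan X k l) r) ?_ hr
    have e : (a • D.toPGr : (PGr X).obj k l) =
        Submodule.Quotient.mk (p := relSpan X k l) (Finsupp.single D a) := by
      refine (Submodule.Quotient.mk_smul (p := relSpan X k l) a _).symm.trans ?_
      rw [Finsupp.smul_single, smul_eq_mul, mul_one]
    exact e ▸ smul a _ (graph D)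

/-- `cast` as a linear map. -/
def _root_.SymData.castLin (X : SymData.{u, w} K) (hk : k = k') (hl : l = l') :
    X.obj k l →ₗ[K] X.obj k' l' where
  toFun := X.cast hk hl
  map_add' := by subst hk hl; exact fun _ _ => rfl
  map_smul' := by subst hk hl; exact fun _ _ => rfl

/-- Classes of single graphs span `PGr X`. The TraP axioms, the properties of the evaluation and the
uniqueness of the morphism are all reduced to graphs in this way. -/
theorem PGr_hom_ext {M : Type*} [AddCommGroup M] [Module K M] {f g : (PGr X).obj k l →ₗ[K] M}
    (h : ∀ D : DecGraph X k l, f D.toPGr = g D.toPGr) : f = g :=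
  LinearMap.ext fun p => PGr_induction (C := fun p => f p = g p) (by rw [map_zero, map_zero]) h
    (fun p q hp hq => by rw [map_add, map_add, hp, hq])
    (fun a p hp => by rw [map_smul, map_smul, hp]) p

theorem PGr_eq {M : Type*} [AddCommGroup M] [Module K M] (f g : (PGr X).obj k l →ₗ[K] M)
    (h : ∀ D : DecGraph X k l, f D.toPGr = g D.toPGr) (p : (PGr X).obj k l) : f p = g p :=
  LinearMap.congr_fun (PGr_hom_ext h) p

theorem PGr_eq₂ {M : Type*} [AddCommGroup M] [Module K M]
    (f g : (PGr X).obj k l →ₗ[K] (PGr X).obj k' l' →ₗ[K] M)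
    (h : ∀ (D : DecGraph X k l) (D' : DecGraph X k' l'), f D.toPGr D'.toPGr = g D.toPGr D'.toPGr)
    (p : (PGr X).obj k l) (p' : (PGr X).obj k' l') : f p p' = g p p' :=
  LinearMap.congr_fun (PGr_eq f g (fun D => PGr_hom_ext (h D)) p) p'

theorem isSymModule_PGr : (PGr X).toSymData.IsSymModule where
  one_lact p := by
    refine PGr_eq ((PGr X).lact 1) LinearMap.id (fun D => ?_) p
    rw [PGr_lact, lact_eq_relabel]
    exact congrArg toPGr D.relabel_refl
  ract_one p := by
    refine PGr_eq ((PGr X).ract 1) LinearMap.id (fun D => ?_) p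
    rw [PGr_ract, ract_eq_relabel]
    exact congrArg toPGr D.relabel_refl
  mul_lact σ σ' p := by
    refine PGr_eq ((PGr X).lact (σ * σ')) ((PGr X).lact σ ∘ₗ (PGr X).lact σ') (fun D => ?_) p
    rw [LinearMap.comp_apply, PGr_lact, PGr_lact, PGr_lact]
    refine congrArg toPGr (congrArg (D.rewire D.graph.loops) (Equiv.ext fun x => ?_))
    simp only [DecGraph.lact, PlanarGraph.lact, Equiv.trans_apply]
    rcases D.graph.wire x with y | y <;> rfl
  ract_mul τ τ' p := by
    refine PGr_eq ((PGr X).ract (τ * τ')) ((PGr X).ract τ' ∘ₗ (PGr X).ract τ) (fun D => ?_) p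
    rw [LinearMap.comp_apply, PGr_ract, PGr_ract, PGr_ract]
    refine congrArg toPGr (congrArg (D.rewire D.graph.loops) (Equiv.ext fun x => ?_))
    rcases x with x | x <;> rfl
  lact_ract σ τ p := by
    refine PGr_eq ((PGr X).lact σ ∘ₗ (PGr X).ract τ) ((PGr X).ract τ ∘ₗ (PGr X).lact σ)
      (fun D => ?_) p
    rw [LinearMap.comp_apply, LinearMap.comp_apply, PGr_ract, PGr_lact, PGr_lact, PGr_ract]
    rfl

/-! ### Two partial traces -/

/-- Both sides perform the same two gluings. An edge of the result is a chain of at most three old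
edges passing through glued pairs, a description that does not depend on the order of the gluings.
-/
theorem traceWire_traceWire {S T : Type} (i : Fin (k + 2)) (j : Fin (l + 2)) (i' : Fin (k + 1))
    (j' : Fin (l + 1)) (w : Fin (k + 2) ⊕ S ≃ Fin (l + 2) ⊕ T) :
    traceWire i' j' (traceWire i j w) =
      traceWire (i'.predAbove i) (j'.predAbove j)
        (traceWire (i.succAbove i') (j.succAbove j') w) := by
  have hs : ∀ {n : ℕ} {S : Type} (i : Fin (n + 2)) (i' : Fin (n + 1)) (x : Fin n ⊕ S),
      skip (i.succAbove i') (skip (i'.predAbove i) x) = skip i (skip i' x) := by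
    rintro n S i i' (x | x)
    · exact congrArg Sum.inl (Fin.succAbove_succAbove_succAbove_predAbove i i' x)
    · rfl
  refine (Equiv.ext fun x => ?_ : _ = traceWire i' j' (traceWire i j w)).symm
  rw [traceWire_eq_iff, traceWire_eq_iff, traceWire_eq_iff, traceWire_eq_iff]
  obtain ⟨y, hy⟩ : ∃ y, y = traceWire i' j' (traceWire i j w) x := ⟨_, rfl⟩
  rw [← hy]
  have h := hy.symm
  rw [traceWire_eq_iff, traceWire_eq_iff, traceWire_eq_iff, traceWire_eq_iff] at h
  simp only [hs] at h ⊢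
  simp only [skip_inl, Fin.succAbove_succAbove_predAbove] at h ⊢
  -- The expansion contains a spurious chain in which one beginning leads both to a glued output and
  -- to the final end. The final end differs from both glued outputs, which rules this chain out.
  have h1 := skip_ne j (skip j' y)
  have h2 : skip j (skip j' y) ≠ Sum.inl (j.succAbove j') := by
    rw [← skip_inl]
    exact (skip_injective j).ne (skip_ne j' y)
  grind

end DecGraph

/-! ### Ends of edges in disjoint unions -/

namespace PlanarGraph

section

variable {V V' : Type} (m n : ℕ) (a : V → ℕ) (a' : V' → ℕ)

/-- The edge ends of the first part of a disjoint union. -/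
def endL (x : Fin m ⊕ Σ v, Fin (a v)) : Fin (m + n) ⊕ Σ x : V ⊕ V', Fin (Sum.elim a a' x) :=
  (splitEnds m n a a').symm (Sum.inl x)

/-- The edge ends of the second part of a disjoint union. -/
def endR (x : Fin n ⊕ Σ v, Fin (a' v)) : Fin (m + n) ⊕ Σ x : V ⊕ V', Fin (Sum.elim a a' x) :=
  (splitEnds m n a a').symm (Sum.inr x)

theorem eq_endL_or_eq_endR (x : Fin (m + n) ⊕ Σ x : V ⊕ V', Fin (Sum.elim a a' x)) :
    (∃ y, x = endL m n a a' y) ∨ ∃ y, x = endR m n a a' y := by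
  rcases h : splitEnds m n a a' x with y | y
  · exact Or.inl ⟨y, by rw [endL, ← h, Equiv.symm_apply_apply]⟩
  · exact Or.inr ⟨y, by rw [endR, ← h, Equiv.symm_apply_apply]⟩

end

section

variable {k l k' l' : ℕ} (G : PlanarGraph k l) (G' : PlanarGraph k' l')

theorem hmul_wire_endL (x : Fin k ⊕ Σ v, Fin (G.out v)) :
    (G.hmul G').wire (endL k k' G.out G'.out x) = endL l l' G.inn G'.inn (G.wire x) :=
  congrArg (fun y => (splitEnds l l' G.inn G'.inn).symm (Equiv.sumCongr G.wire G'.wire y))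
    ((splitEnds k k' G.out G'.out).apply_symm_apply (Sum.inl x))

theorem hmul_wire_endR (x : Fin k' ⊕ Σ v, Fin (G'.out v)) :
    (G.hmul G').wire (endR k k' G.out G'.out x) = endR l l' G.inn G'.inn (G'.wire x) :=
  congrArg (fun y => (splitEnds l l' G.inn G'.inn).symm (Equiv.sumCongr G.wire G'.wire y))
    ((splitEnds k k' G.out G'.out).apply_symm_apply (Sum.inr x))

end

theorem relabelWire_apply {k l k' l' : ℕ} {S T : Type} (f : Fin k ≃ Fin k') (g : Fin l ≃ Fin l')
    (w : Fin k ⊕ S ≃ Fin l ⊕ T) (x : Fin k ⊕ S) :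
    relabelWire f g w (Sum.map f id x) = Sum.map g id (w x) := by
  rcases x with x | x <;> simp [relabelWire]

end PlanarGraph

namespace DecGraph

open PlanarGraph

variable {K : Type w} [Field K] {X : SymData.{u, w} K} {k l k' l' k'' l'' : ℕ}

/-- An isomorphism after a transport of the external indices. -/
def isoOfRelabel {D : DecGraph X k l} {D' : DecGraph X k' l'} (f : Fin k ≃ Fin k')
    (g : Fin l ≃ Fin l') (e : D.graph.V ≃ D'.graph.V)
    (inn_eq : ∀ v, D.graph.inn v = D'.graph.inn (e v))
    (out_eq : ∀ v, D.graph.out v = D'.graph.out (e v))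
    (loops_eq : D.graph.loops = D'.graph.loops)
    (wire_eq : ∀ x, D'.graph.wire (Sum.map f (slotEquiv e out_eq) x) =
      Sum.map g (slotEquiv e inn_eq) (D.graph.wire x))
    (dec_eq : ∀ v, X.cast (inn_eq v) (out_eq v) (D.dec v) = D'.dec (e v)) :
    Iso (D.relabel f g) D' where
  equiv := e
  inn_eq := inn_eq
  out_eq := out_eq
  loops_eq := loops_eq
  dec_eq := dec_eq
  wire_eq := by
    ext1 x
    obtain ⟨y, rfl⟩ : ∃ y, x = Sum.map f id y := by
      rcases x with x | x
      · exact ⟨Sum.inl (f.symm x), by simp⟩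
      · exact ⟨Sum.inr x, rfl⟩
    have h1 : Sum.map id (slotEquiv e out_eq) (Sum.map f id y) =
        Sum.map f (slotEquiv e out_eq) y := by rcases y with y | y <;> rfl
    have h2 : ∀ z, Sum.map id (slotEquiv e inn_eq) (Sum.map g id z) =
        Sum.map g (slotEquiv e inn_eq) z := by rintro (z | z) <;> rfl
    exact (congrArg _ h1).trans ((wire_eq y).trans
      ((h2 _).symm.trans (congrArg _ (relabelWire_apply f g D.graph.wire y).symm)))

theorem relabel_wire (f : Fin k ≃ Fin k') (g : Fin l ≃ Fin l') (D : DecGraph X k l) (x) :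
    (D.relabel f g).graph.wire (Sum.map f id x) = Sum.map g id (D.graph.wire x) :=
  relabelWire_apply f g D.graph.wire x

/-! ### Axioms of the horizontal concatenation -/

/-- The wiring of a disjoint union acts on each factor separately, so it suffices that the
embeddings of the ends of each of the three factors match in the two bracketings. -/
def hmulAssocIso (D : DecGraph X k l) (D' : DecGraph X k' l') (D'' : DecGraph X k'' l'') :
    Iso (((D.hmul D').hmul D'').relabel (finCongr (Nat.add_assoc k k' k''))
      (finCongr (Nat.add_assoc l l' l''))) (D.hmul (D'.hmul D'')) := by
  refine isoOfRelabel _ _ (Equiv.sumAssoc _ _ _) (by rintro ((v | v) | v) <;> rfl)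
    (by rintro ((v | v) | v) <;> rfl) (Nat.add_assoc _ _ _) ?_ (by rintro ((v | v) | v) <;> rfl)
  have hL : ∀ {V V' V'' : Type} (m n p : ℕ) (a : V → ℕ) (a' : V' → ℕ) (a'' : V'' → ℕ) (h) (x),
      Sum.map (finCongr (Nat.add_assoc m n p)) (slotEquiv (Equiv.sumAssoc V V' V'') h)
        (endL (m + n) p (Sum.elim a a') a'' (endL m n a a' x)) =
      endL m (n + p) a (Sum.elim a' a'') x := by
    rintro V V' V'' m n p a a' a'' h (x | ⟨v, r⟩)
    · exact congrArg Sum.inl (Fin.ext rfl)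
    · rfl
  have hM : ∀ {V V' V'' : Type} (m n p : ℕ) (a : V → ℕ) (a' : V' → ℕ) (a'' : V'' → ℕ) (h) (x),
      Sum.map (finCongr (Nat.add_assoc m n p)) (slotEquiv (Equiv.sumAssoc V V' V'') h)
        (endL (m + n) p (Sum.elim a a') a'' (endR m n a a' x)) =
      endR m (n + p) a (Sum.elim a' a'') (endL n p a' a'' x) := by
    rintro V V' V'' m n p a a' a'' h (x | ⟨v, r⟩)
    · exact congrArg Sum.inl (Fin.ext rfl)
    · rfl
  have hR : ∀ {V V' V'' : Type} (m n p : ℕ) (a : V → ℕ) (a' : V' → ℕ) (a'' : V'' → ℕ) (h) (x),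
      Sum.map (finCongr (Nat.add_assoc m n p)) (slotEquiv (Equiv.sumAssoc V V' V'') h)
        (endR (m + n) p (Sum.elim a a') a'' x) =
      endR m (n + p) a (Sum.elim a' a'') (endR n p a' a'' x) := by
    rintro V V' V'' m n p a a' a'' h (x | ⟨v, r⟩)
    · exact congrArg Sum.inl (Fin.ext (Nat.add_assoc _ _ _))
    · rfl
  intro x
  rcases eq_endL_or_eq_endR _ _ _ _ x with ⟨x, rfl⟩ | ⟨x, rfl⟩
  · rcases eq_endL_or_eq_endR _ _ _ _ x with ⟨x, rfl⟩ | ⟨x, rfl⟩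
    · refine (congrArg _ (hL ..)).trans ((hmul_wire_endL _ _ _).trans (Eq.symm ?_))
      refine (congrArg _ ((hmul_wire_endL _ _ _).trans (congrArg _ (hmul_wire_endL _ _ _)))).trans ?_
      exact hL ..
    · refine (congrArg _ (hM ..)).trans ((hmul_wire_endR _ _ _).trans
        ((congrArg _ (hmul_wire_endL _ _ _)).trans (Eq.symm ?_)))
      refine (congrArg _ ((hmul_wire_endL _ _ _).trans (congrArg _ (hmul_wire_endR _ _ _)))).trans ?_
      exact hM ..
  · refine (congrArg _ (hR ..)).trans ((hmul_wire_endR _ _ _).trans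
      ((congrArg _ (hmul_wire_endR _ _ _)).trans (Eq.symm ?_)))
    exact (congrArg _ (hmul_wire_endR _ _ _)).trans (hR ..)

def emptyHmulIso (D : DecGraph X k l) :
    Iso (((empty X).hmul D).relabel (finCongr (Nat.zero_add k)) (finCongr (Nat.zero_add l))) D := by
  refine isoOfRelabel _ _ (Equiv.emptySum Empty _) (by rintro (v | v); exacts [v.elim, rfl])
    (by rintro (v | v); exacts [v.elim, rfl]) (Nat.zero_add _) ?_
    (by rintro (v | v); exacts [v.elim, rfl])
  have hR : ∀ {V : Type} (m : ℕ) (a : V → ℕ) (h) (x),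
      Sum.map (finCongr (Nat.zero_add m)) (slotEquiv (Equiv.emptySum Empty V) h)
        (endR 0 m Empty.elim a x) = x := by
    rintro V m a h (x | ⟨v, r⟩)
    · exact congrArg Sum.inl (Fin.ext (Nat.zero_add _))
    · rfl
  intro x
  rcases eq_endL_or_eq_endR _ _ _ _ x with ⟨x, rfl⟩ | ⟨x, rfl⟩
  · rcases x with x | ⟨v, r⟩
    exacts [x.elim0, v.elim]
  · refine (congrArg _ (hR ..)).trans (Eq.symm ?_)
    exact (congrArg _ (hmul_wire_endR _ _ _)).trans (hR ..)

def hmulEmptyIso (D : DecGraph X k l) :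
    Iso ((D.hmul (empty X)).relabel (Equiv.refl _) (Equiv.refl _)) D := by
  refine isoOfRelabel _ _ (Equiv.sumEmpty _ Empty) (by rintro (v | v); exacts [rfl, v.elim])
    (by rintro (v | v); exacts [rfl, v.elim]) (Nat.add_zero _) ?_
    (by rintro (v | v); exacts [rfl, v.elim])
  have hL : ∀ {V : Type} (m : ℕ) (a : V → ℕ) (h) (x),
      Sum.map (Equiv.refl _) (slotEquiv (Equiv.sumEmpty V Empty) h)
        (endL m 0 a Empty.elim x) = x := by
    rintro V m a h (x | ⟨v, r⟩) <;> rfl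
  intro x
  rcases eq_endL_or_eq_endR _ _ _ _ x with ⟨x, rfl⟩ | ⟨x, rfl⟩
  · refine (congrArg _ (hL ..)).trans (Eq.symm ?_)
    exact (congrArg _ (hmul_wire_endL _ _ _)).trans (hL ..)
  · rcases x with x | ⟨v, r⟩
    exacts [x.elim0, v.elim]

theorem tensor_castAdd {m n : ℕ} (σ : Equiv.Perm (Fin m)) (τ : Equiv.Perm (Fin n)) (i : Fin m) :
    TraPPerm.tensor σ τ (Fin.castAdd n i) = Fin.castAdd n (σ i) := by
  simp [TraPPerm.tensor]

theorem tensor_natAdd {m n : ℕ} (σ : Equiv.Perm (Fin m)) (τ : Equiv.Perm (Fin n)) (i : Fin n) :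
    TraPPerm.tensor σ τ (Fin.natAdd m i) = Fin.natAdd m (τ i) := by
  simp [TraPPerm.tensor]

/-- Both sides have literally the same vertices, loops and decorations, so only the wirings differ
in form and an equality of graphs holds, not merely an isomorphism. -/
theorem act_hmul_act (D : DecGraph X k l) (D' : DecGraph X k' l')
    (σ : Equiv.Perm (Fin l)) (τ : Equiv.Perm (Fin k))
    (σ' : Equiv.Perm (Fin l')) (τ' : Equiv.Perm (Fin k')) :
    ((D.ract τ).lact σ).hmul ((D'.ract τ').lact σ') =
      ((D.hmul D').ract (TraPPerm.tensor τ τ')).lact (TraPPerm.tensor σ σ') := by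
  refine congrArg ((D.hmul D').rewire (D.graph.loops + D'.graph.loops)) (Equiv.ext fun x => ?_)
  have hL : ∀ {V V' : Type} {m n : ℕ} (a : V → ℕ) (a' : V' → ℕ) (σ : Equiv.Perm (Fin m))
      (τ : Equiv.Perm (Fin n)) (x), Sum.map (TraPPerm.tensor σ τ) id (endL m n a a' x) =
        endL m n a a' (Sum.map σ id x) := by
    rintro V V' m n a a' σ τ (x | ⟨v, r⟩)
    · exact congrArg Sum.inl (tensor_castAdd σ τ x)
    · rfl
  have hR : ∀ {V V' : Type} {m n : ℕ} (a : V → ℕ) (a' : V' → ℕ) (σ : Equiv.Perm (Fin m))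
      (τ : Equiv.Perm (Fin n)) (x), Sum.map (TraPPerm.tensor σ τ) id (endR m n a a' x) =
        endR m n a a' (Sum.map τ id x) := by
    rintro V V' m n a a' σ τ (x | ⟨v, r⟩)
    · exact congrArg Sum.inl (tensor_natAdd σ τ x)
    · rfl
  rcases eq_endL_or_eq_endR _ _ _ _ x with ⟨x, rfl⟩ | ⟨x, rfl⟩
  · refine (hmul_wire_endL ((D.ract τ).lact σ).graph ((D'.ract τ').lact σ').graph x).trans
      (Eq.symm ?_)
    refine (congrArg (Sum.map (TraPPerm.tensor σ σ') id) ((congrArg (D.hmul D').graph.wire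
      (hL ..)).trans (hmul_wire_endL D.graph D'.graph _))).trans ?_
    exact hL ..
  · refine (hmul_wire_endR ((D.ract τ).lact σ).graph ((D'.ract τ').lact σ').graph x).trans
      (Eq.symm ?_)
    refine (congrArg (Sum.map (TraPPerm.tensor σ σ') id) ((congrArg (D.hmul D').graph.wire
      (hR ..)).trans (hmul_wire_endR D.graph D'.graph _))).trans ?_
    exact hR ..

theorem comm_castAdd (m n : ℕ) (i : Fin m) :
    TraPPerm.comm m n (Fin.castAdd n i) = Fin.cast (Nat.add_comm n m) (Fin.natAdd n i) := by
  simp [TraPPerm.comm]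

theorem comm_natAdd (m n : ℕ) (i : Fin n) :
    TraPPerm.comm m n (Fin.natAdd m i) = Fin.cast (Nat.add_comm n m) (Fin.castAdd m i) := by
  simp [TraPPerm.comm]

/-- The commutation of a horizontal concatenation, before the external indices are exchanged. -/
def hmulCommIso (D : DecGraph X k l) (D' : DecGraph X k' l') :
    Iso ((D.hmul D').relabel (Equiv.refl _) (TraPPerm.comm l l'))
      (((D'.hmul D).relabel (finCongr (Nat.add_comm k' k)) (finCongr (Nat.add_comm l' l))).ract
        (TraPPerm.comm k k')) := by
  refine isoOfRelabel _ _ (Equiv.sumComm _ _) (by rintro (v | v) <;> rfl)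
    (by rintro (v | v) <;> rfl) (Nat.add_comm _ _) ?_ (by rintro (v | v) <;> rfl)
  have hL : ∀ {V V' : Type} (m n : ℕ) (a : V → ℕ) (a' : V' → ℕ) (h) (x),
      Sum.map (TraPPerm.comm m n) (slotEquiv (Equiv.sumComm V V') h) (endL m n a a' x) =
        Sum.map (finCongr (Nat.add_comm n m)) id (endR n m a' a x) := by
    rintro V V' m n a a' h (x | ⟨v, r⟩)
    · exact congrArg Sum.inl (comm_castAdd m n x)
    · rfl
  have hR : ∀ {V V' : Type} (m n : ℕ) (a : V → ℕ) (a' : V' → ℕ) (h) (x),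
      Sum.map (TraPPerm.comm m n) (slotEquiv (Equiv.sumComm V V') h) (endR m n a a' x) =
        Sum.map (finCongr (Nat.add_comm n m)) id (endL n m a' a x) := by
    rintro V V' m n a a' h (x | ⟨v, r⟩)
    · exact congrArg Sum.inl (comm_natAdd m n x)
    · rfl
  have hs : ∀ {S T : Type} (f : S ≃ T) (x : Fin (k + k') ⊕ S),
      Sum.map (TraPPerm.comm k k') id (Sum.map (Equiv.refl _) f x) =
        Sum.map (TraPPerm.comm k k') f x := by rintro S T f (x | x) <;> rfl
  intro x
  refine (congrArg ((D'.hmul D).relabel (finCongr (Nat.add_comm k' k))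
    (finCongr (Nat.add_comm l' l))).graph.wire (hs _ x)).trans ?_
  rcases eq_endL_or_eq_endR _ _ _ _ x with ⟨x, rfl⟩ | ⟨x, rfl⟩
  · refine (congrArg _ (hL ..)).trans ((relabel_wire _ _ (D'.hmul D) _).trans
      ((congrArg _ (hmul_wire_endR _ _ _)).trans (Eq.symm ?_)))
    exact (congrArg _ (hmul_wire_endL _ _ _)).trans (hL ..)
  · refine (congrArg _ (hR ..)).trans ((relabel_wire _ _ (D'.hmul D) _).trans
      ((congrArg _ (hmul_wire_endL _ _ _)).trans (Eq.symm ?_)))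
    exact (congrArg _ (hmul_wire_endR _ _ _)).trans (hR ..)

end DecGraph

namespace DecGraph

open PlanarGraph

variable {K : Type w} [Field K] {X : SymData.{u, w} K} {k l k' l' k'' l'' : ℕ}

/-! ### Axioms of the partial traces -/

theorem rewire_congr (D : DecGraph X k l) {n n' : ℕ}
    {w w' : Fin k' ⊕ (Σ v, Fin (D.graph.out v)) ≃ Fin l' ⊕ (Σ v, Fin (D.graph.inn v))}
    (hn : n = n') (hw : w = w') : D.rewire n w = D.rewire n' w' := by
  rw [hn, hw]

/-- Naturality of the trace: the relational rule is preserved by all maps of ends that are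
compatible with the wirings and with the glued ends. They need not be bijective, so that the
embedding of one factor into a disjoint union is covered along with relabellings. -/
theorem _root_.PlanarGraph.traceWire_map {S T S' T' : Type} {i : Fin (k + 1)} {j : Fin (l + 1)}
    {i' : Fin (k' + 1)} {j' : Fin (l' + 1)} (w : Fin (k + 1) ⊕ S ≃ Fin (l + 1) ⊕ T)
    (w' : Fin (k' + 1) ⊕ S' ≃ Fin (l' + 1) ⊕ T') {a : Fin (k + 1) ⊕ S → Fin (k' + 1) ⊕ S'}
    {b : Fin (l + 1) ⊕ T → Fin (l' + 1) ⊕ T'} {a' : Fin k ⊕ S → Fin k' ⊕ S'}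
    {b' : Fin l ⊕ T → Fin l' ⊕ T'} (hw : ∀ x, w' (a x) = b (w x)) (hi : a (Sum.inl i) = Sum.inl i')
    (hj : b (Sum.inl j) = Sum.inl j') (ha : ∀ x, a (skip i x) = skip i' (a' x))
    (hb : ∀ x, b (skip j x) = skip j' (b' x)) (x : Fin k ⊕ S) :
    traceWire i' j' w' (a' x) = b' (traceWire i j w x) := by
  rw [traceWire_eq_iff, ← ha, ← hb, ← hi, ← hj, hw, hw]
  obtain ⟨y, hy⟩ : ∃ y, traceWire i j w x = y := ⟨_, rfl⟩
  rw [hy]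
  rcases (traceWire_eq_iff _ _ _ _ _).mp hy with h | ⟨h, h'⟩
  · exact Or.inl (congrArg b h)
  · exact Or.inr ⟨congrArg b h, congrArg b h'⟩

theorem _root_.PlanarGraph.traceWire_of_eq_skip {S T : Type} {i : Fin (k + 1)} {j : Fin (l + 1)}
    (w : Fin (k + 1) ⊕ S ≃ Fin (l + 1) ⊕ T) {x : Fin k ⊕ S} {y : Fin l ⊕ T}
    (h : w (skip i x) = skip j y) : traceWire i j w x = y :=
  (traceWire_eq_iff _ _ _ _ _).mpr (Or.inl h)

theorem _root_.PlanarGraph.wire_eq_inl_iff {S T S' T' : Type} {i : Fin k} {j : Fin l}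
    {i' : Fin k'} {j' : Fin l'} (w : Fin k ⊕ S ≃ Fin l ⊕ T)
    (w' : Fin k' ⊕ S' ≃ Fin l' ⊕ T') {a : Fin k ⊕ S → Fin k' ⊕ S'}
    {b : Fin l ⊕ T → Fin l' ⊕ T'} (hb : Function.Injective b) (hw : ∀ x, w' (a x) = b (w x))
    (hi : a (Sum.inl i) = Sum.inl i') (hj : b (Sum.inl j) = Sum.inl j') :
    w' (Sum.inl i') = Sum.inl j' ↔ w (Sum.inl i) = Sum.inl j := by
  rw [← hi, ← hj, hw, hb.eq_iff]

theorem loops_trace_of_eq {i : Fin (k + 1)} {j : Fin (l + 1)} {D : DecGraph X (k + 1) (l + 1)}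
    (h : D.graph.wire (Sum.inl i) = Sum.inl j) :
    (D.trace i j).graph.loops = D.graph.loops + 1 := if_pos h

theorem loops_trace_of_ne {i : Fin (k + 1)} {j : Fin (l + 1)} {D : DecGraph X (k + 1) (l + 1)}
    (h : D.graph.wire (Sum.inl i) ≠ Sum.inl j) :
    (D.trace i j).graph.loops = D.graph.loops := if_neg h

/-- Two partial traces of decorated graphs with the same underlying loops create the same number
of loops if their wirings agree. -/
theorem loops_trace_congr {i : Fin (k + 1)} {j : Fin (l + 1)} {D : DecGraph X (k + 1) (l + 1)}
    {i' : Fin (k' + 1)} {j' : Fin (l' + 1)} {D' : DecGraph X (k' + 1) (l' + 1)} (n : ℕ)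
    (hn : D.graph.loops = D'.graph.loops + n)
    (h : D.graph.wire (Sum.inl i) = Sum.inl j ↔ D'.graph.wire (Sum.inl i') = Sum.inl j') :
    (D.trace i j).graph.loops = (D'.trace i' j').graph.loops + n := by
  by_cases c : D.graph.wire (Sum.inl i) = Sum.inl j
  · rw [loops_trace_of_eq c, loops_trace_of_eq (h.mp c), hn, Nat.add_right_comm]
  · rw [loops_trace_of_ne c, loops_trace_of_ne (mt h.mpr c), hn]

/-- Besides the wirings, the loops must be compared. In either order one loop arises for each of the
edges `i → j` and `i.succAbove i' → j.succAbove j'` that is present, and one if these two inputs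
lead crosswise to the two outputs. -/
theorem trace_trace (i : Fin (k + 2)) (j : Fin (l + 2)) (i' : Fin (k + 1)) (j' : Fin (l + 1))
    (D : DecGraph X (k + 2) (l + 2)) :
    (D.trace i j).trace i' j' =
      (D.trace (i.succAbove i') (j.succAbove j')).trace (i'.predAbove i) (j'.predAbove j) := by
  refine D.rewire_congr ?_ (traceWire_traceWire i j i' j' D.graph.wire)
  have h1 : (D.trace i j).graph.wire (Sum.inl i') = Sum.inl j' ↔ _ :=
    traceWire_eq_iff i j D.graph.wire (Sum.inl i') (Sum.inl j')
  have h2 : (D.trace (i.succAbove i') (j.succAbove j')).graph.wire (Sum.inl (i'.predAbove i)) =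
    Sum.inl (j'.predAbove j) ↔ _ := traceWire_eq_iff (i.succAbove i') (j.succAbove j') D.graph.wire
      (Sum.inl (i'.predAbove i)) (Sum.inl (j'.predAbove j))
  simp only [skip_inl, Fin.succAbove_succAbove_predAbove] at h1 h2
  change ((D.trace i j).trace i' j').graph.loops =
    ((D.trace (i.succAbove i') (j.succAbove j')).trace (i'.predAbove i) (j'.predAbove j)).graph.loops
  have hj := Fin.succAbove_ne j j'
  have hl : ∀ {k l : ℕ} (i : Fin (k + 1)) (j : Fin (l + 1)) (D : DecGraph X (k + 1) (l + 1))
      {p : Prop} [Decidable p], (D.graph.wire (Sum.inl i) = Sum.inl j ↔ p) →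
      (D.trace i j).graph.loops = D.graph.loops + if p then 1 else 0 := by
    intro k l i j D p _ h
    split_ifs with c
    · exact loops_trace_of_eq (h.mpr c)
    · exact loops_trace_of_ne (mt h.mp c)
  classical
  rw [hl _ _ _ h1, hl _ _ _ h2, hl _ _ _ Iff.rfl, hl _ _ _ Iff.rfl]
  -- A direct edge excludes the crosswise circuit, as the two outputs differ; the circuit itself is
  -- symmetric in the two gluings.
  by_cases c1 : D.graph.wire (Sum.inl i) = Sum.inl j <;>
  by_cases c2 : D.graph.wire (Sum.inl (i.succAbove i')) = Sum.inl (j.succAbove j') <;>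
  simp [c1, c2, hj, hj.symm, and_comm]

/-- `delete α p` is what `α` induces between the complements of `α.symm p` and `p`, read through
their increasing enumerations. As `succAbove` is injective, this equation determines it. -/
theorem succAbove_delete {n : ℕ} (α : Equiv.Perm (Fin (n + 1))) (p : Fin (n + 1)) (x : Fin n) :
    p.succAbove (TraPPerm.delete α p x) = α ((α.symm p).succAbove x) := by
  have h := (finSuccAboveEquiv p).apply_symm_apply
    ((α.subtypeEquiv fun _ => not_congr (Equiv.eq_symm_apply α)) (finSuccAboveEquiv (α.symm p) x))
  exact congrArg Subtype.val h

/-- Naturality for the maps `τ.symm` on inputs and `σ` on outputs: they carry the glued ends `τ i`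
and `σ.symm j` to `i` and `j`, and on the remaining indices they induce the deleted permutations,
inverted on the inputs. -/
theorem trace_act (i : Fin (k + 1)) (j : Fin (l + 1))
    (σ : Equiv.Perm (Fin (l + 1))) (τ : Equiv.Perm (Fin (k + 1))) (D : DecGraph X (k + 1) (l + 1)) :
    ((D.ract τ).lact σ).trace i j =
      ((D.trace (τ i) (σ.symm j)).ract (TraPPerm.delete τ (τ i))).lact (TraPPerm.delete σ j) := by
  have hs : ∀ {n : ℕ} {S : Type} (σ : Equiv.Perm (Fin (n + 1))) (j) (x : Fin n ⊕ S),
      Sum.map σ id (skip (σ.symm j) x) = skip j (Sum.map (TraPPerm.delete σ j) id x) := by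
    rintro n S σ j (x | x)
    · exact congrArg Sum.inl (succAbove_delete σ j x).symm
    · rfl
  have hs' : ∀ {n : ℕ} {S : Type} (σ : Equiv.Perm (Fin (n + 1))) (i) (x : Fin n ⊕ S),
      Sum.map σ.symm id (skip (σ i) x) =
        skip i (Sum.map (TraPPerm.delete σ (σ i)).symm id x) := by
    intro n S σ i x
    obtain ⟨x, rfl⟩ : ∃ y, x = Sum.map (TraPPerm.delete σ (σ i)) id y :=
      ⟨Sum.map (TraPPerm.delete σ (σ i)).symm id x, by rcases x with x | x <;> simp⟩
    rw [← hs, Equiv.symm_apply_apply]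
    rcases x with x | x <;> simp
  have hw : ∀ x, ((D.ract τ).lact σ).graph.wire (Sum.map τ.symm id x) =
      Sum.map σ id (D.graph.wire x) := by
    rintro (x | x)
    · exact congrArg (fun x => Sum.map σ id (D.graph.wire (Sum.inl x))) (τ.apply_symm_apply x)
    · rfl
  have hi : ∀ {S : Type}, Sum.map τ.symm id (Sum.inl (τ i) : Fin (k + 1) ⊕ S) = Sum.inl i := by
    simp
  have hj : ∀ {S : Type}, Sum.map σ id (Sum.inl (σ.symm j) : Fin (l + 1) ⊕ S) = Sum.inl j := by
    simp
  refine D.rewire_congr ?_ (Equiv.ext fun x => ?_)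
  · exact loops_trace_congr (D := (D.ract τ).lact σ) (D' := D) 0 rfl
      (wire_eq_inl_iff D.graph.wire ((D.ract τ).lact σ).graph.wire
        (Sum.map_injective.mpr ⟨σ.injective, Function.injective_id⟩) hw hi hj)
  · have h := traceWire_map D.graph.wire ((D.ract τ).lact σ).graph.wire hw hi hj (hs' τ i) (hs σ j)
      (Sum.map (TraPPerm.delete τ (τ i)) id x)
    have e : Sum.map (TraPPerm.delete τ (τ i)).symm id
        (Sum.map (TraPPerm.delete τ (τ i)) id x) = x := by rcases x with x | x <;> simp
    exact (congrArg _ e.symm).trans h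

theorem cast_succAbove_castAdd {m n : ℕ} (i : Fin (m + 1)) (x : Fin m) :
    (Fin.cast (Nat.add_right_comm m 1 n) (Fin.castAdd n i)).succAbove (Fin.castAdd n x) =
      Fin.cast (Nat.add_right_comm m 1 n) (Fin.castAdd n (i.succAbove x)) := by
  ext
  simp [Fin.succAbove, Fin.lt_def]
  split_ifs <;> rfl

theorem cast_succAbove_natAdd {m n : ℕ} (i : Fin (m + 1)) (x : Fin n) :
    (Fin.cast (Nat.add_right_comm m 1 n) (Fin.castAdd n i)).succAbove (Fin.natAdd m x) =
      Fin.cast (Nat.add_right_comm m 1 n) (Fin.natAdd (m + 1) x) := by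
  ext
  have := i.2
  simp [Fin.succAbove, Fin.lt_def]
  split_ifs <;> simp <;> omega

theorem natAdd_succAbove_castAdd {m n : ℕ} (i : Fin (n + 1)) (x : Fin m) :
    Fin.succAbove (n := m + n) (Fin.natAdd m i) (Fin.castAdd n x) = Fin.castAdd (n + 1) x := by
  have := x.2
  rw [Fin.succAbove_of_castSucc_lt]
  · rfl
  · simp only [Fin.lt_def, Fin.val_castSucc, Fin.val_castAdd, Fin.val_natAdd]
    omega

theorem natAdd_succAbove_natAdd {m n : ℕ} (i : Fin (n + 1)) (x : Fin n) :
    Fin.succAbove (n := m + n) (Fin.natAdd m i) (Fin.natAdd m x) =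
      Fin.natAdd m (i.succAbove x) := by
  ext
  simp [Fin.succAbove, Fin.lt_def]
  split_ifs <;> rfl

/-- On the ends of `D` this is naturality for the embedding of `D` into the disjoint union; the
edges of `D'` meet neither glued end and are kept. -/
theorem trace_hmul_left (i : Fin (k + 1)) (j : Fin (l + 1)) (D : DecGraph X (k + 1) (l + 1))
    (D' : DecGraph X k' l') :
    ((D.hmul D').relabel (finCongr (Nat.add_right_comm k 1 k'))
      (finCongr (Nat.add_right_comm l 1 l'))).trace
        (Fin.cast (Nat.add_right_comm k 1 k') (Fin.castAdd k' i))
        (Fin.cast (Nat.add_right_comm l 1 l') (Fin.castAdd l' j)) =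
      (D.trace i j).hmul D' := by
  have hL : ∀ {V V' : Type} (m n : ℕ) (a : V → ℕ) (a' : V' → ℕ) (i : Fin (m + 1)) (x),
      Sum.map (finCongr (Nat.add_right_comm m 1 n)) id (endL (m + 1) n a a' (skip i x)) =
        skip (Fin.cast (Nat.add_right_comm m 1 n) (Fin.castAdd n i)) (endL m n a a' x) := by
    rintro V V' m n a a' i (x | ⟨v, r⟩)
    · exact congrArg Sum.inl (cast_succAbove_castAdd i x).symm
    · rfl
  have hR : ∀ {V V' : Type} (m n : ℕ) (a : V → ℕ) (a' : V' → ℕ) (i : Fin (m + 1)) (x),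
      skip (Fin.cast (Nat.add_right_comm m 1 n) (Fin.castAdd n i)) (endR m n a a' x) =
        Sum.map (finCongr (Nat.add_right_comm m 1 n)) id (endR (m + 1) n a a' x) := by
    rintro V V' m n a a' i (x | ⟨v, r⟩)
    · exact congrArg Sum.inl (cast_succAbove_natAdd i x)
    · rfl
  have hwL : ∀ x, ((D.hmul D').relabel (finCongr (Nat.add_right_comm k 1 k'))
      (finCongr (Nat.add_right_comm l 1 l'))).graph.wire (Sum.map
        (finCongr (Nat.add_right_comm k 1 k')) id (endL (k + 1) k' _ _ x)) =
      Sum.map (finCongr (Nat.add_right_comm l 1 l')) id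
        (endL (l + 1) l' _ _ (D.graph.wire x)) := fun x =>
    (relabel_wire _ _ (D.hmul D') _).trans (congrArg _ (hmul_wire_endL _ _ _))
  have hwR : ∀ x, ((D.hmul D').relabel (finCongr (Nat.add_right_comm k 1 k'))
      (finCongr (Nat.add_right_comm l 1 l'))).graph.wire (Sum.map
        (finCongr (Nat.add_right_comm k 1 k')) id (endR (k + 1) k' _ _ x)) =
      Sum.map (finCongr (Nat.add_right_comm l 1 l')) id
        (endR (l + 1) l' _ _ (D'.graph.wire x)) := fun x =>
    (relabel_wire _ _ (D.hmul D') _).trans (congrArg _ (hmul_wire_endR _ _ _))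
  refine (D.hmul D').rewire_congr ?_ (Equiv.ext fun x => ?_)
  · have hinj : Function.Injective fun x => Sum.map (finCongr (Nat.add_right_comm l 1 l')) id
        (endL (l + 1) l' D.graph.inn D'.graph.inn x) :=
      (Sum.map_injective.mpr ⟨(finCongr _).injective, Function.injective_id⟩).comp
        ((splitEnds (l + 1) l' D.graph.inn D'.graph.inn).symm.injective.comp Sum.inl_injective)
    -- The loops of `D'` are a constant summand on both sides.
    exact loops_trace_congr (D := (D.hmul D').relabel _ _) (D' := D) D'.graph.loops rfl
      (wire_eq_inl_iff (i := i) (j := j) D.graph.wire _ hinj hwL rfl rfl)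
  · rcases eq_endL_or_eq_endR _ _ _ _ x with ⟨x, rfl⟩ | ⟨x, rfl⟩
    · have h := traceWire_map (a := fun x => Sum.map (finCongr (Nat.add_right_comm k 1 k')) id
          (endL (k + 1) k' D.graph.out D'.graph.out x))
        (b := fun x => Sum.map (finCongr (Nat.add_right_comm l 1 l')) id
          (endL (l + 1) l' D.graph.inn D'.graph.inn x)) D.graph.wire _ hwL rfl rfl
        (hL k k' D.graph.out D'.graph.out i) (hL l l' D.graph.inn D'.graph.inn j) x
      exact h.trans (hmul_wire_endL (D.trace i j).graph D'.graph x).symm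
    · refine (traceWire_of_eq_skip _ ?_).trans
        (hmul_wire_endR (D.trace i j).graph D'.graph x).symm
      exact (congrArg _ (hR ..)).trans ((hwR x).trans (hR ..).symm)

theorem trace_hmul_right (i : Fin (k' + 1)) (j : Fin (l' + 1)) (D : DecGraph X k l)
    (D' : DecGraph X (k' + 1) (l' + 1)) :
    DecGraph.trace (k := k + k') (l := l + l') (Fin.natAdd k i) (Fin.natAdd l j) (D.hmul D') =
      D.hmul (D'.trace i j) := by
  have hL : ∀ {V V' : Type} (m n : ℕ) (a : V → ℕ) (a' : V' → ℕ) (i : Fin (n + 1)) (x),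
      skip (n := m + n) (Fin.natAdd m i) (endL m n a a' x) = endL m (n + 1) a a' x := by
    rintro V V' m n a a' i (x | ⟨v, r⟩)
    · exact congrArg Sum.inl (natAdd_succAbove_castAdd i x)
    · rfl
  have hR : ∀ {V V' : Type} (m n : ℕ) (a : V → ℕ) (a' : V' → ℕ) (i : Fin (n + 1)) (x),
      endR m (n + 1) a a' (skip i x) = skip (n := m + n) (Fin.natAdd m i) (endR m n a a' x) := by
    rintro V V' m n a a' i (x | ⟨v, r⟩)
    · exact congrArg Sum.inl (natAdd_succAbove_natAdd i x).symm
    · rfl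
  have hwL := hmul_wire_endL D.graph D'.graph
  have hwR := hmul_wire_endR D.graph D'.graph
  refine (D.hmul D').rewire_congr ?_ (Equiv.ext fun x => ?_)
  · have hinj : Function.Injective (endR l (l' + 1) D.graph.inn D'.graph.inn) :=
      (splitEnds l (l' + 1) D.graph.inn D'.graph.inn).symm.injective.comp Sum.inr_injective
    exact (loops_trace_congr (k := k + k') (l := l + l') (D := D.hmul D') (D' := D')
      D.graph.loops (Nat.add_comm _ _)
      (wire_eq_inl_iff (i := i) (j := j) D'.graph.wire _ hinj hwR rfl rfl)).trans
      (Nat.add_comm _ _)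
  · rcases eq_endL_or_eq_endR _ _ _ _ x with ⟨x, rfl⟩ | ⟨x, rfl⟩
    · refine (traceWire_of_eq_skip (k := k + k') (l := l + l') _ ?_).trans
        (hmul_wire_endL D.graph (D'.trace i j).graph x).symm
      exact (congrArg _ (hL ..)).trans ((hwL x).trans (hL ..).symm)
    · exact (traceWire_map (k' := k + k') (l' := l + l') D'.graph.wire _ hwR rfl rfl
        (hR k k' D.graph.out D'.graph.out i) (hR l l' D.graph.inn D'.graph.inn j) x).trans
        (hmul_wire_endR D.graph (D'.trace i j).graph x).symm

/-! ### Axioms of the unit -/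

theorem one_add_succAbove_zero {n : ℕ} (x : Fin n) :
    (0 : Fin (n + 1)).succAbove x = Fin.cast (Nat.add_comm 1 n) (Fin.natAdd 1 x) := by
  ext
  simp

theorem last_succAbove_castAdd {n : ℕ} (x : Fin n) :
    (Fin.last n).succAbove x = Fin.castAdd 1 x := by
  simp
  rfl

/-- Gluing an output to the input of an input-output edge on the left. -/
noncomputable def traceUnitHmulLeftIso (j : Fin (l + 1)) (D : DecGraph X k (l + 1)) :
    Iso (D.relabel (Equiv.refl _) j.cycleRange)
      ((((edge X).hmul D).relabel (finCongr (Nat.add_comm 1 k))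
        (finCongr (Nat.add_comm 1 (l + 1)))).trace 0 j.succ) := by
  have hw0 : (((edge X).hmul D).relabel (finCongr (Nat.add_comm 1 k))
      (finCongr (Nat.add_comm 1 (l + 1)))).graph.wire (Sum.inl 0) = Sum.inl 0 :=
    (relabel_wire _ _ ((edge X).hmul D) (endL 1 k _ _ (Sum.inl 0))).trans
      (congrArg _ (hmul_wire_endL (edge X).graph D.graph (Sum.inl 0)))
  have hw : ∀ x, (((edge X).hmul D).relabel (finCongr (Nat.add_comm 1 k))
      (finCongr (Nat.add_comm 1 (l + 1)))).graph.wire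
        (Sum.map (finCongr (Nat.add_comm 1 k)) id (endR 1 k _ _ x)) = _ := fun x =>
    (relabel_wire _ _ ((edge X).hmul D) _).trans
      (congrArg _ (hmul_wire_endR (edge X).graph D.graph x))
  refine isoOfRelabel _ _ (Equiv.emptySum Empty _).symm (fun _ => rfl) (fun _ => rfl) ?_ ?_
    (fun _ => rfl)
  · refine ((loops_trace_of_ne fun h => ?_).trans (Nat.zero_add _)).symm
    -- No loop arises: the input `0` leads to the output `0`, while the glued output is `j.succ`.
    exact (Fin.succ_ne_zero j).symm (Sum.inl_injective (hw0.symm.trans h))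
  · intro x
    refine (traceWire_eq_iff _ _ _ _ _).mpr ?_
    have hs : ∀ {V : Type} (m : ℕ) (a : V → ℕ) (h : ∀ v, a v = Sum.elim Empty.elim a
        ((Equiv.emptySum Empty V).symm v)) (x),
        skip (0 : Fin (m + 1)) (Sum.map (Equiv.refl _)
          (slotEquiv (Equiv.emptySum Empty V).symm h) x) =
        Sum.map (finCongr (Nat.add_comm 1 m)) id (endR 1 m Empty.elim a x) := by
      rintro V m a h (x | ⟨v, r⟩)
      · exact congrArg Sum.inl (one_add_succAbove_zero x)
      · rfl
    have e1 : ∀ z, ((((edge X).hmul D).relabel (finCongr (Nat.add_comm 1 k))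
        (finCongr (Nat.add_comm 1 (l + 1)))).graph.wire (skip 0 (Sum.map (Equiv.refl _)
          (slotEquiv (Equiv.emptySum Empty D.graph.V).symm fun _ => rfl) x)) = z) ↔
        Sum.map (finCongr (Nat.add_comm 1 (l + 1))) id
          (endR 1 (l + 1) Empty.elim D.graph.inn (D.graph.wire x)) = z := fun z =>
      Eq.congr ((congrArg _ (hs k D.graph.out (fun _ => rfl) x)).trans (hw x)) rfl
    refine (or_congr (e1 _) (and_congr (e1 _) (Eq.congr hw0 rfl))).mpr ?_
    -- The edge that ended at `j` is continued through the copy of `I` and now ends at the output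
    -- `0`; the outputs before `j` move up by one and those after `j` stay. This is the cycle `(0,
    -- 1, …, j)`.
    rcases D.graph.wire x with y | ⟨v, r⟩
    · rcases Fin.eq_self_or_eq_succAbove j y with rfl | ⟨y, rfl⟩
      · refine Or.inr ⟨congrArg Sum.inl (Fin.ext (Nat.add_comm _ _)), congrArg Sum.inl ?_⟩
        change 0 = y.succ.succAbove (y.cycleRange y)
        rw [Fin.cycleRange_self, Fin.succ_succAbove_zero]
      · refine Or.inl (congrArg Sum.inl ?_)
        change _ = j.succ.succAbove (j.cycleRange (j.succAbove y))
        rw [Fin.cycleRange_succAbove, Fin.succ_succAbove_succ]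
        exact Fin.ext (Nat.add_comm _ _)
    · exact Or.inl rfl

/-- Gluing the output of an input-output edge on the left to an input. -/
noncomputable def traceUnitHmulRightIso (i : Fin (k + 1)) (D : DecGraph X (k + 1) l) :
    Iso (D.relabel i.cycleRange (Equiv.refl _))
      ((((edge X).hmul D).relabel (finCongr (Nat.add_comm 1 (k + 1)))
        (finCongr (Nat.add_comm 1 l))).trace i.succ 0) := by
  have hw0 : (((edge X).hmul D).relabel (finCongr (Nat.add_comm 1 (k + 1)))
      (finCongr (Nat.add_comm 1 l))).graph.wire (Sum.inl 0) = Sum.inl 0 :=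
    (relabel_wire _ _ ((edge X).hmul D) (endL 1 (k + 1) _ _ (Sum.inl 0))).trans
      (congrArg _ (hmul_wire_endL (edge X).graph D.graph (Sum.inl 0)))
  have hw : ∀ x, (((edge X).hmul D).relabel (finCongr (Nat.add_comm 1 (k + 1)))
      (finCongr (Nat.add_comm 1 l))).graph.wire
        (Sum.map (finCongr (Nat.add_comm 1 (k + 1))) id (endR 1 (k + 1) _ _ x)) = _ := fun x =>
    (relabel_wire _ _ ((edge X).hmul D) _).trans
      (congrArg _ (hmul_wire_endR (edge X).graph D.graph x))
  have hs : ∀ {V : Type} (m : ℕ) (a : V → ℕ) (h : ∀ v, a v = Sum.elim Empty.elim a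
      ((Equiv.emptySum Empty V).symm v)) (x),
      skip (0 : Fin (m + 1)) (Sum.map (Equiv.refl _)
        (slotEquiv (Equiv.emptySum Empty V).symm h) x) =
      Sum.map (finCongr (Nat.add_comm 1 m)) id (endR 1 m Empty.elim a x) := by
    rintro V m a h (x | ⟨v, r⟩)
    · exact congrArg Sum.inl (one_add_succAbove_zero x)
    · rfl
  have hi : Sum.inl i.succ = Sum.map (finCongr (Nat.add_comm 1 (k + 1))) id
      (endR 1 (k + 1) Empty.elim D.graph.out (Sum.inl i)) :=
    congrArg Sum.inl (Fin.ext (Nat.add_comm _ _))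
  refine isoOfRelabel _ _ (Equiv.emptySum Empty _).symm (fun _ => rfl) (fun _ => rfl) ?_ ?_
    (fun _ => rfl)
  · refine ((loops_trace_of_ne fun h => ?_).trans (Nat.zero_add _)).symm
    exact (Fin.succ_ne_zero i).symm (Sum.inl_injective
      ((Equiv.injective _) (hw0.trans h.symm)))
  · intro x
    refine (traceWire_eq_iff _ _ _ _ _).mpr ?_
    have e2 := hs l D.graph.inn (fun _ => rfl) (D.graph.wire x)
    -- Dually, the edge that began at the input `i` now begins at the input `0` of the copy of `I`.
    rcases x with x | ⟨v, r⟩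
    · rcases Fin.eq_self_or_eq_succAbove i x with rfl | ⟨y, rfl⟩
      · refine Or.inr ⟨(congrArg _ (congrArg Sum.inl ?_)).trans hw0,
          (congrArg _ hi).trans ((hw _).trans e2.symm)⟩
        change x.succ.succAbove (x.cycleRange x) = 0
        rw [Fin.cycleRange_self, Fin.succ_succAbove_zero]
      · refine Or.inl ((congrArg _ (congrArg Sum.inl ?_)).trans ((hw _).trans e2.symm))
        change i.succ.succAbove (i.cycleRange (i.succAbove y)) = _
        rw [Fin.cycleRange_succAbove, Fin.succ_succAbove_succ]
        exact Fin.ext (Nat.add_comm _ _)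
    · exact Or.inl ((hw _).trans e2.symm)

theorem castSucc_succAbove_last {n : ℕ} (j : Fin (n + 1)) :
    j.castSucc.succAbove (Fin.last n) = Fin.last (n + 1) := by
  rw [Fin.succAbove_of_le_castSucc _ _ (Fin.castSucc_le_castSucc_iff.mpr (Fin.le_last j)),
    Fin.succ_last]

theorem cycleIcc_inv_self {n : ℕ} (j : Fin (n + 1)) :
    (Fin.cycleIcc j (Fin.last n))⁻¹ j = Fin.last n := by
  rw [Equiv.Perm.inv_eq_iff_eq, Fin.cycleIcc_of_last (Fin.le_last j)]

/-- Together with `cycleIcc_inv_self` this determines the inverse cycle: `j` becomes the last index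
and the others close the gap in increasing order. That is the effect of prolonging the edge at `j`
by a copy of `I` placed at the end. -/
theorem cycleIcc_inv_succAbove {n : ℕ} (j : Fin (n + 1)) (y : Fin n) :
    (Fin.cycleIcc j (Fin.last n))⁻¹ (j.succAbove y) = y.castSucc := by
  rw [Equiv.Perm.inv_eq_iff_eq, ← Fin.succAbove_last,
    ← Fin.cycleIcc_comp_succAbove j (Fin.last n) (Fin.le_last j)]
  rfl

theorem skip_last_endL {V : Type} (m : ℕ) (a : V → ℕ)
    (h : ∀ v, a v = Sum.elim a Empty.elim ((Equiv.sumEmpty V Empty).symm v)) (x) :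
    skip (Fin.last m) (Sum.map (Equiv.refl _) (slotEquiv (Equiv.sumEmpty V Empty).symm h) x) =
      endL m 1 a Empty.elim x := by
  rcases x with x | ⟨v, r⟩
  · exact congrArg Sum.inl (last_succAbove_castAdd x)
  · rfl

/-- Gluing an output to the input of an input-output edge on the right. -/
noncomputable def traceHmulUnitLeftIso (j : Fin (l + 1)) (D : DecGraph X k (l + 1)) :
    Iso (D.relabel (Equiv.refl _) (Fin.cycleIcc j (Fin.last l))⁻¹)
      ((D.hmul (edge X)).trace (Fin.last k) j.castSucc) := by
  have hw0 : (D.hmul (edge X)).graph.wire (Sum.inl (Fin.last k)) = Sum.inl (Fin.last (l + 1)) :=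
    hmul_wire_endR D.graph (edge X).graph (Sum.inl 0)
  have hw := hmul_wire_endL D.graph (edge X).graph
  refine isoOfRelabel _ _ (Equiv.sumEmpty _ Empty).symm (fun _ => rfl) (fun _ => rfl) ?_ ?_
    (fun _ => rfl)
  · refine (loops_trace_of_ne (D := D.hmul (edge X)) fun h => ?_).symm
    exact (Fin.castSucc_lt_last j).ne' (Sum.inl_injective (hw0.symm.trans h))
  · intro x
    refine (traceWire_eq_iff _ _ _ _ _).mpr ?_
    have e1 : ∀ z, ((D.hmul (edge X)).graph.wire (skip (Fin.last k) (Sum.map (Equiv.refl _)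
          (slotEquiv (Equiv.sumEmpty D.graph.V Empty).symm fun _ => rfl) x)) = z) ↔
        endL (l + 1) 1 D.graph.inn Empty.elim (D.graph.wire x) = z := fun z =>
      Eq.congr ((congrArg _ (skip_last_endL k D.graph.out (fun _ => rfl) x)).trans (hw x)) rfl
    refine (or_congr (e1 _) (and_congr (e1 _) (Eq.congr hw0 rfl))).mpr ?_
    rcases D.graph.wire x with y | ⟨v, r⟩
    · rcases Fin.eq_self_or_eq_succAbove j y with rfl | ⟨y, rfl⟩
      · refine Or.inr ⟨rfl, congrArg Sum.inl ?_⟩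
        change _ = y.castSucc.succAbove ((Fin.cycleIcc y (Fin.last l))⁻¹ y)
        rw [cycleIcc_inv_self, castSucc_succAbove_last]
      · refine Or.inl (congrArg Sum.inl ?_)
        change _ = j.castSucc.succAbove ((Fin.cycleIcc j (Fin.last l))⁻¹ (j.succAbove y))
        rw [cycleIcc_inv_succAbove, Fin.castSucc_succAbove_castSucc]
        rfl
    · exact Or.inl rfl

/-- Gluing the output of an input-output edge on the right to an input. -/
noncomputable def traceHmulUnitRightIso (i : Fin (k + 1)) (D : DecGraph X (k + 1) l) :
    Iso (D.relabel (Fin.cycleIcc i (Fin.last k))⁻¹ (Equiv.refl _))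
      ((D.hmul (edge X)).trace i.castSucc (Fin.last l)) := by
  have hw0 : (D.hmul (edge X)).graph.wire (Sum.inl (Fin.last (k + 1))) = Sum.inl (Fin.last l) :=
    hmul_wire_endR D.graph (edge X).graph (Sum.inl 0)
  have hw := hmul_wire_endL D.graph (edge X).graph
  refine isoOfRelabel _ _ (Equiv.sumEmpty _ Empty).symm (fun _ => rfl) (fun _ => rfl) ?_ ?_
    (fun _ => rfl)
  · refine (loops_trace_of_ne (D := D.hmul (edge X)) fun h => ?_).symm
    exact (Fin.castSucc_lt_last i).ne' (Sum.inl_injective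
      ((Equiv.injective _) (hw0.trans h.symm)))
  · intro x
    refine (traceWire_eq_iff _ _ _ _ _).mpr ?_
    have e2 := skip_last_endL l D.graph.inn (fun _ => rfl) (D.graph.wire x)
    rcases x with x | ⟨v, r⟩
    · rcases Fin.eq_self_or_eq_succAbove i x with rfl | ⟨y, rfl⟩
      · refine Or.inr ⟨(congrArg _ (congrArg Sum.inl ?_)).trans hw0, (hw (Sum.inl x)).trans e2.symm⟩
        change x.castSucc.succAbove ((Fin.cycleIcc x (Fin.last k))⁻¹ x) = Fin.last (k + 1)
        rw [cycleIcc_inv_self, castSucc_succAbove_last]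
      · refine Or.inl ((congrArg _ (congrArg Sum.inl ?_)).trans
          ((hw (Sum.inl (i.succAbove y))).trans e2.symm))
        change i.castSucc.succAbove ((Fin.cycleIcc i (Fin.last k))⁻¹ (i.succAbove y)) = _
        rw [cycleIcc_inv_succAbove, Fin.castSucc_succAbove_castSucc]
        rfl
    · exact Or.inl ((hw _).trans e2.symm)

/-! ### The TraP axioms for `PGr X`, by multilinearity from those for graphs -/

theorem isTraP_PGr : (PGr X).IsTraP where
  toIsSymModule := isSymModule_PGr
  mul_assoc {k l k' l' k'' l''} p p' p'' := by
    -- The axiom is trilinear: `p` is replaced by a graph first, and then `p'` and `p''` together.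
    refine PGr_eq ((PGr X).castLin (Nat.add_assoc k k' k'') (Nat.add_assoc l l' l'') ∘ₗ
      (PGr X).mul.flip p'' ∘ₗ (PGr X).mul.flip p') ((PGr X).mul.flip ((PGr X).mul p' p''))
      (fun D => ?_) p
    refine PGr_eq₂ (((PGr X).mul ∘ₗ (PGr X).mul D.toPGr).compr₂
      ((PGr X).castLin (Nat.add_assoc k k' k'') (Nat.add_assoc l l' l'')))
      ((PGr X).mul.compr₂ ((PGr X).mul D.toPGr)) (fun D' D'' => ?_) p' p''
    simp only [LinearMap.compr₂_apply, LinearMap.comp_apply, PGr_mul]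
    exact (cast_toPGr _ _ _).trans (toPGr_eq_of_iso (hmulAssocIso D D' D''))
  one_mul p := PGr_eq ((PGr X).castLin _ _ ∘ₗ (PGr X).mul (PGr X).one) LinearMap.id (fun D =>
    (congrArg _ (PGr_mul (empty X) D)).trans
      ((cast_toPGr _ _ _).trans (toPGr_eq_of_iso (emptyHmulIso D)))) p
  mul_one p := PGr_eq ((PGr X).mul.flip (PGr X).one) LinearMap.id (fun D =>
    (PGr_mul D (empty X)).trans ((congrArg toPGr (relabel_refl _).symm).trans
      (toPGr_eq_of_iso (hmulEmptyIso D)))) p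
  act_mul_act p p' σ τ σ' τ' := PGr_eq₂
    ((PGr X).mul.compl₁₂ ((PGr X).lact σ ∘ₗ (PGr X).ract τ) ((PGr X).lact σ' ∘ₗ (PGr X).ract τ'))
    ((PGr X).mul.compr₂ ((PGr X).lact (TraPPerm.tensor σ σ') ∘ₗ
      (PGr X).ract (TraPPerm.tensor τ τ')))
    (fun D D' => by
      simp only [LinearMap.compl₁₂_apply, LinearMap.compr₂_apply, LinearMap.comp_apply, PGr_lact,
        PGr_ract, PGr_mul, act_hmul_act]) p p'
  mul_comm {k l k' l'} p p' := PGr_eq₂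
    ((PGr X).mul.compr₂ ((PGr X).lact (TraPPerm.comm l l')))
    ((PGr X).mul.flip.compr₂ ((PGr X).ract (TraPPerm.comm k k') ∘ₗ
      (PGr X).castLin (Nat.add_comm k' k) (Nat.add_comm l' l)))
    (fun D D' => by
      have h : (PGr X).castLin (Nat.add_comm k' k) (Nat.add_comm l' l) (D'.hmul D).toPGr = _ :=
        cast_toPGr _ _ _
      simp only [LinearMap.compr₂_apply, LinearMap.flip_apply, LinearMap.comp_apply, PGr_mul, h,
        PGr_lact, PGr_ract, lact_eq_relabel]
      exact toPGr_eq_of_iso (hmulCommIso D D')) p p'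
  tr_tr i j i' j' p := PGr_eq ((PGr X).tr i' j' ∘ₗ (PGr X).tr i j)
    ((PGr X).tr (i'.predAbove i) (j'.predAbove j) ∘ₗ
      (PGr X).tr (i.succAbove i') (j.succAbove j')) (fun D => by
      simp only [LinearMap.comp_apply, PGr_tr, trace_trace i j i' j' D]) p
  tr_act i j σ τ p := PGr_eq ((PGr X).tr i j ∘ₗ (PGr X).lact σ ∘ₗ (PGr X).ract τ)
    ((PGr X).lact (TraPPerm.delete σ j) ∘ₗ (PGr X).ract (TraPPerm.delete τ (τ i)) ∘ₗ
      (PGr X).tr (τ i) (σ.symm j)) (fun D => by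
      simp only [LinearMap.comp_apply, PGr_tr, PGr_lact, PGr_ract, trace_act]) p
  tr_mul_left {k l k' l'} i j p p' := PGr_eq₂
    ((PGr X).mul.compr₂ ((PGr X).tr (Fin.cast (Nat.add_right_comm k 1 k') (Fin.castAdd k' i))
        (Fin.cast (Nat.add_right_comm l 1 l') (Fin.castAdd l' j)) ∘ₗ
      (PGr X).castLin (Nat.add_right_comm k 1 k') (Nat.add_right_comm l 1 l')))
    ((PGr X).mul ∘ₗ (PGr X).tr i j) (fun D D' => by
      have h : (PGr X).castLin (Nat.add_right_comm k 1 k') (Nat.add_right_comm l 1 l')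
        (D.hmul D').toPGr = _ := cast_toPGr _ _ _
      simp only [LinearMap.compr₂_apply, LinearMap.comp_apply, PGr_mul, h, PGr_tr,
        trace_hmul_left]) p p'
  tr_mul_right {k l k' l'} i j p p' := PGr_eq₂
    (((PGr X).mul (k := k) (l := l) (k' := k' + 1) (l' := l' + 1)).compr₂
      ((PGr X).tr (k := k + k') (l := l + l') (Fin.natAdd k i) (Fin.natAdd l j)))
    (((PGr X).mul (k := k) (l := l)).compl₂ ((PGr X).tr i j)) (fun D D' => by
      simp only [LinearMap.compr₂_apply, LinearMap.compl₂_apply, PGr_mul, PGr_tr]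
      exact congrArg toPGr (trace_hmul_right i j D D')) p p'
  tr_unit_mul_left {k l} j p := PGr_eq ((PGr X).tr 0 j.succ ∘ₗ
      (PGr X).castLin (Nat.add_comm 1 k) (Nat.add_comm 1 (l + 1)) ∘ₗ (PGr X).mul (PGr X).unit)
    ((PGr X).lact j.cycleRange) (fun D => by
      rw [PGr_lact, lact_eq_relabel]
      refine ((congrArg ((PGr X).tr 0 j.succ) ((congrArg _ (PGr_mul (edge X) D)).trans
        (cast_toPGr _ _ _))).trans (PGr_tr _ _ _)).trans ?_
      exact (toPGr_eq_of_iso (traceUnitHmulLeftIso j D)).symm) p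
  tr_unit_mul_right {k l} i p := PGr_eq ((PGr X).tr i.succ 0 ∘ₗ
      (PGr X).castLin (Nat.add_comm 1 (k + 1)) (Nat.add_comm 1 l) ∘ₗ (PGr X).mul (PGr X).unit)
    ((PGr X).ract (i.cycleRange)⁻¹) (fun D => by
      rw [PGr_ract, ract_eq_relabel]
      refine ((congrArg ((PGr X).tr i.succ 0) ((congrArg _ (PGr_mul (edge X) D)).trans
        (cast_toPGr _ _ _))).trans (PGr_tr _ _ _)).trans ?_
      exact (toPGr_eq_of_iso (traceUnitHmulRightIso i D)).symm) p
  tr_mul_unit_left {k l} j p := PGr_eq ((PGr X).tr (Fin.last k) j.castSucc ∘ₗ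
      (PGr X).mul.flip (PGr X).unit)
    ((PGr X).lact (Fin.cycleIcc j (Fin.last l))⁻¹) (fun D => by
      rw [PGr_lact, lact_eq_relabel]
      exact ((congrArg ((PGr X).tr (Fin.last k) j.castSucc) (PGr_mul D (edge X))).trans
        (PGr_tr _ _ _)).trans (toPGr_eq_of_iso (traceHmulUnitLeftIso j D)).symm) p
  tr_mul_unit_right {k l} i p := PGr_eq ((PGr X).tr i.castSucc (Fin.last l) ∘ₗ
      (PGr X).mul.flip (PGr X).unit)
    ((PGr X).ract (Fin.cycleIcc i (Fin.last k))) (fun D => by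
      rw [PGr_ract, ract_eq_relabel]
      exact ((congrArg ((PGr X).tr i.castSucc (Fin.last l)) (PGr_mul D (edge X))).trans
        (PGr_tr _ _ _)).trans (toPGr_eq_of_iso (traceHmulUnitRightIso i D)).symm) p

end DecGraph

namespace DecGraph

open PlanarGraph

variable {K : Type w} [Field K] {X : SymData.{u, w} K} {k l k' l' k'' l'' : ℕ}

/-! ### Injectivity of the one-vertex inclusion -/

theorem _root_.SymData.cast_add (X : SymData.{u, w} K) (hk : k = k') (hl : l = l')
    (x y : X.obj k l) : X.cast hk hl (x + y) = X.cast hk hl x + X.cast hk hl y :=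
  (X.castLin hk hl).map_add x y

theorem _root_.SymData.cast_smul (X : SymData.{u, w} K) (hk : k = k') (hl : l = l') (a : K)
    (x : X.obj k l) : X.cast hk hl (a • x) = a • X.cast hk hl x :=
  (X.castLin hk hl).map_smul a x

theorem _root_.SymData.cast_cast (X : SymData.{u, w} K) (hk : k = k') (hl : l = l')
    (hk' : k' = k'') (hl' : l' = l'') (x : X.obj k l) :
    X.cast hk' hl' (X.cast hk hl x) = X.cast (hk.trans hk') (hl.trans hl') x := by
  subst hk hl hk' hl'
  rfl

/-- The shape of an isomorphism to a corolla. -/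
structure CorollaShape (G : PlanarGraph k l) where
  equiv : G.V ≃ Unit
  inn_eq : ∀ v, G.inn v = k
  out_eq : ∀ v, G.out v = l
  loops_eq : G.loops = 0
  wire_eq : (Equiv.sumCongr (Equiv.refl _) (slotEquiv equiv out_eq)).trans
      (PlanarGraph.corolla k l).wire =
    G.wire.trans (Equiv.sumCongr (Equiv.refl _) (slotEquiv equiv inn_eq))

open Classical in
/-- The decoration of a graph that is isomorphic to a corolla; zero for all the other graphs. -/
noncomputable def corollaDec (D : DecGraph X k l) : X.obj k l :=
  if h : Nonempty (CorollaShape D.graph) then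
    X.cast (h.some.inn_eq _) (h.some.out_eq _) (D.dec (h.some.equiv.symm ()))
  else 0

/-- The isomorphism chosen in the definition does not matter: there is only one vertex, and the cast
depends only on the arities. -/
theorem corollaDec_eq {D : DecGraph X k l} (h : CorollaShape D.graph) (v : D.graph.V) :
    corollaDec D = X.cast (h.inn_eq v) (h.out_eq v) (D.dec v) := by
  have h' : Nonempty (CorollaShape D.graph) := ⟨h⟩
  rw [corollaDec, dif_pos h']
  have : v = h'.some.equiv.symm () := h'.some.equiv.injective rfl
  subst this
  rfl

theorem corollaDec_eq_zero {D : DecGraph X k l} (h : ¬ Nonempty (CorollaShape D.graph)) :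
    corollaDec D = 0 := dif_neg h

/-- Transport of the shape along an isomorphism. -/
def CorollaShape.ofIso {D D' : DecGraph X k l} (f : Iso D D') (h : CorollaShape D'.graph) :
    CorollaShape D.graph where
  equiv := f.equiv.trans h.equiv
  inn_eq v := (f.inn_eq v).trans (h.inn_eq _)
  out_eq v := (f.out_eq v).trans (h.out_eq _)
  loops_eq := f.loops_eq.trans h.loops_eq
  wire_eq := by
    ext1 x
    have e1 := Equiv.congr_fun h.wire_eq
      (Sum.map id (slotEquiv f.equiv f.out_eq) x)
    have e2 := Equiv.congr_fun f.wire_eq x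
    refine Eq.trans ?_ (e1.trans ((congrArg (Sum.map id (slotEquiv h.equiv h.inn_eq)) e2).trans ?_))
    · rcases x with x | x <;> rfl
    · change Sum.map id _ (Sum.map id _ (D.graph.wire x)) = Sum.map id _ (D.graph.wire x)
      rcases D.graph.wire x with y | y <;> rfl

theorem slotEquiv_symm_slotEquiv {V V' : Type} {a : V → ℕ} {a' : V' → ℕ} (f : V ≃ V')
    (h : ∀ v, a v = a' (f v)) (h' : ∀ v, a' v = a (f.symm v)) (x : Σ v, Fin (a v)) :
    slotEquiv f.symm h' (slotEquiv f h x) = x := by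
  obtain ⟨v, r⟩ := x
  exact Sigma.ext (f.symm_apply_apply v)
    ((Fin.heq_ext_iff (congrArg a (f.symm_apply_apply v))).mpr rfl)

/-- The inverse isomorphism. -/
def Iso.symm {D D' : DecGraph X k l} (f : Iso D D') : Iso D' D where
  equiv := f.equiv.symm
  inn_eq v := by rw [f.inn_eq, Equiv.apply_symm_apply]
  out_eq v := by rw [f.out_eq, Equiv.apply_symm_apply]
  loops_eq := f.loops_eq.symm
  wire_eq := by
    ext1 x
    obtain ⟨x, rfl⟩ : ∃ y, x = Sum.map id (slotEquiv f.equiv f.out_eq) y :=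
      ⟨Sum.map id (slotEquiv f.equiv f.out_eq).symm x, by rcases x with x | x <;> simp⟩
    have e := Equiv.congr_fun f.wire_eq x
    have hs : ∀ {S T : Type} (g : S ≃ T) (g' : T ≃ S) (h : ∀ s, g' (g s) = s) {n : ℕ}
        (x : Fin n ⊕ S), Sum.map id g' (Sum.map id g x) = x := by
      rintro S T g g' h n (x | x)
      · rfl
      · exact congrArg Sum.inr (h x)
    refine (congrArg D.graph.wire (hs _ _ (slotEquiv_symm_slotEquiv _ _ _) x)).trans ?_
    refine Eq.trans ?_ (congrArg (Sum.map id _) e).symm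
    exact (hs _ _ (slotEquiv_symm_slotEquiv _ _ _) (D.graph.wire x)).symm
  dec_eq v := by
    obtain ⟨v, rfl⟩ := f.equiv.surjective v
    rw [← f.dec_eq, SymData.cast_cast]
    have h : ∀ (v v' : D.graph.V) (h : v = v'), X.cast (congrArg D.graph.inn h)
        (congrArg D.graph.out h) (D.dec v) = D.dec v' := by
      rintro v _ rfl
      rfl
    exact h _ _ (f.equiv.symm_apply_apply v).symm

theorem corollaDec_of_iso {D D' : DecGraph X k l} (f : Iso D D') :
    corollaDec D = corollaDec D' := by
  by_cases h : Nonempty (CorollaShape D'.graph)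
  · obtain ⟨h⟩ := h
    have v := (CorollaShape.ofIso f h).equiv.symm ()
    rw [corollaDec_eq (CorollaShape.ofIso f h) v, corollaDec_eq h (f.equiv v), ← f.dec_eq,
      SymData.cast_cast]
  -- Being corolla-shaped passes along an isomorphism in both directions; the inverse isomorphism
  -- serves here.
  · rw [corollaDec_eq_zero h, corollaDec_eq_zero
      fun ⟨h'⟩ => h ⟨CorollaShape.ofIso f.symm h'⟩]

/-- The linear map `PGr X → X` that extracts the decoration of corollas. -/
noncomputable def retraction (X : SymData.{u, w} K) (k l : ℕ) :
    (PGr X).obj k l →ₗ[K] X.obj k l :=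
  (relSpan X k l).liftQ (Finsupp.linearCombination K corollaDec)
    (Submodule.span_le.mpr fun r hr => by
      rw [SetLike.mem_coe, LinearMap.mem_ker]
      -- In a corolla, the updated vertex is the only one, so the extracted value is the new
      -- decoration and is linear in it. For any other graph all terms of a relation vanish.
      have hu : ∀ (G : PlanarGraph k l) [DecidableEq G.V] (h : CorollaShape G)
          (d : ∀ v : G.V, X.obj (G.inn v) (G.out v)) (v x),
          corollaDec ⟨G, Function.update d v x⟩ = X.cast (h.inn_eq v) (h.out_eq v) x := by
        intro G _ h d v x
        refine (corollaDec_eq (D := ⟨G, Function.update d v x⟩) h v).trans ?_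
        exact congrArg _ (Function.update_self v x d)
      cases hr with
      | iso D D' f =>
        simp [Finsupp.linearCombination_single, corollaDec_of_iso f]
      | add G d v x y =>
        simp only [map_sub, Finsupp.linearCombination_single, one_smul]
        by_cases h : Nonempty (CorollaShape G)
        · obtain ⟨h⟩ := h
          rw [hu G h, hu G h, hu G h, SymData.cast_add]
          abel
        · rw [corollaDec_eq_zero h, corollaDec_eq_zero h, corollaDec_eq_zero h]
          simp
      | smul G d v a x =>
        simp only [map_sub, Finsupp.linearCombination_single, one_smul]
        by_cases h : Nonempty (CorollaShape G)
        · obtain ⟨h⟩ := h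
          rw [hu G h, hu G h, SymData.cast_smul, sub_self]
        · rw [corollaDec_eq_zero h, corollaDec_eq_zero h]
          simp)

theorem injective_incl : Function.Injective (PGr.incl X k l) := by
  refine Function.LeftInverse.injective (g := retraction X k l) fun x => ?_
  have h : CorollaShape (DecGraph.corolla x).graph :=
    ⟨Equiv.refl _, fun _ => rfl, fun _ => rfl, rfl, by
      ext1 y
      rcases y with y | ⟨⟨⟩, r⟩ <;> rfl⟩
  refine (?_ : _ = corollaDec (corolla x)).trans (corollaDec_eq h ())
  exact (Finsupp.linearCombination_single K 1 _).trans (one_smul _ _)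

end DecGraph

/-! ### Elements with labelled inputs and outputs -/

theorem Fin.eq_of_equiv {m n : ℕ} (f : Fin m ≃ Fin n) : m = n := by
  simpa using Fintype.card_congr f

namespace SymData

variable {K : Type w} [Field K] {k l k' l' k'' l'' : ℕ}

/-- Transport along bijections of the inputs and of the outputs. -/
def re (X : SymData.{u, w} K) (f : Fin k ≃ Fin k') (g : Fin l ≃ Fin l') :
    X.obj k l →ₗ[K] X.obj k' l' :=
  X.castLin (Fin.eq_of_equiv f) (Fin.eq_of_equiv g) ∘ₗ
    X.lact (g.trans (finCongr (Fin.eq_of_equiv g).symm)) ∘ₗ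
      X.ract (f.trans (finCongr (Fin.eq_of_equiv f).symm)).symm

variable {X : SymData.{u, w} K}

theorem re_perm (f : Equiv.Perm (Fin k)) (g : Equiv.Perm (Fin l)) (p : X.obj k l) :
    X.re f g p = X.lact g (X.ract f.symm p) := rfl

theorem re_refl (hX : X.IsSymModule) (p : X.obj k l) :
    X.re (Equiv.refl _) (Equiv.refl _) p = p :=
  (hX.one_lact _).trans (hX.ract_one p)

/-- A bijection between `Fin k` and `Fin k'` forces `k = k'`. After substitution only permutations
are left, and functoriality is the two action laws together with their commutation. -/
theorem re_re (hX : X.IsSymModule) (f : Fin k ≃ Fin k') (g : Fin l ≃ Fin l')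
    (f' : Fin k' ≃ Fin k'') (g' : Fin l' ≃ Fin l'') (p : X.obj k l) :
    X.re f' g' (X.re f g p) = X.re (f.trans f') (g.trans g') p := by
  obtain rfl := Fin.eq_of_equiv f
  obtain rfl := Fin.eq_of_equiv g
  obtain rfl := Fin.eq_of_equiv f'
  obtain rfl := Fin.eq_of_equiv g'
  rw [re_perm, re_perm, re_perm, ← hX.lact_ract, ← hX.mul_lact, ← hX.ract_mul]
  rfl

theorem cast_eq_re (hX : X.IsSymModule) (hk : k = k') (hl : l = l') (p : X.obj k l) :
    X.cast hk hl p = X.re (finCongr hk) (finCongr hl) p := by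
  subst hk hl
  exact (re_refl hX p).symm

end SymData

namespace TraPData

variable {K : Type w} [Field K] {P : TraPData.{v, w} K} {k l k' l' k'' l'' : ℕ}

theorem mul_re (hP : P.IsTraP) (f : Fin k ≃ Fin k') (g : Fin l ≃ Fin l')
    {m n m' n' : ℕ} (f' : Fin m ≃ Fin m') (g' : Fin n ≃ Fin n') (p : P.obj k l) (p' : P.obj m n) :
    P.mul (P.re f g p) (P.re f' g' p') =
      P.re ((finSumFinEquiv.symm.trans (Equiv.sumCongr f f')).trans finSumFinEquiv)
        ((finSumFinEquiv.symm.trans (Equiv.sumCongr g g')).trans finSumFinEquiv) (P.mul p p') := by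
  obtain rfl := Fin.eq_of_equiv f
  obtain rfl := Fin.eq_of_equiv g
  obtain rfl := Fin.eq_of_equiv f'
  obtain rfl := Fin.eq_of_equiv g'
  exact hP.act_mul_act p p' g f.symm g' f'.symm

/-- The equivariance axiom of partial traces without standardized words: `f'` and `g'` are what `f`
and `g` induce on the complements of the glued indices, and `succAbove_delete` identifies them with
deletions. -/
theorem tr_re (hP : P.IsTraP) (f : Fin (k + 1) ≃ Fin (k' + 1)) (g : Fin (l + 1) ≃ Fin (l' + 1))
    {i : Fin (k + 1)} {j : Fin (l + 1)} {i' : Fin (k' + 1)} {j' : Fin (l' + 1)}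
    (f' : Fin k ≃ Fin k') (g' : Fin l ≃ Fin l') (hi : f i = i') (hj : g j = j')
    (hf : ∀ x, f (i.succAbove x) = i'.succAbove (f' x))
    (hg : ∀ x, g (j.succAbove x) = j'.succAbove (g' x)) (p : P.obj (k + 1) (l + 1)) :
    P.tr i' j' (P.re f g p) = P.re f' g' (P.tr i j p) := by
  obtain rfl := Fin.eq_of_equiv f'
  obtain rfl := Fin.eq_of_equiv g'
  subst hi hj
  have h1 : f.symm (f i) = i := f.symm_apply_apply i
  have h2 : g.symm (g j) = j := g.symm_apply_apply j
  have h3 : TraPPerm.delete f.symm i = f'.symm := by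
    ext1 x
    apply Fin.succAbove_right_injective (p := i)
    rw [DecGraph.succAbove_delete]
    apply f.injective
    rw [hf, Equiv.symm_symm, Equiv.apply_symm_apply, Equiv.apply_symm_apply]
  have h4 : TraPPerm.delete g (g j) = g' := by
    ext1 x
    apply Fin.succAbove_right_injective (p := g j)
    rw [DecGraph.succAbove_delete, h2, hg]
  -- The inputs are transported through the right action of the inverse, hence `f.symm`.
  have h := hP.tr_act (f i) (g j) g f.symm p
  rw [h1, h2, h3, h4] at h
  exact h

/-- The elements of `P` whose inputs and outputs are labelled by `A` and `B`. -/
def Lab (P : TraPData.{v, w} K) (A B : Type) : Type v := P.obj (Nat.card A) (Nat.card B)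

noncomputable instance (A B : Type) : AddCommGroup (P.Lab A B) :=
  inferInstanceAs (AddCommGroup (P.obj (Nat.card A) (Nat.card B)))

noncomputable instance (A B : Type) : Module K (P.Lab A B) :=
  inferInstanceAs (Module K (P.obj (Nat.card A) (Nat.card B)))

variable {A B A' B' A'' B'' A₁ B₁ : Type} [Finite A] [Finite B] [Finite A'] [Finite B']
  [Finite A''] [Finite B''] [Finite A₁] [Finite B₁]

/-- Labelling of the inputs and the outputs. -/
noncomputable def lab (P : TraPData.{v, w} K) (a : Fin k ≃ A) (b : Fin l ≃ B) :
    P.obj k l →ₗ[K] P.Lab A B :=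
  P.re (a.trans (Finite.equivFin A)) (b.trans (Finite.equivFin B))

/-- Inverse of `lab`. -/
noncomputable def unlab (P : TraPData.{v, w} K) (a : Fin k ≃ A) (b : Fin l ≃ B) :
    P.Lab A B →ₗ[K] P.obj k l :=
  P.re (a.trans (Finite.equivFin A)).symm (b.trans (Finite.equivFin B)).symm

theorem lab_unlab (hP : P.IsTraP) (a : Fin k ≃ A) (b : Fin l ≃ B) (x : P.Lab A B) :
    P.lab a b (P.unlab a b x) = x := by
  refine (SymData.re_re hP.toIsSymModule _ _ _ _ _).trans ?_
  rw [Equiv.symm_trans_self, Equiv.symm_trans_self]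
  exact SymData.re_refl hP.toIsSymModule _

theorem unlab_lab (hP : P.IsTraP) (a : Fin k ≃ A) (b : Fin l ≃ B) (p : P.obj k l) :
    P.unlab a b (P.lab a b p) = p := by
  refine (SymData.re_re hP.toIsSymModule _ _ _ _ _).trans ?_
  rw [Equiv.self_trans_symm, Equiv.self_trans_symm]
  exact SymData.re_refl hP.toIsSymModule _

/-- A labelled element can be presented through any enumerations of its labels. The identities below
are checked with enumerations adapted to them. -/
theorem exists_eq_lab (hP : P.IsTraP) (a : Fin k ≃ A) (b : Fin l ≃ B) (x : P.Lab A B) :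
    ∃ p, x = P.lab a b p := ⟨_, (lab_unlab hP a b x).symm⟩

theorem lab_re (hP : P.IsTraP) (f : Fin k ≃ Fin k') (g : Fin l ≃ Fin l') (a : Fin k' ≃ A)
    (b : Fin l' ≃ B) (p : P.obj k l) :
    P.lab a b (P.re f g p) = P.lab (f.trans a) (g.trans b) p :=
  SymData.re_re hP.toIsSymModule _ _ _ _ _

/-- Change of the labels. -/
noncomputable def rel (P : TraPData.{v, w} K) (f : A ≃ A') (g : B ≃ B') :
    P.Lab A B →ₗ[K] P.Lab A' B' :=
  P.lab ((Finite.equivFin A).symm.trans f) ((Finite.equivFin B).symm.trans g)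

theorem rel_lab (hP : P.IsTraP) (f : A ≃ A') (g : B ≃ B') (a : Fin k ≃ A) (b : Fin l ≃ B)
    (p : P.obj k l) : P.rel f g (P.lab a b p) = P.lab (a.trans f) (b.trans g) p := by
  refine (lab_re hP _ _ _ _ _).trans ?_
  congr 2 <;> ext x <;> simp

/-- Horizontal concatenation of labelled elements. -/
noncomputable def lmul (P : TraPData.{v, w} K) :
    P.Lab A B →ₗ[K] P.Lab A' B' →ₗ[K] P.Lab (A ⊕ A') (B ⊕ B') :=
  (P.mul (k := Nat.card A) (l := Nat.card B) (k' := Nat.card A') (l' := Nat.card B')).compr₂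
    (P.lab (finSumFinEquiv.symm.trans
        (Equiv.sumCongr (Finite.equivFin A).symm (Finite.equivFin A').symm))
      (finSumFinEquiv.symm.trans
        (Equiv.sumCongr (Finite.equivFin B).symm (Finite.equivFin B').symm)))

/-- The enumerations fixed in the definition of `lmul` are irrelevant: changing them acts on the
product by block bijections, by `mul_re`. -/
theorem lmul_lab (hP : P.IsTraP) (a : Fin k ≃ A) (b : Fin l ≃ B) (a' : Fin k' ≃ A')
    (b' : Fin l' ≃ B') (p : P.obj k l) (p' : P.obj k' l') :
    P.lmul (P.lab a b p) (P.lab a' b' p') =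
      P.lab (finSumFinEquiv.symm.trans (Equiv.sumCongr a a'))
        (finSumFinEquiv.symm.trans (Equiv.sumCongr b b')) (P.mul p p') := by
  refine (congrArg _ (mul_re hP _ _ _ _ p p')).trans ((lab_re hP _ _ _ _ _).trans ?_)
  congr 2 <;> ext1 x <;> obtain ⟨x, rfl⟩ := finSumFinEquiv.surjective x <;>
    rcases x with x | x <;> simp

/-- The partial trace of labelled elements. -/
noncomputable def ltr (P : TraPData.{v, w} K) :
    P.Lab (Option A) (Option B) →ₗ[K] P.Lab A B :=
  P.tr (k := Nat.card A) (l := Nat.card B) 0 0 ∘ₗ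
    P.re ((Finite.equivFin (Option A)).symm.trans
      ((Equiv.optionCongr (Finite.equivFin A)).trans (finSuccEquiv _).symm))
    ((Finite.equivFin (Option B)).symm.trans
      ((Equiv.optionCongr (Finite.equivFin B)).trans (finSuccEquiv _).symm))

/-- The definition of `ltr` enumerates `none` first, but by `tr_re` the marked input and output may
sit at any positions `i` and `j`. -/
theorem ltr_lab (hP : P.IsTraP) {a : Fin (k + 1) ≃ Option A} {b : Fin (l + 1) ≃ Option B}
    {i : Fin (k + 1)} {j : Fin (l + 1)} (a' : Fin k ≃ A) (b' : Fin l ≃ B)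
    (hi : a i = none) (hj : b j = none) (ha : ∀ x, a (i.succAbove x) = some (a' x))
    (hb : ∀ x, b (j.succAbove x) = some (b' x)) (p : P.obj (k + 1) (l + 1)) :
    P.ltr (P.lab a b p) = P.lab a' b' (P.tr i j p) := by
  refine (congrArg (P.tr 0 0) (SymData.re_re hP.toIsSymModule _ _ _ _ p)).trans ?_
  refine tr_re hP _ _ _ _ ?_ ?_ ?_ ?_ p
  · simp [hi]
  · simp [hj]
  · simp [ha]
  · simp [hb]

theorem rel_refl (hP : P.IsTraP) (x : P.Lab A B) :
    P.rel (Equiv.refl _) (Equiv.refl _) x = x := by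
  obtain ⟨p, rfl⟩ := exists_eq_lab hP (Finite.equivFin A).symm (Finite.equivFin B).symm x
  exact rel_lab hP _ _ _ _ p

theorem rel_rel (hP : P.IsTraP) (f : A ≃ A') (g : B ≃ B') (f' : A' ≃ A'') (g' : B' ≃ B'')
    (x : P.Lab A B) : P.rel f' g' (P.rel f g x) = P.rel (f.trans f') (g.trans g') x := by
  obtain ⟨p, rfl⟩ := exists_eq_lab hP (Finite.equivFin A).symm (Finite.equivFin B).symm x
  rw [rel_lab hP, rel_lab hP, rel_lab hP]
  rfl

theorem rel_congr {f f' : A ≃ A'} {g g' : B ≃ B'} (hf : ∀ x, f x = f' x) (hg : ∀ x, g x = g' x)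
    (x : P.Lab A B) : P.rel f g x = P.rel f' g' x := by
  rw [Equiv.ext hf, Equiv.ext hg]

theorem lmul_rel (hP : P.IsTraP) (f : A ≃ A') (g : B ≃ B') (f' : A'' ≃ A₁) (g' : B'' ≃ B₁)
    (x : P.Lab A B) (y : P.Lab A'' B'') :
    P.lmul (P.rel f g x) (P.rel f' g' y) =
      P.rel (Equiv.sumCongr f f') (Equiv.sumCongr g g') (P.lmul x y) := by
  obtain ⟨p, rfl⟩ := exists_eq_lab hP (Finite.equivFin A).symm (Finite.equivFin B).symm x
  obtain ⟨q, rfl⟩ := exists_eq_lab hP (Finite.equivFin A'').symm (Finite.equivFin B'').symm y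
  rw [rel_lab hP, rel_lab hP, lmul_lab hP, lmul_lab hP, rel_lab hP]
  congr 2 <;> ext1 x <;> obtain ⟨x, rfl⟩ := finSumFinEquiv.surjective x <;>
    rcases x with x | x <;> simp

theorem lmul_assoc (hP : P.IsTraP) (x : P.Lab A B) (y : P.Lab A' B') (z : P.Lab A'' B'') :
    P.rel (Equiv.sumAssoc _ _ _) (Equiv.sumAssoc _ _ _) (P.lmul (P.lmul x y) z) =
      P.lmul x (P.lmul y z) := by
  obtain ⟨p, rfl⟩ := exists_eq_lab hP (Finite.equivFin A).symm (Finite.equivFin B).symm x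
  obtain ⟨q, rfl⟩ := exists_eq_lab hP (Finite.equivFin A').symm (Finite.equivFin B').symm y
  obtain ⟨r, rfl⟩ := exists_eq_lab hP (Finite.equivFin A'').symm (Finite.equivFin B'').symm z
  simp only [lmul_lab hP, rel_lab hP, ← hP.mul_assoc, SymData.cast_eq_re hP.toIsSymModule]
  rw [lab_re hP]
  congr 2 <;> ext1 x <;> obtain ⟨x, rfl⟩ := finSumFinEquiv.surjective x <;>
    (rcases x with x | x
     · obtain ⟨x, rfl⟩ := finSumFinEquiv.surjective x
       rcases x with x | x
       · have h : ∀ {m n p : ℕ} (x : Fin m) h, Fin.cast h (Fin.castAdd p (Fin.castAdd n x)) =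
           Fin.castAdd (n + p) x := fun _ _ => rfl
         simp [h]
       · have h : ∀ {m n p : ℕ} (x : Fin n) h, Fin.cast h (Fin.castAdd p (Fin.natAdd m x)) =
           Fin.natAdd m (Fin.castAdd p x) := fun _ _ => rfl
         simp [h]
     · have h : ∀ {m n p : ℕ} (x : Fin p) h, Fin.cast h (Fin.natAdd (m + n) x) =
         Fin.natAdd m (Fin.natAdd n x) := fun x _ => Fin.ext (Nat.add_assoc _ _ _)
       simp [h])

theorem lmul_comm (hP : P.IsTraP) (x : P.Lab A B) (y : P.Lab A' B') :
    P.rel (Equiv.sumComm _ _) (Equiv.sumComm _ _) (P.lmul x y) = P.lmul y x := by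
  obtain ⟨p, rfl⟩ := exists_eq_lab hP (Finite.equivFin A).symm (Finite.equivFin B).symm x
  obtain ⟨q, rfl⟩ := exists_eq_lab hP (Finite.equivFin A').symm (Finite.equivFin B').symm y
  rw [lmul_lab hP, lmul_lab hP, rel_lab hP]
  -- The commutativity axiom solved for `q * p`, with both block exchanges on one side.
  have h : ∀ {k l k' l' : ℕ} (p : P.obj k l) (q : P.obj k' l'), P.mul q p =
      P.re ((TraPPerm.comm k k').trans (finCongr (Nat.add_comm k k')))
        ((TraPPerm.comm l l').trans (finCongr (Nat.add_comm l l'))) (P.mul p q) := by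
    intro k l k' l' p q
    have h := hP.mul_comm p q
    rw [SymData.cast_eq_re hP.toIsSymModule] at h
    have h1 : P.re (Equiv.refl _) (TraPPerm.comm l l') (P.mul p q) =
        P.re (TraPPerm.comm k k').symm (Equiv.refl _)
          (P.re (finCongr (Nat.add_comm k' k)) (finCongr (Nat.add_comm l' l)) (P.mul q p)) := by
      rw [SymData.re_perm, SymData.re_perm]
      exact (congrArg _ (hP.ract_one _)).trans (h.trans (hP.one_lact _).symm)
    have h2 := congrArg (P.re ((TraPPerm.comm k k').trans (finCongr (Nat.add_comm k k')))
      (finCongr (Nat.add_comm l l'))) h1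
    simp only [SymData.re_re hP.toIsSymModule] at h2
    refine Eq.trans ?_ h2.symm
    refine (SymData.re_refl hP.toIsSymModule _).symm.trans ?_
    congr 2 <;> (ext1 x; simp)
  rw [h, lab_re hP]
  congr 2 <;> ext1 x <;> obtain ⟨x, rfl⟩ := finSumFinEquiv.surjective x <;>
    rcases x with x | x <;> simp [DecGraph.comm_castAdd, DecGraph.comm_natAdd]

theorem lmul_unit_right (hP : P.IsTraP) (x : P.Lab A B) (e : Fin 0 ≃ Empty) :
    P.rel (Equiv.sumEmpty A Empty) (Equiv.sumEmpty B Empty) (P.lmul x (P.lab e e P.one)) = x := by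
  obtain ⟨p, rfl⟩ := exists_eq_lab hP (Finite.equivFin A).symm (Finite.equivFin B).symm x
  rw [lmul_lab hP, rel_lab hP, hP.mul_one]
  have h : ∀ {A : Type} (a : Fin (Nat.card A) ≃ A), ((finSumFinEquiv.symm.trans
      (Equiv.sumCongr a e)).trans (Equiv.sumEmpty A Empty)) = a := by
    intro A a
    ext1 x
    obtain ⟨x, rfl⟩ := finSumFinEquiv.surjective x
    rcases x with x | x
    · have h0 : finSumFinEquiv (Sum.inl x : Fin (Nat.card A) ⊕ Fin 0) = x := rfl
      have h1 : (finSumFinEquiv.symm x : Fin (Nat.card A) ⊕ Fin 0) = Sum.inl x := by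
        rw [Equiv.symm_apply_eq, h0]
      simp [h0, h1]
    · exact x.elim0
  rw [h, h]

/-! ### Axioms of the partial trace in labelled form -/

/-- Exchange of the two added elements. -/
def optionSwap (A : Type) : Equiv.Perm (Option (Option A)) where
  toFun := fun x => x.elim (some none) fun y => y.elim none fun a => some (some a)
  invFun := fun x => x.elim (some none) fun y => y.elim none fun a => some (some a)
  left_inv := by rintro (_ | _ | a) <;> rfl
  right_inv := by rintro (_ | _ | a) <;> rfl

/-- Move the added element of the right summand out. -/
def optionSumRight (A B : Type) : A ⊕ Option B ≃ Option (A ⊕ B) where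
  toFun := Sum.elim (fun a => some (Sum.inl a)) (Option.map Sum.inr)
  invFun := fun x => x.elim (Sum.inr none) (Sum.map id some)
  left_inv := by rintro (a | _ | b) <;> rfl
  right_inv := by rintro (_ | a | b) <;> rfl

/-- The added element is the right summand. -/
def optionSumUnit (A : Type) : A ⊕ Unit ≃ Option A := (Equiv.optionEquivSumPUnit A).symm

/-- Extension of an enumeration by a new first element. -/
def optionEnum {T : Type} {n : ℕ} (a : Fin n ≃ T) : Fin (n + 1) ≃ Option T :=
  (finSuccEquiv n).trans (Equiv.optionCongr a)

theorem optionEnum_zero {T : Type} {n : ℕ} (a : Fin n ≃ T) : optionEnum a 0 = none := rfl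

theorem optionEnum_succ {T : Type} {n : ℕ} (a : Fin n ≃ T) (x : Fin n) :
    optionEnum a x.succ = some (a x) := rfl

theorem ltr_lab_optionEnum (hP : P.IsTraP) (a : Fin k ≃ A) (b : Fin l ≃ B)
    (p : P.obj (k + 1) (l + 1)) :
    P.ltr (P.lab (optionEnum a) (optionEnum b) p) = P.lab a b (P.tr 0 0 p) :=
  ltr_lab hP a b rfl rfl (fun _ => rfl) (fun _ => rfl) p

theorem ltr_rel (hP : P.IsTraP) (f : A ≃ A') (g : B ≃ B') (x : P.Lab (Option A) (Option B)) :
    P.ltr (P.rel (Equiv.optionCongr f) (Equiv.optionCongr g) x) = P.rel f g (P.ltr x) := by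
  obtain ⟨p, rfl⟩ := exists_eq_lab hP
    (optionEnum (Finite.equivFin A).symm)
    (optionEnum (Finite.equivFin B).symm) x
  rw [rel_lab hP, ltr_lab_optionEnum hP, rel_lab hP]
  exact ltr_lab hP _ _ rfl rfl (fun _ => rfl) (fun _ => rfl) p

/-- With the two marked points enumerated first, this is `tr_tr` for `i = j = 1` and `i' = j' = 0`:
tracing position `1` and then `0`, or position `0` twice. In labelled form no other instance of the
axiom is needed. -/
theorem ltr_ltr (hP : P.IsTraP) (x : P.Lab (Option (Option A)) (Option (Option B))) :
    P.ltr (P.ltr (P.rel (optionSwap A) (optionSwap B) x)) = P.ltr (P.ltr x) := by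
  have h0 : ∀ {n : ℕ} (x : Fin n), Fin.succAbove 1 x.succ = x.succ.succ := fun _ => by
    simp
  obtain ⟨p, rfl⟩ := exists_eq_lab hP
    (optionEnum (optionEnum (Finite.equivFin A).symm))
    (optionEnum (optionEnum (Finite.equivFin B).symm)) x
  have hx : ∀ {n : ℕ} {A : Type} (a : Fin n ≃ A) (x : Fin (n + 1)),
      (optionEnum (optionEnum a)).trans (optionSwap A) (Fin.succAbove 1 x) =
        some (optionEnum a x) := by
    intro n A a x
    induction x using Fin.cases with
    | zero => rfl
    | succ x => rw [h0]; rfl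
  rw [ltr_lab_optionEnum hP, ltr_lab_optionEnum hP, rel_lab hP,
    ltr_lab hP (i := 1) (j := 1) (optionEnum (Finite.equivFin A).symm)
      (optionEnum (Finite.equivFin B).symm) rfl rfl (hx _) (hx _), ltr_lab_optionEnum hP]
  exact congrArg _ (hP.tr_tr 1 1 0 0 p)

theorem optionSumRight_enum_zero {m n : ℕ} {T T' : Type} (a : Fin n ≃ T) (a' : Fin m ≃ T') :
    ((finSumFinEquiv.symm.trans (Equiv.sumCongr a' (optionEnum a))).trans
      (optionSumRight T' T)) (Fin.natAdd m 0) = none := by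
  simp [optionSumRight, optionEnum_zero]

theorem optionSumRight_enum_succAbove {m n : ℕ} {T T' : Type} (a : Fin n ≃ T) (a' : Fin m ≃ T')
    (x : Fin (m + n)) :
    ((finSumFinEquiv.symm.trans (Equiv.sumCongr a' (optionEnum a))).trans (optionSumRight T' T))
        (Fin.succAbove (n := m + n) (Fin.natAdd m (0 : Fin (n + 1))) x) =
      some (finSumFinEquiv.symm.trans (Equiv.sumCongr a' a) x) := by
  obtain ⟨x, rfl⟩ := finSumFinEquiv.surjective x
  rcases x with x | x
  · refine (congrArg _ (DecGraph.natAdd_succAbove_castAdd 0 x)).trans ?_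
    simp [optionSumRight]
  · refine (congrArg _ (DecGraph.natAdd_succAbove_natAdd 0 x)).trans ?_
    simp [optionSumRight, optionEnum_succ]

theorem ltr_lab_optionSumRight (hP : P.IsTraP) (a : Fin k ≃ A) (b : Fin l ≃ B) (a' : Fin k' ≃ A')
    (b' : Fin l' ≃ B') (p : P.obj (k' + k + 1) (l' + l + 1)) :
    P.ltr (P.lab (k := k' + k + 1) (l := l' + l + 1)
      ((finSumFinEquiv.symm.trans (Equiv.sumCongr a' (optionEnum a))).trans (optionSumRight A' A))
      ((finSumFinEquiv.symm.trans (Equiv.sumCongr b' (optionEnum b))).trans (optionSumRight B' B))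
      p) =
    P.lab (finSumFinEquiv.symm.trans (Equiv.sumCongr a' a))
      (finSumFinEquiv.symm.trans (Equiv.sumCongr b' b))
      (P.tr (k := k' + k) (l := l' + l) (Fin.natAdd k' (0 : Fin (k + 1)))
        (Fin.natAdd l' (0 : Fin (l + 1))) p) :=
  ltr_lab hP (k := k' + k) (l := l' + l) _ _ (optionSumRight_enum_zero a a') (optionSumRight_enum_zero b b')
    (optionSumRight_enum_succAbove a a') (optionSumRight_enum_succAbove b b') p

theorem lmul_ltr (hP : P.IsTraP) (x : P.Lab A' B') (y : P.Lab (Option A) (Option B)) :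
    P.ltr (P.rel (optionSumRight A' A) (optionSumRight B' B) (P.lmul x y)) =
      P.lmul x (P.ltr y) := by
  have key : ∀ {k l k' l' : ℕ} (a : Fin k ≃ A) (b : Fin l ≃ B) (a' : Fin k' ≃ A')
      (b' : Fin l' ≃ B') (p : P.obj k' l') (q : P.obj (k + 1) (l + 1)),
      P.ltr (P.rel (optionSumRight A' A) (optionSumRight B' B)
        (P.lmul (P.lab a' b' p) (P.lab (optionEnum a) (optionEnum b) q))) =
      P.lmul (P.lab a' b' p) (P.ltr (P.lab (optionEnum a) (optionEnum b) q)) := by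
    intro k l k' l' a b a' b' p q
    rw [ltr_lab_optionEnum hP, lmul_lab hP, lmul_lab hP, ← hP.tr_mul_right, rel_lab hP]
    exact ltr_lab_optionSumRight hP a b a' b' _
  obtain ⟨p, rfl⟩ := exists_eq_lab hP (Finite.equivFin A').symm (Finite.equivFin B').symm x
  obtain ⟨q, rfl⟩ := exists_eq_lab hP (optionEnum (Finite.equivFin A).symm)
    (optionEnum (Finite.equivFin B).symm) y
  exact key _ _ _ _ p q

/-- The unit `I`, labelled. -/
noncomputable def lunit (P : TraPData.{v, w} K) : P.Lab Unit Unit :=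
  P.lab finOneEquiv finOneEquiv P.unit

/-- The unit `I₀`, labelled. -/
noncomputable def lone (P : TraPData.{v, w} K) : P.Lab Empty Empty :=
  P.lab finZeroEquiv finZeroEquiv P.one

theorem sumUnit_last {T : Type} {n : ℕ} (a : Fin n ≃ T) :
    ((finSumFinEquiv.symm.trans (Equiv.sumCongr a finOneEquiv)).trans (optionSumUnit T))
      (Fin.last n) = none := by
  have h : Fin.last n = finSumFinEquiv (Sum.inr (0 : Fin 1)) := rfl
  rw [h]
  simp [optionSumUnit]

theorem sumUnit_castSucc {T : Type} {n : ℕ} (a : Fin n ≃ T) (x : Fin n) :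
    ((finSumFinEquiv.symm.trans (Equiv.sumCongr a finOneEquiv)).trans (optionSumUnit T))
      ((Fin.last n).succAbove x) = some (a x) := by
  have h : (Fin.last n).succAbove x = finSumFinEquiv (Sum.inl x) := Fin.succAbove_last_apply x
  rw [h]
  simp [optionSumUnit]

theorem sumUnit_castSucc_last {T : Type} {n : ℕ} (a : Fin n ≃ T) :
    ((finSumFinEquiv.symm.trans (Equiv.sumCongr (finSuccEquivLast.trans (Equiv.optionCongr a))
      finOneEquiv)).trans ((optionSumUnit (Option T)).trans (optionSwap T)))
        (Fin.last n).castSucc = none ∧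
    ∀ x, ((finSumFinEquiv.symm.trans (Equiv.sumCongr (finSuccEquivLast.trans (Equiv.optionCongr a))
      finOneEquiv)).trans ((optionSumUnit (Option T)).trans (optionSwap T)))
        ((Fin.last n).castSucc.succAbove x) =
      some (finSuccEquivLast.trans (Equiv.optionCongr a) x) := by
  constructor
  · have h : (Fin.last n).castSucc = finSumFinEquiv (Sum.inl (Fin.last n) : Fin (n + 1) ⊕ Fin 1) :=
      rfl
    rw [h]
    simp [optionSumUnit, optionSwap]
  · intro x
    induction x using Fin.lastCases with
    | last =>
      have h : (Fin.last n).castSucc.succAbove (Fin.last n) =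
        finSumFinEquiv (Sum.inr 0 : Fin (n + 1) ⊕ Fin 1) := DecGraph.castSucc_succAbove_last _
      rw [h]
      simp [optionSumUnit, optionSwap]
    | cast x =>
      have h : (Fin.last n).castSucc.succAbove x.castSucc =
          finSumFinEquiv (Sum.inl x.castSucc : Fin (n + 1) ⊕ Fin 1) := by
        rw [Fin.castSucc_succAbove_castSucc, Fin.succAbove_last_apply]
        rfl
      rw [h]
      simp [optionSumUnit, optionSwap]

/-- The marked output of `x` is glued to the input of `I`, and `optionSwap` lets the output of `I`
take its place. Enumerating the mark last makes the cycle in the axiom trivial, so only this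
instance of it is used. -/
theorem ltr_unit_left (hP : P.IsTraP) (x : P.Lab A (Option B)) :
    P.ltr (P.rel (optionSumUnit A) ((optionSumUnit (Option B)).trans (optionSwap B))
      (P.lmul x P.lunit)) = x := by
  obtain ⟨p, rfl⟩ := exists_eq_lab hP (Finite.equivFin A).symm
    (finSuccEquivLast.trans (Equiv.optionCongr (Finite.equivFin B).symm)) x
  rw [lunit, lmul_lab hP, rel_lab hP]
  have h := hP.tr_mul_unit_left (Fin.last _) p
  rw [Fin.cycleIcc_eq, inv_one, hP.one_lact] at h
  refine (ltr_lab hP (k := Nat.card A) (l := Nat.card B + 1) _ _ ?_ ?_ ?_ ?_ _).trans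
    (congrArg _ h)
  · exact sumUnit_last _
  · exact (sumUnit_castSucc_last _).1
  · exact sumUnit_castSucc _
  · exact (sumUnit_castSucc_last _).2

theorem ltr_unit_right (hP : P.IsTraP) (x : P.Lab (Option A) B) :
    P.ltr (P.rel ((optionSumUnit (Option A)).trans (optionSwap A)) (optionSumUnit B)
      (P.lmul x P.lunit)) = x := by
  obtain ⟨p, rfl⟩ := exists_eq_lab hP
    (finSuccEquivLast.trans (Equiv.optionCongr (Finite.equivFin A).symm)) (Finite.equivFin B).symm x
  rw [lunit, lmul_lab hP, rel_lab hP]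
  have h := hP.tr_mul_unit_right (Fin.last _) p
  rw [Fin.cycleIcc_eq, hP.ract_one] at h
  refine (ltr_lab hP (k := Nat.card A + 1) (l := Nat.card B) _ _ ?_ ?_ ?_ ?_ _).trans
    (congrArg _ h)
  · exact (sumUnit_castSucc_last _).1
  · exact sumUnit_last _
  · exact (sumUnit_castSucc_last _).2
  · exact sumUnit_castSucc _

end TraPData

/-! ### Iterated partial traces and products -/

/-- A type with `n` elements, built by adding elements to the empty type. -/
def Opt : ℕ → Type
  | 0 => Empty
  | n + 1 => Option (Opt n)

instance Opt.finite : ∀ n, Finite (Opt n)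
  | 0 => inferInstanceAs (Finite Empty)
  | n + 1 => by
    have := Opt.finite n
    exact inferInstanceAs (Finite (Option (Opt n)))

theorem Opt.nonempty_equiv_fin : ∀ n, Nonempty (Opt n ≃ Fin n)
  | 0 => ⟨finZeroEquiv.symm⟩
  | n + 1 => by
    obtain ⟨e⟩ := Opt.nonempty_equiv_fin n
    exact ⟨(Equiv.optionCongr e).trans (finSuccEquiv n).symm⟩

theorem Opt.nonempty_equiv (V : Type) [Finite V] : Nonempty (Opt (Nat.card V) ≃ V) := by
  obtain ⟨e⟩ := Opt.nonempty_equiv_fin (Nat.card V)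
  exact ⟨e.trans (Finite.equivFin V).symm⟩

theorem Opt.eq_of_equiv {m n : ℕ} (e : Opt m ≃ Opt n) : m = n := by
  obtain ⟨f⟩ := Opt.nonempty_equiv_fin m
  obtain ⟨g⟩ := Opt.nonempty_equiv_fin n
  exact Fin.eq_of_equiv ((f.symm.trans e).trans g)

theorem optionSwap_eq_swap (A : Type) [DecidableEq (Option (Option A))] :
    TraPData.optionSwap A = Equiv.swap none (some none) := by
  ext1 x
  rcases x with _ | _ | a
  · simp [TraPData.optionSwap]
  · simp [TraPData.optionSwap]
  · rw [Equiv.swap_apply_of_ne_of_ne (by simp) (by simp)]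
    rfl

/-- A permutation is a transposition of `none` with some point, times a permutation fixing `none`.
Those transpositions arise from the exchange of the two newest points by conjugation with lifted
transpositions. -/
theorem optionOption_perm_induction {T : Type} {Q : Equiv.Perm (Option (Option T)) → Prop}
    (mul : ∀ σ τ, Q σ → Q τ → Q (σ * τ)) (lift : ∀ σ : Equiv.Perm (Option T), Q (Equiv.optionCongr σ))
    (swap : Q (TraPData.optionSwap T)) (σ : Equiv.Perm (Option (Option T))) : Q σ := by
  classical
  obtain ⟨⟨x, τ⟩, rfl⟩ := Equiv.Perm.decomposeOption.symm.surjective σ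
  rw [Equiv.Perm.decomposeOption_symm_apply]
  refine mul _ _ ?_ (lift τ)
  have h1 : ∀ y : Option T, Q (Equiv.swap (some none) (some y)) := by
    intro y
    have h := lift (Equiv.swap none y)
    rw [Equiv.optionCongr_swap] at h
    convert h
  have h0 : Q (Equiv.swap none (some none)) := by
    rw [← optionSwap_eq_swap]
    exact swap
  rcases x with _ | _ | y
  · rw [Equiv.swap_self]
    have h := lift (Equiv.refl _)
    rwa [Equiv.optionCongr_refl] at h
  · convert h0
  · have h2 : Equiv.swap (some none) (some (some y)) * Equiv.swap none (some none) *
        Equiv.swap (some none) (some (some y)) = Equiv.swap (some (some y)) none :=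
      Equiv.swap_mul_swap_mul_swap (by simp) (by simp)
    have h3 := mul _ _ (mul _ _ (h1 (some y)) h0) (h1 (some y))
    rw [h2, Equiv.swap_comm] at h3
    convert h3

/-- Reduces the invariance of an iterated trace or product under all reorderings to the exchange of
its two outermost steps. -/
theorem Opt.perm_induction {Q : ∀ n, Equiv.Perm (Opt n) → Prop} (one : ∀ n, Q n 1)
    (mul : ∀ n σ τ, Q n σ → Q n τ → Q n (σ * τ))
    (lift : ∀ n (σ : Equiv.Perm (Opt n)), Q n σ → Q (n + 1) (Equiv.optionCongr σ))
    (swap : ∀ n, Q (n + 2) (TraPData.optionSwap (Opt n))) : ∀ n σ, Q n σ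
  | 0, σ => by
    have : σ = 1 := Equiv.ext fun x => (x : Empty).elim
    exact this ▸ one 0
  | 1, σ => by
    have : σ = 1 := Equiv.ext fun x => by
      change Option Empty at x
      change Equiv.Perm (Option Empty) at σ
      exact Subsingleton.elim (σ x) x
    exact this ▸ one 1
  | n + 2, σ => optionOption_perm_induction (Q := Q (n + 2)) (mul (n + 2))
      (fun σ => lift (n + 1) σ (Opt.perm_induction one mul lift swap (n + 1) σ)) (swap n) σ

namespace TraPData

variable {K : Type w} [Field K] {P : TraPData.{v, w} K} {k l k' l' k'' l'' : ℕ}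

variable {A B A' B' A'' B'' A₁ B₁ : Type} [Finite A] [Finite B] [Finite A'] [Finite B']
  [Finite A''] [Finite B''] [Finite A₁] [Finite B₁]

/-! #### Traces over a finite type -/

/-- The iterated partial trace over `Opt n`. -/
noncomputable def trOpt (P : TraPData.{v, w} K) : ∀ (n : ℕ) {A B : Type} [Finite A] [Finite B],
    P.Lab (A ⊕ Opt n) (B ⊕ Opt n) →ₗ[K] P.Lab A B
  | 0, A, B, _, _ => P.rel (Equiv.sumEmpty A Empty) (Equiv.sumEmpty B Empty)
  | n + 1, A, B, _, _ => trOpt P n ∘ₗ P.ltr ∘ₗ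
      P.rel (optionSumRight A (Opt n)) (optionSumRight B (Opt n))

theorem trOpt_rel (hP : P.IsTraP) (n : ℕ) : ∀ {A B A' B' : Type} [Finite A] [Finite B] [Finite A']
    [Finite B'] (f : A ≃ A') (g : B ≃ B') (x : P.Lab (A ⊕ Opt n) (B ⊕ Opt n)),
    P.trOpt n (P.rel (Equiv.sumCongr f (Equiv.refl _)) (Equiv.sumCongr g (Equiv.refl _)) x) =
      P.rel f g (P.trOpt n x) := by
  induction n with
  | zero =>
    intro A B A' B' _ _ _ _ f g x
    refine (rel_rel hP _ _ _ _ x).trans (Eq.symm ((rel_rel hP _ _ _ _ x).trans ?_))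
    exact rel_congr (by rintro (_ | ⟨⟨⟩⟩); rfl) (by rintro (_ | ⟨⟨⟩⟩); rfl) x
  | succ n ih =>
    intro A B A' B' _ _ _ _ f g x
    change P.Lab (A ⊕ Option (Opt n)) (B ⊕ Option (Opt n)) at x
    refine Eq.trans ?_ (ih f g _)
    refine congrArg (P.trOpt n) (Eq.trans (congrArg P.ltr ?_) (ltr_rel hP _ _ _))
    refine (rel_rel hP _ _ _ _ x).trans (Eq.symm ((rel_rel hP _ _ _ _ x).trans ?_))
    exact rel_congr (by rintro (_ | _ | _) <;> rfl) (by rintro (_ | _ | _) <;> rfl) x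

/-- The permutation acts on the traced inputs and outputs alike, so the same pairs are glued, only
in another order. A lifted permutation passes the outermost trace by naturality; the exchange of the
two newest points is `ltr_ltr`. -/
theorem trOpt_perm (hP : P.IsTraP) (n : ℕ) (σ : Equiv.Perm (Opt n)) :
    ∀ {A B : Type} [Finite A] [Finite B] (x : P.Lab (A ⊕ Opt n) (B ⊕ Opt n)),
    P.trOpt n (P.rel (Equiv.sumCongr (Equiv.refl _) σ) (Equiv.sumCongr (Equiv.refl _) σ) x) =
      P.trOpt n x := by
  refine Opt.perm_induction (Q := fun n σ => ∀ {A B : Type} [Finite A] [Finite B]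
    (x : P.Lab (A ⊕ Opt n) (B ⊕ Opt n)), P.trOpt n (P.rel (Equiv.sumCongr (Equiv.refl _) σ)
      (Equiv.sumCongr (Equiv.refl _) σ) x) = P.trOpt n x) ?_ ?_ ?_ ?_ n σ
  · intro n A B _ _ x
    refine congrArg _ ((rel_congr ?_ ?_ x).trans (rel_refl hP x))
    · rintro (_ | _) <;> rfl
    · rintro (_ | _) <;> rfl
  · intro n σ τ hσ hτ A B _ _ x
    refine Eq.trans ?_ ((hσ _).trans (hτ x))
    refine congrArg _ (Eq.trans ?_ (rel_rel hP _ _ _ _ x).symm)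
    exact rel_congr (by rintro (_ | _) <;> rfl) (by rintro (_ | _) <;> rfl) x
  · intro n σ hσ A B _ _ x
    change P.Lab (A ⊕ Option (Opt n)) (B ⊕ Option (Opt n)) at x
    refine Eq.trans ?_ (hσ _)
    refine congrArg (P.trOpt n) (Eq.trans (congrArg P.ltr ?_) (ltr_rel hP _ _ _))
    refine (rel_rel hP _ _ _ _ x).trans (Eq.symm ((rel_rel hP _ _ _ _ x).trans ?_))
    exact rel_congr (by rintro (_ | _ | _) <;> rfl) (by rintro (_ | _ | _) <;> rfl) x
  · intro n A B _ _ x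
    change P.Lab (A ⊕ Option (Option (Opt n))) (B ⊕ Option (Option (Opt n))) at x
    have h : ∀ x : P.Lab (A ⊕ Option (Option (Opt n))) (B ⊕ Option (Option (Opt n))),
        P.trOpt (n + 2) x = P.trOpt n (P.ltr (P.ltr (P.rel
          ((optionSumRight A (Option (Opt n))).trans (Equiv.optionCongr (optionSumRight A (Opt n))))
          ((optionSumRight B (Option (Opt n))).trans (Equiv.optionCongr (optionSumRight B (Opt n))))
          x))) := by
      intro x
      refine congrArg (P.trOpt n) (congrArg P.ltr ?_)
      exact (ltr_rel hP _ _ _).symm.trans (congrArg P.ltr (rel_rel hP _ _ _ _ x))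
    refine (h _).trans (Eq.trans ?_ (h x).symm)
    refine congrArg (P.trOpt n) (Eq.trans ?_ (ltr_ltr hP _))
    refine congrArg P.ltr (congrArg P.ltr ?_)
    refine (rel_rel hP _ _ _ _ x).trans (Eq.symm ((rel_rel hP _ _ _ _ x).trans ?_))
    exact rel_congr (by rintro (_ | _ | _ | _) <;> rfl) (by rintro (_ | _ | _ | _) <;> rfl) x

variable {S T : Type} [Finite S] [Finite T]

/-- An enumeration of a finite type. -/
noncomputable def enum (S : Type) [Finite S] : Opt (Nat.card S) ≃ S :=
  (Opt.nonempty_equiv S).some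

/-- The trace over a finite type. -/
noncomputable def ltrace (P : TraPData.{v, w} K) (S : Type) [Finite S] :
    P.Lab (A ⊕ S) (B ⊕ S) →ₗ[K] P.Lab A B :=
  P.trOpt (Nat.card S) ∘ₗ P.rel (Equiv.sumCongr (Equiv.refl _) (enum S).symm)
    (Equiv.sumCongr (Equiv.refl _) (enum S).symm)

/-- Two enumerations of `S` differ by a permutation, so any of them computes the trace. This yields
the recursion `ltrace_option`, on which inductions over finite types rest. -/
theorem ltrace_eq (hP : P.IsTraP) {n : ℕ} (e : Opt n ≃ S) (x : P.Lab (A ⊕ S) (B ⊕ S)) :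
    P.ltrace S x = P.trOpt n (P.rel (Equiv.sumCongr (Equiv.refl _) e.symm)
      (Equiv.sumCongr (Equiv.refl _) e.symm) x) := by
  obtain rfl := Opt.eq_of_equiv (e.trans (enum S).symm)
  refine (trOpt_perm hP _ ((enum S).trans e.symm) _).symm.trans ?_
  refine congrArg _ ((rel_rel hP _ _ _ _ x).trans ?_)
  exact rel_congr (by rintro (_ | _) <;> simp) (by rintro (_ | _) <;> simp) x

theorem ltrace_rel (hP : P.IsTraP) (f : A ≃ A') (g : B ≃ B') (h : S ≃ T)
    (x : P.Lab (A ⊕ S) (B ⊕ S)) :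
    P.ltrace T (P.rel (Equiv.sumCongr f h) (Equiv.sumCongr g h) x) =
      P.rel f g (P.ltrace S x) := by
  rw [ltrace_eq hP ((enum S).trans h), ltrace, LinearMap.comp_apply, ← trOpt_rel hP, rel_rel hP,
    rel_rel hP]
  refine congrArg _ (rel_congr ?_ ?_ x)
  · rintro (_ | _) <;> simp
  · rintro (_ | _) <;> simp

theorem ltrace_empty (hP : P.IsTraP) (x : P.Lab (A ⊕ Empty) (B ⊕ Empty)) :
    P.ltrace Empty x = P.rel (Equiv.sumEmpty A Empty) (Equiv.sumEmpty B Empty) x := by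
  refine (ltrace_eq hP (n := 0) (Equiv.refl Empty) x).trans ?_
  refine (rel_rel hP _ _ _ _ x).trans ?_
  exact rel_congr (by rintro (_ | ⟨⟨⟩⟩); rfl) (by rintro (_ | ⟨⟨⟩⟩); rfl) x

theorem ltrace_option (hP : P.IsTraP) (x : P.Lab (A ⊕ Option S) (B ⊕ Option S)) :
    P.ltrace (Option S) x =
      P.ltrace S (P.ltr (P.rel (optionSumRight A S) (optionSumRight B S) x)) := by
  refine (ltrace_eq hP (n := Nat.card S + 1) (Equiv.optionCongr (enum S)) x).trans ?_
  rw [ltrace_eq hP (enum S), ← ltr_rel hP]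
  refine congrArg (P.trOpt _) (congrArg P.ltr ?_)
  refine (rel_rel hP _ _ _ _ x).trans (Eq.symm ((rel_rel hP _ _ _ _ x).trans ?_))
  exact rel_congr (by rintro (_ | _ | _) <;> rfl) (by rintro (_ | _ | _) <;> rfl) x

/-- Move the added element of the left summand out. -/
def optionSumLeft (A B : Type) : Option A ⊕ B ≃ Option (A ⊕ B) where
  toFun := Sum.elim (Option.map Sum.inl) (fun b => some (Sum.inr b))
  invFun := fun x => x.elim (Sum.inl none) (Sum.map some id)
  left_inv := by rintro ((_ | _) | _) <;> rfl
  right_inv := by rintro (_ | _ | _) <;> rfl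

/-- Induction on a finite type, with invariance under bijections. -/
theorem finite_induction {Q : (S : Type) → [Finite S] → Prop}
    (equiv : ∀ (S T : Type) [Finite S] [Finite T] (_ : S ≃ T), Q S → Q T) (empty : Q Empty)
    (option : ∀ (S : Type) [Finite S], Q S → Q (Option S)) (S : Type) [Finite S] : Q S := by
  have h : ∀ n, Q (Opt n) := by
    intro n
    induction n with
    | zero => exact empty
    | succ n ih => exact option (Opt n) ih
  exact equiv _ _ (enum S) (h _)

/-- The single trace passes the traces over the points of `S` one at a time, each time by `ltr_ltr`.
-/
theorem ltr_ltrace (hP : P.IsTraP) (S : Type) [Finite S] :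
    ∀ {A B : Type} [Finite A] [Finite B] (x : P.Lab (Option A ⊕ S) (Option B ⊕ S)),
    P.ltr (P.ltrace S x) =
      P.ltrace S (P.ltr (P.rel (optionSumLeft A S) (optionSumLeft B S) x)) := by
  refine finite_induction (Q := fun S _ => ∀ {A B : Type} [Finite A] [Finite B]
    (x : P.Lab (Option A ⊕ S) (Option B ⊕ S)), P.ltr (P.ltrace S x) =
      P.ltrace S (P.ltr (P.rel (optionSumLeft A S) (optionSumLeft B S) x))) ?_ ?_ ?_ S
  · intro S T _ _ e h A B _ _ x
    have hr : ∀ {A B : Type} [Finite A] [Finite B] (x : P.Lab (A ⊕ T) (B ⊕ T)),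
        P.ltrace T x = P.ltrace S (P.rel (Equiv.sumCongr (Equiv.refl _) e.symm)
          (Equiv.sumCongr (Equiv.refl _) e.symm) x) := fun x =>
      (rel_refl hP _).symm.trans (ltrace_rel hP _ _ e.symm x).symm
    rw [hr, hr, h, ← ltr_rel hP, rel_rel hP, rel_rel hP]
    refine congrArg (P.ltrace S) (congrArg P.ltr (rel_congr ?_ ?_ x))
    · rintro ((_ | _) | _) <;> rfl
    · rintro ((_ | _) | _) <;> rfl
  · intro A B _ _ x
    rw [ltrace_empty hP, ltrace_empty hP, ← ltr_rel hP, rel_rel hP]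
    refine congrArg P.ltr (rel_congr ?_ ?_ x)
    · rintro ((_ | _) | ⟨⟨⟩⟩) <;> rfl
    · rintro ((_ | _) | ⟨⟨⟩⟩) <;> rfl
  · intro S _ h A B _ _ x
    rw [ltrace_option hP, ltrace_option hP, h, ← ltr_rel hP, ← ltr_rel hP, rel_rel hP, rel_rel hP,
      ← ltr_ltr hP, rel_rel hP]
    refine congrArg (P.ltrace S) (congrArg P.ltr (congrArg P.ltr (rel_congr ?_ ?_ x)))
    · rintro ((_ | _) | (_ | _)) <;> rfl
    · rintro ((_ | _) | (_ | _)) <;> rfl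

theorem lmul_ltrace (hP : P.IsTraP) (S : Type) [Finite S] :
    ∀ {A B A' B' : Type} [Finite A] [Finite B] [Finite A'] [Finite B'] (x : P.Lab A' B')
      (y : P.Lab (A ⊕ S) (B ⊕ S)),
    P.lmul x (P.ltrace S y) = P.ltrace S (P.rel (Equiv.sumAssoc A' A S).symm
      (Equiv.sumAssoc B' B S).symm (P.lmul x y)) := by
  refine finite_induction (Q := fun S _ => ∀ {A B A' B' : Type} [Finite A] [Finite B] [Finite A']
    [Finite B'] (x : P.Lab A' B') (y : P.Lab (A ⊕ S) (B ⊕ S)),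
    P.lmul x (P.ltrace S y) = P.ltrace S (P.rel (Equiv.sumAssoc A' A S).symm
      (Equiv.sumAssoc B' B S).symm (P.lmul x y))) ?_ ?_ ?_ S
  · intro S T _ _ e h A B A' B' _ _ _ _ x y
    have hr : ∀ {A B : Type} [Finite A] [Finite B] (x : P.Lab (A ⊕ T) (B ⊕ T)),
        P.ltrace T x = P.ltrace S (P.rel (Equiv.sumCongr (Equiv.refl _) e.symm)
          (Equiv.sumCongr (Equiv.refl _) e.symm) x) := fun x =>
      (rel_refl hP _).symm.trans (ltrace_rel hP _ _ e.symm x).symm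
    rw [hr, hr, h, rel_rel hP]
    conv_lhs => rw [← rel_refl hP x]
    rw [lmul_rel hP, rel_rel hP]
    refine congrArg (P.ltrace S) (rel_congr ?_ ?_ _)
    · rintro (_ | _ | _) <;> rfl
    · rintro (_ | _ | _) <;> rfl
  · intro A B A' B' _ _ _ _ x y
    rw [ltrace_empty hP, ltrace_empty hP, rel_rel hP]
    conv_lhs => rw [← rel_refl hP x]
    rw [lmul_rel hP]
    refine rel_congr ?_ ?_ _
    · rintro (_ | _ | ⟨⟨⟩⟩) <;> rfl
    · rintro (_ | _ | ⟨⟨⟩⟩) <;> rfl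
  · intro S _ h A B A' B' _ _ _ _ x y
    rw [ltrace_option hP, ltrace_option hP, h, ← lmul_ltr hP, ← ltr_rel hP, rel_rel hP, rel_rel hP]
    conv_lhs => rw [← rel_refl hP x]
    rw [lmul_rel hP, rel_rel hP]
    refine congrArg (P.ltrace S) (congrArg P.ltr (rel_congr ?_ ?_ _))
    · rintro (_ | _ | _ | _) <;> rfl
    · rintro (_ | _ | _ | _) <;> rfl

theorem ltrace_ltrace (hP : P.IsTraP) (S T : Type) [Finite S] [Finite T] :
    ∀ {A B : Type} [Finite A] [Finite B] (x : P.Lab ((A ⊕ S) ⊕ T) ((B ⊕ S) ⊕ T)),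
    P.ltrace S (P.ltrace T x) =
      P.ltrace (S ⊕ T) (P.rel (Equiv.sumAssoc A S T) (Equiv.sumAssoc B S T) x) := by
  refine finite_induction (Q := fun T _ => ∀ {A B : Type} [Finite A] [Finite B]
    (x : P.Lab ((A ⊕ S) ⊕ T) ((B ⊕ S) ⊕ T)),
    P.ltrace S (P.ltrace T x) =
      P.ltrace (S ⊕ T) (P.rel (Equiv.sumAssoc A S T) (Equiv.sumAssoc B S T) x)) ?_ ?_ ?_ T
  · intro T T' _ _ e h A B _ _ x
    have hr : ∀ {A B : Type} [Finite A] [Finite B] {T T' : Type} [Finite T] [Finite T'] (e : T ≃ T')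
        (x : P.Lab (A ⊕ T') (B ⊕ T')),
        P.ltrace T' x = P.ltrace T (P.rel (Equiv.sumCongr (Equiv.refl _) e.symm)
          (Equiv.sumCongr (Equiv.refl _) e.symm) x) := fun e x =>
      (rel_refl hP _).symm.trans (ltrace_rel hP _ _ e.symm x).symm
    rw [hr e, hr (Equiv.sumCongr (Equiv.refl S) e), h, rel_rel hP, rel_rel hP]
    refine congrArg (P.ltrace (S ⊕ T)) (rel_congr ?_ ?_ x)
    · rintro ((_ | _) | _) <;> rfl
    · rintro ((_ | _) | _) <;> rfl
  · intro A B _ _ x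
    rw [ltrace_empty hP]
    refine (rel_refl hP _).symm.trans ((ltrace_rel hP _ _ (Equiv.sumEmpty S Empty).symm _).symm.trans ?_)
    rw [rel_rel hP]
    refine congrArg (P.ltrace (S ⊕ Empty)) (rel_congr ?_ ?_ x)
    · rintro ((_ | _) | ⟨⟨⟩⟩) <;> rfl
    · rintro ((_ | _) | ⟨⟨⟩⟩) <;> rfl
  · intro T _ h A B _ _ x
    rw [ltrace_option hP, h]
    refine Eq.trans ?_ ((rel_refl hP _).symm.trans
      (ltrace_rel hP _ _ (optionSumRight S T) _).symm).symm
    rw [ltrace_option hP, ← ltr_rel hP, rel_rel hP, rel_rel hP, rel_rel hP]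
    refine congrArg (P.ltrace (S ⊕ T)) (congrArg P.ltr (rel_congr ?_ ?_ x))
    · rintro ((_ | _) | _ | _) <;> rfl
    · rintro ((_ | _) | _ | _) <;> rfl

end TraPData

namespace TraPData

variable {K : Type w} [Field K] {P : TraPData.{v, w} K} {k l k' l' k'' l'' : ℕ}

variable {A B A' B' A'' B'' A₁ B₁ : Type} [Finite A] [Finite B] [Finite A'] [Finite B']
  [Finite A''] [Finite B''] [Finite A₁] [Finite B₁]

theorem rel_comp (hP : P.IsTraP) {f : A ≃ A'} {g : B ≃ B'} {f' : A' ≃ A''} {g' : B' ≃ B''}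
    {f'' : A ≃ A''} {g'' : B ≃ B''} (hf : ∀ x, f' (f x) = f'' x) (hg : ∀ x, g' (g x) = g'' x)
    (x : P.Lab A B) : P.rel f' g' (P.rel f g x) = P.rel f'' g'' x :=
  (rel_rel hP f g f' g' x).trans (rel_congr hf hg x)

theorem lmul_rel_left (hP : P.IsTraP) (f : A ≃ A') (g : B ≃ B') (x : P.Lab A B)
    (y : P.Lab A'' B'') : P.lmul (P.rel f g x) y =
      P.rel (Equiv.sumCongr f (Equiv.refl _)) (Equiv.sumCongr g (Equiv.refl _)) (P.lmul x y) := by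
  rw [← lmul_rel hP, rel_refl hP]

theorem lmul_rel_right (hP : P.IsTraP) (f : A ≃ A') (g : B ≃ B') (x : P.Lab A B)
    (y : P.Lab A'' B'') : P.lmul y (P.rel f g x) =
      P.rel (Equiv.sumCongr (Equiv.refl _) f) (Equiv.sumCongr (Equiv.refl _) g) (P.lmul y x) := by
  rw [← lmul_rel hP, rel_refl hP]

/-- `(A ⊕ B) ⊕ C ≃ (A ⊕ C) ⊕ B`. -/
def sumRightComm (A B C : Type) : (A ⊕ B) ⊕ C ≃ (A ⊕ C) ⊕ B where
  toFun := Sum.elim (Sum.elim (fun a => Sum.inl (Sum.inl a)) Sum.inr) (fun c => Sum.inl (Sum.inr c))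
  invFun := Sum.elim (Sum.elim (fun a => Sum.inl (Sum.inl a)) Sum.inr)
    (fun c => Sum.inl (Sum.inr c))
  left_inv := by rintro ((_ | _) | _) <;> rfl
  right_inv := by rintro ((_ | _) | _) <;> rfl

/-- `A ⊕ (B ⊕ C) ≃ B ⊕ (A ⊕ C)`. -/
def sumLeftComm (A B C : Type) : A ⊕ (B ⊕ C) ≃ B ⊕ (A ⊕ C) where
  toFun := Sum.elim (fun a => Sum.inr (Sum.inl a)) (Sum.map id Sum.inr)
  invFun := Sum.elim (fun a => Sum.inr (Sum.inl a)) (Sum.map id Sum.inr)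
  left_inv := by rintro (_ | _ | _) <;> rfl
  right_inv := by rintro (_ | _ | _) <;> rfl

theorem lmul_assoc' (hP : P.IsTraP) (x : P.Lab A B) (y : P.Lab A' B') (z : P.Lab A'' B'') :
    P.lmul (P.lmul x y) z =
      P.rel (Equiv.sumAssoc _ _ _).symm (Equiv.sumAssoc _ _ _).symm (P.lmul x (P.lmul y z)) := by
  rw [← lmul_assoc hP, rel_rel hP]
  refine (rel_refl hP _).symm.trans (rel_congr ?_ ?_ _) <;> intro x <;> simp

theorem lmul_left_comm (hP : P.IsTraP) (x : P.Lab A B) (y : P.Lab A' B') (z : P.Lab A'' B'') :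
    P.lmul x (P.lmul y z) =
      P.rel (sumLeftComm _ _ _) (sumLeftComm _ _ _) (P.lmul y (P.lmul x z)) := by
  rw [← lmul_assoc hP, ← lmul_assoc hP, ← lmul_comm hP y x, lmul_rel_left hP, rel_rel hP,
    rel_rel hP]
  refine rel_congr ?_ ?_ _ <;> rintro ((_ | _) | _) <;> rfl

theorem lmul_right_comm (hP : P.IsTraP) (x : P.Lab A B) (y : P.Lab A' B') (z : P.Lab A'' B'') :
    P.lmul (P.lmul x y) z =
      P.rel (sumRightComm _ _ _) (sumRightComm _ _ _) (P.lmul (P.lmul x z) y) := by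
  rw [lmul_assoc' hP, lmul_assoc' hP x z, ← lmul_comm hP z y, lmul_rel_right hP, rel_rel hP,
    rel_rel hP]
  refine rel_congr ?_ ?_ _ <;> rintro (_ | _ | _) <;> rfl

theorem lmul_lone (hP : P.IsTraP) (x : P.Lab A B) :
    P.lmul x P.lone = P.rel (Equiv.sumEmpty A Empty).symm (Equiv.sumEmpty B Empty).symm x := by
  have h := lmul_unit_right hP x finZeroEquiv
  conv_rhs => rw [← h, rel_rel hP]
  refine (rel_refl hP _).symm.trans (rel_congr ?_ ?_ _) <;> intro x <;> simp

theorem lone_lmul (hP : P.IsTraP) (x : P.Lab A B) :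
    P.lmul P.lone x = P.rel (Equiv.emptySum Empty A).symm (Equiv.emptySum Empty B).symm x := by
  rw [← lmul_comm hP, lmul_lone hP, rel_rel hP]
  refine rel_congr ?_ ?_ _ <;> intro x <;> rfl

/-! #### Products over a finite type -/

/-- A disjoint union over `Option V`. -/
def sigmaOption {V : Type} (A : Option V → Type) :
    A none ⊕ (Σ i, A (some i)) ≃ Σ i, A i where
  toFun := Sum.elim (fun a => ⟨none, a⟩) (fun a => ⟨some a.1, a.2⟩)
  invFun
    | ⟨none, a⟩ => Sum.inl a
    | ⟨some i, a⟩ => Sum.inr ⟨i, a⟩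
  left_inv := by rintro (_ | ⟨_, _⟩) <;> rfl
  right_inv := by rintro ⟨_ | _, _⟩ <;> rfl

section

variable {V : Type} [Finite V]

/-- The product of a family indexed by `Option V`, the product over `V` being given. -/
noncomputable def lprodCons {A B : Option V → Type} [∀ i, Finite (A i)] [∀ i, Finite (B i)]
    (x : P.Lab (A none) (B none)) (y : P.Lab (Σ i, A (some i)) (Σ i, B (some i))) :
    P.Lab (Σ i, A i) (Σ i, B i) :=
  P.rel (sigmaOption A) (sigmaOption B) (P.lmul x y)

theorem lprodCons_perm (hP : P.IsTraP) {A B : Option V → Type} [∀ i, Finite (A i)]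
    [∀ i, Finite (B i)] (σ : Equiv.Perm V) (x : P.Lab (A none) (B none))
    (y : P.Lab (Σ i, A (some (σ i))) (Σ i, B (some (σ i)))) :
    P.rel (Equiv.sigmaCongrLeft (β := A) (Equiv.optionCongr σ))
      (Equiv.sigmaCongrLeft (β := B) (Equiv.optionCongr σ))
      (lprodCons (A := fun i => A (Equiv.optionCongr σ i))
        (B := fun i => B (Equiv.optionCongr σ i)) x y) =
    lprodCons x (P.rel (Equiv.sigmaCongrLeft (β := fun i => A (some i)) σ)
      (Equiv.sigmaCongrLeft (β := fun i => B (some i)) σ) y) := by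
  refine Eq.trans ?_ (congrArg (P.rel _ _) (lmul_rel_right hP _ _ _ _).symm)
  refine Eq.trans (rel_rel hP _ _ _ _ _) (Eq.trans ?_ (rel_rel hP _ _ _ _ _).symm)
  refine rel_congr ?_ ?_ _ <;> rintro (_ | ⟨_, _⟩) <;> rfl

/-- Exchanging the first two factors is `lmul_left_comm`. This is the generator from which
independence of the order of the vertices follows. -/
theorem lprodCons_swap (hP : P.IsTraP) {A B : Option (Option V) → Type} [∀ i, Finite (A i)]
    [∀ i, Finite (B i)] (x : P.Lab (A none) (B none)) (y : P.Lab (A (some none)) (B (some none)))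
    (z : P.Lab (Σ i, A (some (some i))) (Σ i, B (some (some i)))) :
    P.rel (Equiv.sigmaCongrLeft (β := A) (optionSwap V))
      (Equiv.sigmaCongrLeft (β := B) (optionSwap V))
      (lprodCons (A := fun i => A (optionSwap V i)) (B := fun i => B (optionSwap V i)) y
        (lprodCons (A := fun i => A (optionSwap V (some i)))
          (B := fun i => B (optionSwap V (some i))) x z)) =
    lprodCons x (lprodCons (A := fun i => A (some i)) (B := fun i => B (some i)) y z) := by
  refine Eq.trans (congrArg (P.rel _ _) (congrArg (P.rel _ _) ((lmul_rel_right hP _ _ _ _).trans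
    (congrArg (P.rel _ _) (lmul_left_comm hP _ _ _))))) ?_
  refine Eq.trans ?_ (congrArg (P.rel _ _) (lmul_rel_right hP _ _ _ _).symm)
  refine Eq.trans (congrArg (P.rel _ _) (congrArg (P.rel _ _) (rel_rel hP _ _ _ _ _))) ?_
  refine Eq.trans (congrArg (P.rel _ _) (rel_rel hP _ _ _ _ _)) ?_
  refine Eq.trans (rel_rel hP _ _ _ _ _) (Eq.trans ?_ (rel_rel hP _ _ _ _ _).symm)
  refine rel_congr ?_ ?_ _ <;> rintro (_ | _ | ⟨_, _⟩) <;> rfl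

theorem lprodCons_rel (hP : P.IsTraP) {A B A' B' : Option V → Type} [∀ i, Finite (A i)]
    [∀ i, Finite (B i)] [∀ i, Finite (A' i)] [∀ i, Finite (B' i)] (a : ∀ i, A i ≃ A' i)
    (b : ∀ i, B i ≃ B' i) (x : P.Lab (A none) (B none))
    (y : P.Lab (Σ i, A (some i)) (Σ i, B (some i))) :
    lprodCons (P.rel (a none) (b none) x) (P.rel (Equiv.sigmaCongrRight fun i => a (some i))
      (Equiv.sigmaCongrRight fun i => b (some i)) y) =
    P.rel (Equiv.sigmaCongrRight a) (Equiv.sigmaCongrRight b) (lprodCons x y) := by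
  refine Eq.trans (congrArg (P.rel _ _) (lmul_rel hP _ _ _ _ _ _)) ?_
  refine Eq.trans (rel_rel hP _ _ _ _ _) (Eq.trans ?_ (rel_rel hP _ _ _ _ _).symm)
  refine rel_congr ?_ ?_ _ <;> rintro (_ | ⟨_, _⟩) <;> rfl

end

/-- The product of a family indexed by `Opt n`. -/
noncomputable def lprodOpt (P : TraPData.{v, w} K) : ∀ (n : ℕ) {A B : Opt n → Type}
    [∀ i, Finite (A i)] [∀ i, Finite (B i)], (∀ i, P.Lab (A i) (B i)) →
      P.Lab (Σ i, A i) (Σ i, B i)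
  | 0, A, B, _, _, _ => P.rel (Equiv.equivOfIsEmpty Empty (Σ i : Empty, A i))
      (Equiv.equivOfIsEmpty Empty (Σ i : Empty, B i)) P.lone
  | n + 1, A, B, iA, iB, x => @lprodCons _ _ P (Opt n) _ A B iA iB (x none)
      (@lprodOpt P n (fun i => A (some i)) (fun i => B (some i)) (fun i => iA (some i))
        (fun i => iB (some i)) fun i => x (some i))

theorem lprodOpt_perm (hP : P.IsTraP) (n : ℕ) (σ : Equiv.Perm (Opt n)) :
    ∀ {A B : Opt n → Type} [∀ i, Finite (A i)] [∀ i, Finite (B i)] (x : ∀ i, P.Lab (A i) (B i)),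
    P.rel (Equiv.sigmaCongrLeft (β := A) σ) (Equiv.sigmaCongrLeft (β := B) σ)
      (P.lprodOpt n fun i => x (σ i)) = P.lprodOpt n x := by
  refine Opt.perm_induction (Q := fun n σ => ∀ {A B : Opt n → Type} [∀ i, Finite (A i)]
    [∀ i, Finite (B i)] (x : ∀ i, P.Lab (A i) (B i)),
    P.rel (Equiv.sigmaCongrLeft (β := A) σ) (Equiv.sigmaCongrLeft (β := B) σ)
      (P.lprodOpt n fun i => x (σ i)) = P.lprodOpt n x) ?_ ?_ ?_ ?_ n σ
  · intro n A B _ _ x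
    exact (rel_congr (fun _ => rfl) (fun _ => rfl) _).trans (rel_refl hP _)
  · intro n σ τ hσ hτ A B _ _ x
    rw [← hσ x, ← hτ (A := fun i => A (σ i)) (B := fun i => B (σ i)) fun i => x (σ i)]
    exact (rel_comp hP (A := Σ i, A (σ (τ i))) (B := Σ i, B (σ (τ i)))
      (A' := Σ i, A (σ i)) (B' := Σ i, B (σ i)) (A'' := Σ i, A i)
      (B'' := Σ i, B i) (fun _ => rfl) (fun _ => rfl) _).symm
  · intro n σ hσ A B iA iB x
    have h := @hσ (fun i => A (some i)) (fun i => B (some i)) (fun i => iA (some i))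
      (fun i => iB (some i)) (fun i => x (some i))
    exact (@lprodCons_perm _ _ P (Opt n) _ hP A B iA iB σ (x none) _).trans
      (congrArg (@lprodCons _ _ P (Opt n) _ A B iA iB (x none)) h)
  · intro n A B iA iB x
    exact @lprodCons_swap _ _ P (Opt n) _ hP A B iA iB (x none) (x (some none)) _

theorem lprodOpt_rel (hP : P.IsTraP) (n : ℕ) : ∀ {A B A' B' : Opt n → Type} [∀ i, Finite (A i)]
    [∀ i, Finite (B i)] [∀ i, Finite (A' i)] [∀ i, Finite (B' i)] (a : ∀ i, A i ≃ A' i)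
    (b : ∀ i, B i ≃ B' i) (x : ∀ i, P.Lab (A i) (B i)),
    P.lprodOpt n (fun i => P.rel (a i) (b i) (x i)) =
      P.rel (Equiv.sigmaCongrRight a) (Equiv.sigmaCongrRight b) (P.lprodOpt n x) := by
  induction n with
  | zero =>
    intro A B A' B' _ _ _ _ a b x
    refine Eq.trans ?_ (rel_rel hP _ _ _ _ _).symm
    exact rel_congr (fun x => x.elim) (fun x => x.elim) _
  | succ n ih =>
    intro A B A' B' iA iB iA' iB' a b x
    have h := @ih (fun i => A (some i)) (fun i => B (some i)) (fun i => A' (some i))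
      (fun i => B' (some i)) (fun i => iA (some i)) (fun i => iB (some i)) (fun i => iA' (some i))
      (fun i => iB' (some i)) (fun i => a (some i)) (fun i => b (some i)) (fun i => x (some i))
    exact (congrArg (@lprodCons _ _ P (Opt n) _ A' B' iA' iB' _) h).trans
      (@lprodCons_rel _ _ P (Opt n) _ hP A B A' B' iA iB iA' iB' a b (x none) _)

variable {V W : Type} [Finite V] [Finite W]

/-- The product of a family indexed by a finite type. -/
noncomputable def lprod {V : Type} [Finite V] {A B : V → Type} [∀ i, Finite (A i)] [∀ i, Finite (B i)]
    (x : ∀ i, P.Lab (A i) (B i)) : P.Lab (Σ i, A i) (Σ i, B i) :=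
  P.rel (Equiv.sigmaCongrLeft (β := A) (enum V)) (Equiv.sigmaCongrLeft (β := B) (enum V))
    (P.lprodOpt (Nat.card V) fun i => x (enum V i))

section

variable {A B : V → Type} [∀ i, Finite (A i)] [∀ i, Finite (B i)]

theorem lprod_eq (hP : P.IsTraP) {n : ℕ} (e : Opt n ≃ V) (x : ∀ i, P.Lab (A i) (B i)) :
    lprod x = P.rel (Equiv.sigmaCongrLeft (β := A) e) (Equiv.sigmaCongrLeft (β := B) e)
      (P.lprodOpt n fun i => x (e i)) := by
  obtain rfl := Opt.eq_of_equiv (e.trans (enum V).symm)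
  obtain ⟨σ, rfl⟩ : ∃ σ : Equiv.Perm _, e = σ.trans (enum V) :=
    ⟨e.trans (enum V).symm, by ext1; simp⟩
  rw [lprod, ← lprodOpt_perm hP _ σ (A := fun i => A (enum V i)) (B := fun i => B (enum V i))
    fun i => x (enum V i)]
  exact rel_comp hP (A := Σ i, A (enum V (σ i))) (B := Σ i, B (enum V (σ i)))
    (A' := Σ i, A (enum V i)) (B' := Σ i, B (enum V i)) (A'' := Σ i, A i)
    (B'' := Σ i, B i) (fun _ => rfl) (fun _ => rfl) _

/-- Serves two purposes: transport of the product of decorations along an isomorphism of graphs,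
and, with identical labels, mere reindexing of a family. -/
theorem lprod_congr (hP : P.IsTraP) {A' B' : W → Type} [∀ i, Finite (A' i)]
    [∀ i, Finite (B' i)] (f : V ≃ W) (a : ∀ v, A v ≃ A' (f v)) (b : ∀ v, B v ≃ B' (f v))
    (x : ∀ v, P.Lab (A v) (B v)) (x' : ∀ v, P.Lab (A' v) (B' v))
    (h : ∀ v, x' (f v) = P.rel (a v) (b v) (x v)) :
    lprod x' = P.rel (Equiv.sigmaCongr f a) (Equiv.sigmaCongr f b) (lprod x) := by
  have hx : (fun i => x' (((enum V).trans f) i)) =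
      fun i => P.rel (a (enum V i)) (b (enum V i)) (x (enum V i)) := funext fun i => h _
  rw [lprod_eq hP ((enum V).trans f), lprod, hx]
  have h2 := lprodOpt_rel hP _ (A := fun i => A (enum V i)) (B := fun i => B (enum V i))
    (A' := fun i => A' (f (enum V i))) (B' := fun i => B' (f (enum V i)))
    (fun i => a (enum V i)) (fun i => b (enum V i)) fun i => x (enum V i)
  refine Eq.trans (congrArg _ h2) ?_
  rw [rel_rel hP]
  exact rel_comp hP (A := Σ i, A (enum V i)) (B := Σ i, B (enum V i))
    (A' := Σ i, A' (f (enum V i))) (B' := Σ i, B' (f (enum V i))) (A'' := Σ i, A' i)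
    (B'' := Σ i, B' i) (fun _ => rfl) (fun _ => rfl) _

end

theorem lprod_empty (hP : P.IsTraP) {A B : Empty → Type} [∀ i, Finite (A i)] [∀ i, Finite (B i)]
    (x : ∀ i, P.Lab (A i) (B i)) : lprod x = P.rel (Equiv.equivOfIsEmpty Empty (Σ i, A i))
      (Equiv.equivOfIsEmpty Empty (Σ i, B i)) P.lone := by
  refine (lprod_eq hP (V := Empty) (n := 0) (Equiv.refl (Opt 0)) x).trans ?_
  refine Eq.trans (rel_rel hP _ _ _ _ _) ?_
  exact rel_congr (fun x => x.elim) (fun x => x.elim) _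

theorem lprod_option (hP : P.IsTraP) {A B : Option V → Type} [∀ i, Finite (A i)]
    [∀ i, Finite (B i)] (x : ∀ i, P.Lab (A i) (B i)) :
    lprod x = P.rel (sigmaOption A) (sigmaOption B)
      (P.lmul (x none) (lprod fun i => x (some i))) := by
  have h : ∀ {m : ℕ} (e : Opt m ≃ V), lprod x = P.rel
      (Equiv.sigmaCongrLeft (β := A) (Equiv.optionCongr e))
      (Equiv.sigmaCongrLeft (β := B) (Equiv.optionCongr e))
      (lprodCons (A := fun i => A (Equiv.optionCongr e i)) (B := fun i => B (Equiv.optionCongr e i))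
        (x none) (P.lprodOpt m fun i => x (some (e i)))) := fun {m} e =>
    lprod_eq hP (V := Option V) (n := m + 1) (Equiv.optionCongr e) x
  rw [h (enum V), lprod, lmul_rel_right hP, rel_rel hP]
  refine Eq.trans (rel_rel hP (A := A none ⊕ Σ i, A (some (enum V i)))
    (B := B none ⊕ Σ i, B (some (enum V i))) (A' := Σ i, A (Equiv.optionCongr (enum V) i))
    (B' := Σ i, B (Equiv.optionCongr (enum V) i)) _ _ _ _ _) ?_
  refine rel_congr ?_ ?_ _ <;> rintro (_ | ⟨_, _⟩) <;> rfl

theorem lprod_sum (hP : P.IsTraP) (V : Type) [Finite V] :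
    ∀ {A B : V ⊕ W → Type} [∀ i, Finite (A i)] [∀ i, Finite (B i)]
      (x : ∀ i, P.Lab (A i) (B i)),
    lprod x = P.rel (Equiv.sumSigmaDistrib A).symm (Equiv.sumSigmaDistrib B).symm
      (P.lmul (lprod fun i => x (Sum.inl i)) (lprod fun i => x (Sum.inr i))) := by
  refine finite_induction (Q := fun V _ => ∀ {A B : V ⊕ W → Type} [∀ i, Finite (A i)]
    [∀ i, Finite (B i)] (x : ∀ i, P.Lab (A i) (B i)),
    lprod x = P.rel (Equiv.sumSigmaDistrib A).symm (Equiv.sumSigmaDistrib B).symm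
      (P.lmul (lprod fun i => x (Sum.inl i)) (lprod fun i => x (Sum.inr i)))) ?_ ?_ ?_ V
  · intro S T _ _ f h A B _ _ x
    rw [lprod_congr hP (Equiv.sumCongr f (Equiv.refl W)) (fun _ => Equiv.refl _)
      (fun _ => Equiv.refl _) (fun i => x (Equiv.sumCongr f (Equiv.refl W) i)) x
        (fun _ => (rel_refl hP _).symm), h,
      lprod_congr hP f (fun _ => Equiv.refl _) (fun _ => Equiv.refl _) (fun i => x (Sum.inl (f i)))
        (fun i => x (Sum.inl i)) (fun _ => (rel_refl hP _).symm), lmul_rel_left hP]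
    refine Eq.trans (rel_rel hP _ _ _ _ _) (Eq.trans ?_ (rel_rel hP _ _ _ _ _).symm)
    refine rel_congr ?_ ?_ _ <;> rintro (⟨_, _⟩ | ⟨_, _⟩) <;> rfl
  · intro A B _ _ x
    rw [lprod_congr hP (Equiv.emptySum Empty W).symm (fun _ => Equiv.refl _)
      (fun _ => Equiv.refl _) (fun i => x (Sum.inr i)) x (fun _ => (rel_refl hP _).symm),
      lprod_empty hP, lmul_rel_left hP, lone_lmul hP]
    refine Eq.trans ?_ (congrArg (P.rel _ _) (rel_rel hP _ _ _ _ _)).symm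
    refine Eq.trans ?_ (rel_rel hP _ _ _ _ _).symm
    refine rel_congr ?_ ?_ _ <;> rintro ⟨_, _⟩ <;> rfl
  · intro S _ h A B _ _ x
    rw [lprod_congr hP (optionSumLeft S W).symm (A := fun i => A ((optionSumLeft S W).symm i))
      (B := fun i => B ((optionSumLeft S W).symm i)) (fun _ => Equiv.refl _)
      (fun _ => Equiv.refl _) (fun i => x ((optionSumLeft S W).symm i)) x
        (fun _ => (rel_refl hP _).symm), lprod_option hP, lprod_option hP, h, lmul_rel_right hP,
        lmul_rel_left hP, lmul_assoc' hP, rel_rel hP, rel_rel hP, rel_rel hP, rel_rel hP]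
    refine rel_congr ?_ ?_ _ <;> rintro (_ | ⟨_, _⟩ | ⟨_, _⟩) <;> rfl

/-- Two coefficients cover additivity (`c = d = 1`) and homogeneity (`d = 0`) at once. In the
induction the distinguished factor is either the new one, where `lmul` is linear in its first
argument, or lies in the rest, where it is linear in its second. -/
theorem lprod_linear (hP : P.IsTraP) (V : Type) [Finite V] (c d : K) :
    ∀ {A B : V → Type} [∀ i, Finite (A i)] [∀ i, Finite (B i)] (v : V)
      (x y z : ∀ i, P.Lab (A i) (B i)) (_ : x v = c • y v + d • z v) (_ : ∀ i, i ≠ v → x i = y i)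
      (_ : ∀ i, i ≠ v → x i = z i), lprod x = c • lprod y + d • lprod z := by
  refine finite_induction (Q := fun V _ => ∀ {A B : V → Type} [∀ i, Finite (A i)]
    [∀ i, Finite (B i)] (v : V)
      (x y z : ∀ i, P.Lab (A i) (B i)) (_ : x v = c • y v + d • z v) (_ : ∀ i, i ≠ v → x i = y i)
      (_ : ∀ i, i ≠ v → x i = z i), lprod x = c • lprod y + d • lprod z) ?_ ?_ ?_ V
  · intro S T _ _ f h A B _ _ v x y z h1 h2 h3
    obtain ⟨v, rfl⟩ := f.surjective v
    have e : ∀ x : ∀ i, P.Lab (A i) (B i), _ := fun x => lprod_congr hP f (fun _ => Equiv.refl _)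
      (fun _ => Equiv.refl _) (fun i => x (f i)) x (fun _ => (rel_refl hP _).symm)
    rw [e, e y, e z, ← map_smul, ← map_smul, ← map_add]
    refine congrArg _ (h v _ _ _ h1 (fun i hi => h2 _ ?_) (fun i hi => h3 _ ?_))
    · exact fun h => hi (f.injective h)
    · exact fun h => hi (f.injective h)
  · intro A B _ _ v
    exact v.elim
  · intro S _ h A B _ _ v x y z h1 h2 h3
    rw [lprod_option hP x, lprod_option hP y, lprod_option hP z,
      ← LinearMap.map_smul (P.rel _ _), ← LinearMap.map_smul (P.rel _ _), ← map_add]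
    refine congrArg _ ?_
    rcases v with _ | v
    · have e2 : (fun i => x (some i)) = fun i => y (some i) := funext fun i => h2 _ (by simp)
      have e3 : (fun i => x (some i)) = fun i => z (some i) := funext fun i => h3 _ (by simp)
      rw [h1, ← e2, ← e3]
      simp
    · rw [← h2 none (by simp), ← h3 none (by simp),
        h v (fun i => x (some i)) (fun i => y (some i)) (fun i => z (some i)) h1
        (fun i hi => h2 _ (by simpa using hi)) (fun i hi => h3 _ (by simpa using hi))]
      simp

/-! #### Identities -/

variable {C D : Type} [Finite C] [Finite D]

/-- The product of copies of `I`. -/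
noncomputable def lid (P : TraPData.{v, w} K) (C : Type) [Finite C] : P.Lab C C :=
  P.rel (Equiv.sigmaPUnit C) (Equiv.sigmaPUnit C) (lprod fun _ : C => P.lunit)

theorem lid_rel (hP : P.IsTraP) (f : C ≃ D) : P.rel f f (P.lid C) = P.lid D := by
  rw [lid, lid, lprod_congr hP f (fun _ => Equiv.refl _) (fun _ => Equiv.refl _)
    (fun _ => P.lunit) (fun _ => P.lunit) (fun _ => (rel_refl hP _).symm), rel_rel hP, rel_rel hP]
  refine rel_congr ?_ ?_ _ <;> rintro ⟨_, _⟩ <;> rfl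

theorem lid_empty (hP : P.IsTraP) : P.lid Empty = P.lone := by
  rw [lid, lprod_empty hP, rel_rel hP]
  exact (rel_congr (fun x => x.elim) (fun x => x.elim) _).trans (rel_refl hP _)

theorem lid_option (hP : P.IsTraP) : P.lid (Option C) =
    P.rel (optionSumUnit C) (optionSumUnit C) (P.lmul (P.lid C) P.lunit) := by
  rw [lid, lid, lprod_option hP, lmul_rel_left hP, ← lmul_comm hP P.lunit, rel_rel hP, rel_rel hP,
    rel_rel hP]
  refine rel_congr ?_ ?_ _ <;> rintro (_ | ⟨_, _⟩) <;> rfl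

theorem lid_unit (hP : P.IsTraP) : P.lid Unit = P.lunit := by
  have e : Option Empty ≃ Unit := Equiv.equivPUnit _
  rw [← lid_rel hP e, lid_option hP, lid_empty hP, lone_lmul hP, rel_rel hP, rel_rel hP]
  exact (rel_congr (fun _ => rfl) (fun _ => rfl) _).trans (rel_refl hP _)

theorem lid_sum (hP : P.IsTraP) : P.lid (C ⊕ D) = P.lmul (P.lid C) (P.lid D) := by
  rw [lid, lid, lid, lprod_sum hP, lmul_rel hP, rel_rel hP]
  refine rel_congr ?_ ?_ _ <;> rintro (⟨_, _⟩ | ⟨_, _⟩) <;> rfl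

end TraPData

namespace TraPData

variable {K : Type w} [Field K] {P : TraPData.{v, w} K} {k l k' l' k'' l'' : ℕ}

variable {A B A' B' A'' B'' A₁ B₁ : Type} [Finite A] [Finite B] [Finite A'] [Finite B']
  [Finite A''] [Finite B''] [Finite A₁] [Finite B₁]

theorem ltr_lmul (hP : P.IsTraP) (x : P.Lab (Option A) (Option B)) (y : P.Lab A' B') :
    P.ltr (P.rel (optionSumLeft A A') (optionSumLeft B B') (P.lmul x y)) =
      P.lmul (P.ltr x) y := by
  rw [← lmul_comm hP y x, ← lmul_comm hP y, ← lmul_ltr hP, ← ltr_rel hP, rel_rel hP, rel_rel hP]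
  refine congrArg P.ltr (rel_congr ?_ ?_ _) <;> rintro (_ | _ | _) <;> rfl

theorem ltrace_lmul (hP : P.IsTraP) (S : Type) [Finite S] (x : P.Lab (A ⊕ S) (B ⊕ S))
    (y : P.Lab A' B') :
    P.lmul (P.ltrace S x) y =
      P.ltrace S (P.rel (sumRightComm A S A') (sumRightComm B S B') (P.lmul x y)) := by
  rw [← lmul_comm hP y x, ← lmul_comm hP y, lmul_ltrace hP, ← ltrace_rel hP _ _ (Equiv.refl S),
    rel_rel hP, rel_rel hP]
  refine congrArg (P.ltrace S) (rel_congr ?_ ?_ _) <;> rintro (_ | _ | _) <;> rfl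

theorem ltrace_lmul_ltrace (hP : P.IsTraP) (S T : Type) [Finite S] [Finite T]
    (x : P.Lab (A ⊕ S) (B ⊕ S)) (y : P.Lab (A' ⊕ T) (B' ⊕ T)) :
    P.lmul (P.ltrace S x) (P.ltrace T y) =
      P.ltrace (S ⊕ T) (P.rel (Equiv.sumSumSumComm A S A' T) (Equiv.sumSumSumComm B S B' T)
        (P.lmul x y)) := by
  rw [ltrace_lmul hP, lmul_ltrace hP, ← ltrace_rel hP _ _ (Equiv.refl T), ltrace_ltrace hP,
    rel_rel hP, rel_rel hP]
  refine congrArg (P.ltrace _) (rel_congr ?_ ?_ _) <;> rintro ((_ | _) | (_ | _)) <;> rfl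

/-! #### Loops -/

/-- The loop, labelled. -/
noncomputable def lloop (P : TraPData.{v, w} K) : P.Lab Empty Empty :=
  P.ltr (P.rel (Equiv.equivPUnit.{1, 1} (Option Empty)).symm
    (Equiv.equivPUnit.{1, 1} (Option Empty)).symm P.lunit)

/-- The product with a loop. -/
noncomputable def loopMul (x : P.Lab A B) : P.Lab A B :=
  P.rel (Equiv.sumEmpty A Empty) (Equiv.sumEmpty B Empty) (P.lmul x P.lloop)

theorem loopMul_smul_add (a b : K) (x y : P.Lab A B) :
    loopMul (a • x + b • y) = a • loopMul x + b • loopMul y := by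
  simp only [loopMul, map_add, map_smul, LinearMap.add_apply, LinearMap.smul_apply]

/-- A loop has no inputs or outputs, so multiplication by it commutes with relabellings, traces and
products. By these lemmas the loops of a graph can be pulled out of every operation. -/
theorem loopMul_rel (hP : P.IsTraP) (f : A ≃ A') (g : B ≃ B') (x : P.Lab A B) :
    loopMul (P.rel f g x) = P.rel f g (loopMul x) := by
  rw [loopMul, loopMul, lmul_rel_left hP, rel_rel hP, rel_rel hP]
  refine rel_congr ?_ ?_ _ <;> rintro (_ | ⟨⟨⟩⟩) <;> rfl

theorem loopMul_ltr (hP : P.IsTraP) (x : P.Lab (Option A) (Option B)) :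
    loopMul (P.ltr x) = P.ltr (loopMul x) := by
  rw [loopMul, loopMul, ← ltr_lmul hP, ← ltr_rel hP, rel_rel hP]
  refine congrArg P.ltr (rel_congr ?_ ?_ _) <;> rintro ((_ | _) | ⟨⟨⟩⟩) <;> rfl

theorem loopMul_ltrace (hP : P.IsTraP) (S : Type) [Finite S] (x : P.Lab (A ⊕ S) (B ⊕ S)) :
    loopMul (P.ltrace S x) = P.ltrace S (loopMul x) := by
  rw [loopMul, loopMul, ltrace_lmul hP, ← ltrace_rel hP _ _ (Equiv.refl S), rel_rel hP]
  refine congrArg (P.ltrace S) (rel_congr ?_ ?_ _) <;> rintro ((_ | _) | ⟨⟨⟩⟩) <;> rfl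

theorem loopMul_lmul (hP : P.IsTraP) (x : P.Lab A B) (y : P.Lab A' B') :
    loopMul (P.lmul x y) = P.lmul (loopMul x) y := by
  rw [loopMul, loopMul, lmul_rel_left hP, lmul_right_comm hP, rel_rel hP]
  refine rel_congr ?_ ?_ _ <;> rintro ((_ | ⟨⟨⟩⟩) | _) <;> rfl

theorem lmul_loopMul (hP : P.IsTraP) (x : P.Lab A B) (y : P.Lab A' B') :
    loopMul (P.lmul x y) = P.lmul x (loopMul y) := by
  rw [← lmul_comm hP y, loopMul_rel hP, loopMul_lmul hP, lmul_comm hP]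

theorem loopMul_iterate (F : P.Lab A B → P.Lab A' B') (hF : ∀ x, loopMul (F x) = F (loopMul x))
    (n : ℕ) (x : P.Lab A B) : loopMul^[n] (F x) = F (loopMul^[n] x) := by
  induction n with
  | zero => rfl
  | succ n ih => rw [Function.iterate_succ_apply', Function.iterate_succ_apply', ih, hF]

/-! #### Tracing a wire -/

-- A copy of `I` stands beside `x`, and its input is glued to the output that `W` names `none`; in
-- the source of `W`, `none` is the output of `I`. If `W` fixes `none`, then `I` closes up to a
-- loop. Otherwise an output `b₀` of `x` is prolonged by `I` and gets the name `W none`. This is the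
-- case distinction of `Equiv.removeNone`, hence the effect of a trace on the wiring of a graph.
open Classical in
theorem ltr_lmul_lunit (hP : P.IsTraP) (W : Option B ≃ Option B') (x : P.Lab A B) :
    P.ltr (P.rel (optionSumUnit A) ((optionSumUnit B).trans W) (P.lmul x P.lunit)) =
      if W none = none then loopMul (P.rel (Equiv.refl A) (Equiv.removeNone W) x)
      else P.rel (Equiv.refl A) (Equiv.removeNone W) x := by
  split_ifs with h
  · have h1 : ∀ b, W (some b) = some (Equiv.removeNone W b) := fun b =>
      (Equiv.removeNone_some W (Option.ne_none_iff_exists'.mp fun hb => by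
        simpa using W.injective (hb.trans h.symm))).symm
    rw [loopMul_rel hP, loopMul, lloop, ← lmul_ltr hP, ← ltr_rel hP, ← ltr_rel hP,
      lmul_rel_right hP, rel_rel hP, rel_rel hP, rel_rel hP]
    refine congrArg P.ltr (rel_congr ?_ ?_ _)
    · rintro (_ | _) <;> rfl
    · rintro (_ | _)
      · exact h1 _
      · exact h
  · obtain ⟨b₀, hb₀⟩ : ∃ b, W (some b) = none := by
      obtain ⟨z, hz⟩ := W.surjective none
      rcases z with _ | b
      · exact absurd hz h
      · exact ⟨b, hz⟩
    -- `g` presents the outputs of `x` as the marked point `b₀` and the rest, the form required by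
    -- `ltr_unit_left`.
    let g := Equiv.optionSubtypeNe b₀
    obtain ⟨y, rfl⟩ : ∃ y, x = P.rel (Equiv.refl A) g y := ⟨P.rel (Equiv.refl A) g.symm x, by
      rw [rel_comp hP (f'' := Equiv.refl A) (g'' := Equiv.refl B) (fun _ => rfl)
        (fun x => g.apply_symm_apply x), rel_refl hP]⟩
    have e := ltr_unit_left hP y
    have e2 := congrArg (P.rel (Equiv.refl A) (g.trans (Equiv.removeNone W))) e
    rw [← ltr_rel hP, rel_rel hP] at e2
    rw [rel_rel hP, lmul_rel_left hP, rel_rel hP]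
    refine Eq.trans (congrArg P.ltr (rel_congr ?_ ?_ _)) e2
    · rintro (_ | _) <;> rfl
    · have h2 : W none = some (Equiv.removeNone W b₀) := (Equiv.removeNone_none W hb₀).symm
      have g0 : g none = b₀ := by simp [g]
      rintro ((_ | c) | _)
      · change W (some (g none)) = none
        rw [g0, hb₀]
      · change W (some (g (some c))) = some (Equiv.removeNone W (g (some c)))
        refine (Equiv.removeNone_some W (Option.ne_none_iff_exists'.mp fun hb => ?_)).symm
        have h3 := W.injective (hb.trans hb₀.symm)
        simpa using g.injective ((Option.some_injective _ h3).trans g0.symm)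
      · change W none = some (Equiv.removeNone W (g none))
        rw [g0, h2]

/-! #### Gluing along a bijection of ends -/

variable {C D C' D' : Type} [Finite C] [Finite D] [Finite C'] [Finite D']

/-- Connect the beginnings `C ⊕ B` to the ends `D ⊕ A`, where `A` and `B` are the inputs and
outputs of `p`. -/
noncomputable def glue (P : TraPData.{v, w} K) (W : C ⊕ B ≃ D ⊕ A) : P.Lab A B →ₗ[K] P.Lab C D :=
  P.ltrace A ∘ₗ P.rel (Equiv.refl _) W ∘ₗ P.lmul (P.lid C)

theorem glue_apply (W : C ⊕ B ≃ D ⊕ A) (p : P.Lab A B) :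
    P.glue W p = P.ltrace A (P.rel (Equiv.refl _) W (P.lmul (P.lid C) p)) := rfl

/-- With `c` and `d` trivial this gives invariance under isomorphisms of graphs; with `a` and `b`
trivial, compatibility with external relabellings. -/
theorem glue_rel (hP : P.IsTraP) (a : A ≃ A') (b : B ≃ B') (c : C ≃ C') (d : D ≃ D')
    (W : C ⊕ B ≃ D ⊕ A) (W' : C' ⊕ B' ≃ D' ⊕ A')
    (h : ∀ x, W' (Equiv.sumCongr c b x) = Equiv.sumCongr d a (W x)) (p : P.Lab A B) :
    P.glue W' (P.rel a b p) = P.rel c d (P.glue W p) := by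
  rw [glue_apply, glue_apply, ← lid_rel hP c, lmul_rel hP, ← ltrace_rel hP _ _ a, rel_rel hP,
    rel_rel hP]
  exact congrArg (P.ltrace A') (rel_congr (fun _ => rfl) h _)

-- By `lid_option` the identity on `Option C` contains one additional copy of `I`. The single trace
-- is moved inside the trace over `A`, where it glues the input of this copy, and `ltr_lmul_lunit`
-- applies.
open Classical in
theorem ltr_glue (hP : P.IsTraP) (W : Option C ⊕ B ≃ Option D ⊕ A) (p : P.Lab A B) :
    P.ltr (P.glue W p) =
      if W (Sum.inl none) = Sum.inl none then
        loopMul (P.glue (Equiv.removeNone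
          (((optionSumLeft C B).symm.trans W).trans (optionSumLeft D A))) p)
      else P.glue (Equiv.removeNone
        (((optionSumLeft C B).symm.trans W).trans (optionSumLeft D A))) p := by
  set W' := ((optionSumLeft C B).symm.trans W).trans (optionSumLeft D A) with hW
  have h0 : W (Sum.inl none) = Sum.inl none ↔ W' none = none := by
    have : W' none = optionSumLeft D A (W (Sum.inl none)) := rfl
    rw [this]
    exact ((optionSumLeft D A).apply_eq_iff_eq (y := Sum.inl none)).symm
  have key := ltr_lmul_lunit hP W' (P.lmul (P.lid C) p)
  have h1 : P.ltr (P.glue W p) = P.ltrace A (P.ltr (P.rel (optionSumUnit (C ⊕ A))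
      ((optionSumUnit (C ⊕ B)).trans W') (P.lmul (P.lmul (P.lid C) p) P.lunit))) := by
    rw [glue_apply, ltr_ltrace hP, lid_option hP, lmul_rel_left hP, lmul_right_comm hP,
      rel_rel hP, rel_rel hP, rel_rel hP]
    refine congrArg (P.ltrace A) (congrArg P.ltr (rel_congr ?_ ?_ _))
    · rintro ((_ | _) | _) <;> rfl
    · rintro ((_ | _) | _) <;> rfl
  rw [h1, key, if_congr h0 rfl rfl, glue_apply]
  split_ifs
  · rw [loopMul_ltrace hP]
  · rfl

/-- The two traces merge into one over `A ⊕ A'`, and commutativity sorts the identity strands before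
`p` and `p'`. -/
theorem lmul_glue (hP : P.IsTraP) (W : C ⊕ B ≃ D ⊕ A) (W' : C' ⊕ B' ≃ D' ⊕ A') (p : P.Lab A B)
    (p' : P.Lab A' B') :
    P.lmul (P.glue W p) (P.glue W' p') =
      P.glue (((Equiv.sumSumSumComm C C' B B').trans (Equiv.sumCongr W W')).trans
        (Equiv.sumSumSumComm D A D' A')) (P.lmul p p') := by
  rw [glue_apply, glue_apply, glue_apply, ltrace_lmul_ltrace hP, lmul_rel hP, lid_sum hP,
    rel_rel hP]
  have h : P.lmul (P.lmul (P.lid C) (P.lid C')) (P.lmul p p') =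
      P.rel (Equiv.sumSumSumComm C A C' A') (Equiv.sumSumSumComm C B C' B')
        (P.lmul (P.lmul (P.lid C) p) (P.lmul (P.lid C') p')) := by
    rw [lmul_assoc' hP, lmul_assoc' hP, lmul_left_comm hP (P.lid C'), lmul_rel_right hP,
      rel_rel hP, rel_rel hP]
    refine rel_congr ?_ ?_ _ <;> rintro (_ | _ | _ | _) <;> rfl
  rw [h, rel_rel hP]
  refine congrArg (P.ltrace _) (rel_congr ?_ ?_ _)
  · rintro ((_ | _) | (_ | _)) <;> rfl
  · rintro ((_ | _) | (_ | _)) <;> rfl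

/-- The exchange of the two copies of `S` makes the trace glue the outputs of the identity strands
to the inputs of `x`. These inputs are thereby prolonged by copies of `I`, which changes nothing;
each point of `S` costs one use of `ltr_unit_right`. -/
theorem ltrace_lid (hP : P.IsTraP) (S : Type) [Finite S] :
    ∀ {D B : Type} [Finite D] [Finite B] (x : P.Lab (D ⊕ S) B),
    P.ltrace S (P.rel (sumRightComm D S S) (Equiv.refl _) (P.lmul x (P.lid S))) = x := by
  refine finite_induction (Q := fun S _ => ∀ {D B : Type} [Finite D] [Finite B]
    (x : P.Lab (D ⊕ S) B), P.ltrace S (P.rel (sumRightComm D S S) (Equiv.refl _)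
      (P.lmul x (P.lid S))) = x) ?_ ?_ ?_ S
  · intro S T _ _ f h D B _ _ x
    obtain ⟨y, rfl⟩ : ∃ y, x = P.rel (Equiv.sumCongr (Equiv.refl D) f) (Equiv.refl B) y :=
      ⟨P.rel (Equiv.sumCongr (Equiv.refl D) f).symm (Equiv.refl B) x, by
        rw [rel_comp hP (f'' := Equiv.refl _) (g'' := Equiv.refl B) (by simp) (fun x => rfl),
          rel_refl hP]⟩
    conv_rhs => rw [← h y]
    rw [← ltrace_rel hP _ _ f, ← lid_rel hP f, lmul_rel hP, rel_rel hP, rel_rel hP]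
    refine congrArg (P.ltrace T) (rel_congr ?_ ?_ _)
    · rintro ((_ | _) | _) <;> rfl
    · rintro (_ | _) <;> rfl
  · intro D B _ _ x
    rw [ltrace_empty hP, lid_empty hP, lmul_lone hP, rel_rel hP, rel_rel hP]
    refine (rel_congr ?_ ?_ _).trans (rel_refl hP _)
    · rintro (_ | ⟨⟨⟩⟩); rfl
    · intro _; rfl
  · intro S _ h D B _ _ x
    -- The new point is moved to the inputs that are not traced, so that the induction hypothesis
    -- for `S` applies to the relabelled `x`.
    let f : D ⊕ Option S ≃ Option D ⊕ S :=
      (optionSumRight D S).trans (optionSumLeft D S).symm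
    let Φ : (D ⊕ Option S) ⊕ S ≃ Option ((D ⊕ S) ⊕ S) :=
      (Equiv.sumCongr (optionSumRight D S) (Equiv.refl S)).trans (optionSumLeft (D ⊕ S) S)
    have e := congrArg (P.rel ((Equiv.optionCongr (sumRightComm D S S)).trans Φ.symm)
      (Equiv.refl _)) (ltr_unit_right hP (P.rel Φ (Equiv.refl _) (P.lmul x (P.lid S))))
    have e2 : P.rel f.symm (Equiv.refl B) (P.rel f (Equiv.refl B) x) = x := by
      rw [rel_comp hP (f'' := Equiv.refl _) (g'' := Equiv.refl B) (by simp) (fun x => rfl),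
        rel_refl hP]
    conv_rhs => rw [← e2, ← h (P.rel f (Equiv.refl B) x)]
    rw [← ltrace_rel hP _ _ (Equiv.refl S), ltrace_option hP]
    refine congrArg (P.ltrace S) (Eq.trans ?_ (e.trans ?_))
    · rw [lid_option hP, lmul_rel_right hP, ← lmul_assoc hP, lmul_rel_left hP, ← ltr_rel hP,
        rel_rel hP, rel_rel hP, rel_rel hP, rel_rel hP, rel_rel hP]
      refine congrArg P.ltr (rel_congr ?_ ?_ _)
      · rintro (((_ | _ | _) | _) | _) <;> rfl
      · rintro ((_ | _) | _) <;> rfl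
    · rw [lmul_rel_left hP, rel_rel hP, rel_rel hP, rel_rel hP]
      refine rel_congr ?_ ?_ _
      · rintro ((_ | _ | _) | _) <;> rfl
      · rintro (_ | _) <;> rfl

/-- In this wiring every external input leads to the input of `p` with the same label, and every
output of `p` leads outside. It is the case `D = Empty` of `ltrace_lid`, and it evaluates corollas.
-/
theorem glue_sumComm (hP : P.IsTraP) (p : P.Lab A B) : P.glue (Equiv.sumComm A B) p = p := by
  have h := ltrace_lid hP A (D := Empty) (P.rel (Equiv.emptySum Empty A).symm (Equiv.refl B) p)
  have h2 := congrArg (P.rel (Equiv.emptySum Empty A) (Equiv.refl B)) h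
  rw [rel_comp hP (f'' := Equiv.refl _) (g'' := Equiv.refl B) (by simp) (fun x => rfl),
    rel_refl hP, lmul_rel_left hP, rel_rel hP, ← ltrace_rel hP _ _ (Equiv.refl A), rel_rel hP] at h2
  refine Eq.trans ?_ h2
  rw [glue_apply, ← lmul_comm hP p, rel_rel hP]
  refine congrArg (P.ltrace A) (rel_congr ?_ ?_ _) <;> rintro (_ | _) <;> rfl

end TraPData

/-! ### Evaluation of decorated graphs in a TraP -/

instance {k l : ℕ} (G : PlanarGraph k l) : Finite G.V := G.finite

theorem TraPData.lprod_unit {K : Type w} [Field K] {P : TraPData.{v, w} K} (hP : P.IsTraP)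
    {A B : Type} [Finite A] [Finite B] (x : P.Lab A B) :
    lprod (fun _ : Unit => x) = P.rel (Equiv.uniqueSigma fun _ : Unit => A).symm
      (Equiv.uniqueSigma fun _ : Unit => B).symm x := by
  have h1 := lprod_congr hP (Equiv.equivPUnit.{1, 1} (Option Empty)) (A := fun _ => A)
    (B := fun _ => B) (A' := fun _ => A) (B' := fun _ => B) (fun _ => Equiv.refl A)
    (fun _ => Equiv.refl B) (fun _ => x) (fun _ => x) (fun _ => (rel_refl hP _).symm)
  have h2 := lprod_option hP (V := Empty) (A := fun _ => A) (B := fun _ => B) fun _ => x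
  have h3 := lprod_empty hP (A := fun _ => A) (B := fun _ => B) fun _ => x
  rw [h3, lmul_rel_right hP, lmul_lone hP, rel_rel hP, rel_rel hP] at h2
  refine h1.trans ((congrArg _ h2).trans ?_)
  exact rel_comp hP (fun _ => rfl) (fun _ => rfl) _

namespace DecGraph

open PlanarGraph TraPData

variable {K : Type w} [Field K] {X : SymData.{u, w} K} {P : TraPData.{v, w} K}
  {k l k' l' k'' l'' : ℕ} (φ : ∀ k l, X.obj k l →ₗ[K] P.obj k l)

/-- The images of the decorations. -/
noncomputable def decLab (D : DecGraph X k l) (v : D.graph.V) :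
    P.Lab (Fin (D.graph.inn v)) (Fin (D.graph.out v)) :=
  P.lab (Equiv.refl _) (Equiv.refl _) (φ _ _ (D.dec v))

/-- The evaluation of a decorated graph, labelled by its inputs and outputs. -/
noncomputable def labEval (D : DecGraph X k l) : P.Lab (Fin k) (Fin l) :=
  loopMul^[D.graph.loops] (P.glue D.graph.wire (lprod (decLab φ D)))

/-- The evaluation of a decorated graph. -/
noncomputable def eval (D : DecGraph X k l) : P.obj k l :=
  P.unlab (Equiv.refl _) (Equiv.refl _) (labEval φ D)

variable (hP : P.IsTraP)
include hP

theorem lab_eval (D : DecGraph X k l) :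
    P.lab (Equiv.refl _) (Equiv.refl _) (eval φ D) = labEval φ D := lab_unlab hP _ _ _

theorem labEval_of_iso {D D' : DecGraph X k l} (f : Iso D D') : labEval φ D = labEval φ D' := by
  have h1 : lprod (decLab φ D') = P.rel (slotEquiv f.equiv f.inn_eq)
      (slotEquiv f.equiv f.out_eq) (lprod (decLab φ D)) := by
    refine lprod_congr hP (A := fun v => Fin (D.graph.inn v)) (B := fun v => Fin (D.graph.out v))
      (A' := fun v => Fin (D'.graph.inn v)) (B' := fun v => Fin (D'.graph.out v)) f.equiv
      (fun v => finCongr (f.inn_eq v)) (fun v => finCongr (f.out_eq v))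
      (decLab φ D) (decLab φ D') fun v => ?_
    have h : ∀ {m n m' n' : ℕ} (hm : m = m') (hn : n = n') (x : X.obj m n) (x' : X.obj m' n')
        (_ : X.cast hm hn x = x'), P.lab (Equiv.refl _) (Equiv.refl _) (φ m' n' x') =
          P.rel (finCongr hm) (finCongr hn) (P.lab (Equiv.refl _) (Equiv.refl _) (φ m n x)) := by
      intro m n m' n' hm hn x x' hx
      subst hm hn hx
      exact (rel_refl hP _).symm
    exact h _ _ _ _ (f.dec_eq v)
  rw [labEval, labEval, h1, glue_rel hP _ _ (Equiv.refl _) (Equiv.refl _) D.graph.wire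
    D'.graph.wire (fun x => Equiv.congr_fun f.wire_eq x), rel_refl hP, f.loops_eq]

theorem labEval_relabel (f : Fin k ≃ Fin k') (g : Fin l ≃ Fin l') (D : DecGraph X k l) :
    labEval φ (D.relabel f g) = P.rel f g (labEval φ D) := by
  have h := glue_rel hP (Equiv.refl (Σ v, Fin (D.graph.inn v)))
    (Equiv.refl (Σ v, Fin (D.graph.out v))) f g D.graph.wire (relabelWire f g D.graph.wire)
    (relabelWire_apply f g D.graph.wire) (lprod (decLab φ D))
  rw [rel_refl hP] at h
  refine (congrArg (loopMul^[D.graph.loops]) h).trans ?_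
  exact loopMul_iterate _ (loopMul_rel hP f g) _ _

theorem labEval_hmul (D : DecGraph X k l) (E : DecGraph X k' l') :
    labEval φ (D.hmul E) =
      P.rel finSumFinEquiv finSumFinEquiv (P.lmul (labEval φ D) (labEval φ E)) := by
  have h1 : lprod (decLab φ (D.hmul E)) = P.rel
      (Equiv.sumSigmaDistrib fun v : D.graph.V ⊕ E.graph.V =>
        Fin (Sum.elim D.graph.inn E.graph.inn v)).symm
      (Equiv.sumSigmaDistrib fun v : D.graph.V ⊕ E.graph.V =>
        Fin (Sum.elim D.graph.out E.graph.out v)).symm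
      (P.lmul (lprod (decLab φ D)) (lprod (decLab φ E))) :=
    lprod_sum hP (W := E.graph.V) D.graph.V (A := fun v => Fin (Sum.elim D.graph.inn E.graph.inn v))
      (B := fun v => Fin (Sum.elim D.graph.out E.graph.out v)) (decLab φ (D.hmul E))
  have h2 : P.glue (D.hmul E).graph.wire (lprod (decLab φ (D.hmul E))) =
      P.rel finSumFinEquiv finSumFinEquiv (P.lmul (P.glue D.graph.wire (lprod (decLab φ D)))
        (P.glue E.graph.wire (lprod (decLab φ E)))) := by
    rw [lmul_glue hP, h1]
    refine glue_rel hP _ _ _ _ _ _ ?_ _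
    have e : ∀ y : (Fin l ⊕ Σ v, Fin (D.graph.inn v)) ⊕ (Fin l' ⊕ Σ v, Fin (E.graph.inn v)),
        (splitEnds l l' D.graph.inn E.graph.inn).symm y =
        Equiv.sumCongr finSumFinEquiv (Equiv.sumSigmaDistrib fun v : D.graph.V ⊕ E.graph.V =>
          Fin (Sum.elim D.graph.inn E.graph.inn v)).symm (Equiv.sumSumSumComm _ _ _ _ y) := by
      rintro ((_ | ⟨_, _⟩) | (_ | ⟨_, _⟩)) <;> rfl
    rintro ((x | x) | (⟨v, x⟩ | ⟨v, x⟩))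
    · exact (hmul_wire_endL D.graph E.graph (Sum.inl x)).trans (e _)
    · exact (hmul_wire_endR D.graph E.graph (Sum.inl x)).trans (e _)
    · exact (hmul_wire_endL D.graph E.graph (Sum.inr ⟨v, x⟩)).trans (e _)
    · exact (hmul_wire_endR D.graph E.graph (Sum.inr ⟨v, x⟩)).trans (e _)
  have h3 : labEval φ (D.hmul E) = loopMul^[D.graph.loops] (loopMul^[E.graph.loops]
      (P.glue (D.hmul E).graph.wire (lprod (decLab φ (D.hmul E))))) :=
    Function.iterate_add_apply loopMul _ _ _
  rw [h3, h2, loopMul_iterate _ (loopMul_rel hP _ _), loopMul_iterate _ (loopMul_rel hP _ _),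
    loopMul_iterate _ (lmul_loopMul hP _)]
  exact congrArg (P.rel finSumFinEquiv finSumFinEquiv) (loopMul_iterate
    (fun x => P.lmul x (loopMul^[E.graph.loops] (P.glue E.graph.wire (lprod (decLab φ E)))))
      (fun x => loopMul_lmul hP x _) _ _)

/-- After `finSuccEquiv'` has named the glued indices `none`, `ltr_glue` applies; its
`Equiv.removeNone` and its loop condition are those in the definition of the trace of graphs. -/
theorem labEval_trace (i : Fin (k + 1)) (j : Fin (l + 1)) (D : DecGraph X (k + 1) (l + 1)) :
    labEval φ (D.trace i j) =
      P.ltr (P.rel (finSuccEquiv' i) (finSuccEquiv' j) (labEval φ D)) := by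
  classical
  let W : Option (Fin k) ⊕ (Σ v, Fin (D.graph.out v)) ≃ Option (Fin l) ⊕ Σ v, Fin (D.graph.inn v) :=
    ((Equiv.sumCongr (finSuccEquiv' i) (Equiv.refl _)).symm.trans D.graph.wire).trans
      (Equiv.sumCongr (finSuccEquiv' j) (Equiv.refl _))
  have h1 := glue_rel hP (Equiv.refl (Σ v, Fin (D.graph.inn v)))
    (Equiv.refl (Σ v, Fin (D.graph.out v))) (finSuccEquiv' i) (finSuccEquiv' j) D.graph.wire W
    (fun x => congrArg (fun y => Equiv.sumCongr (finSuccEquiv' j) (Equiv.refl _)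
      (D.graph.wire y)) (Equiv.symm_apply_apply _ x)) (lprod (decLab φ D))
  rw [rel_refl hP] at h1
  have h2 : Equiv.removeNone (((optionSumLeft _ _).symm.trans W).trans (optionSumLeft _ _)) =
      traceWire i j D.graph.wire := by
    refine congrArg Equiv.removeNone (Equiv.ext fun x => ?_)
    have e1 : ∀ y, optionSumLeft _ _ (Equiv.sumCongr (finSuccEquiv' j) (Equiv.refl _) y) =
        extract j (Σ v, Fin (D.graph.inn v)) y := by
      rintro (y | y) <;> rfl
    have e2 : (Equiv.sumCongr (finSuccEquiv' i) (Equiv.refl _)).symm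
        ((optionSumLeft _ _).symm x) = (extract i (Σ v, Fin (D.graph.out v))).symm x := by
      rcases x with _ | x | x
      · exact congrArg Sum.inl (finSuccEquiv'_symm_none i)
      · exact congrArg Sum.inl (finSuccEquiv'_symm_some i x)
      · rfl
    exact (e1 _).trans (congrArg (fun y => extract j _ (D.graph.wire y)) e2)
  have h3 : W (Sum.inl none) = Sum.inl none ↔ D.graph.wire (Sum.inl i) = Sum.inl j := by
    have e1 : W (Sum.inl none) =
        Equiv.sumCongr (finSuccEquiv' j) (Equiv.refl _) (D.graph.wire (Sum.inl i)) :=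
      congrArg (fun y => Equiv.sumCongr (finSuccEquiv' j) (Equiv.refl _) (D.graph.wire y))
        (congrArg Sum.inl (finSuccEquiv'_symm_none i))
    have e2 : (Sum.inl none : Option (Fin l) ⊕ Σ v, Fin (D.graph.inn v)) =
        Equiv.sumCongr (finSuccEquiv' j) (Equiv.refl _) (Sum.inl j) :=
      congrArg Sum.inl (finSuccEquiv'_at j).symm
    rw [e1, e2, Equiv.apply_eq_iff_eq]
  have h4 := ltr_glue hP W (lprod (decLab φ D))
  rw [h2] at h4
  have h5 : labEval φ (D.trace i j) =
      loopMul^[if D.graph.wire (Sum.inl i) = Sum.inl j then D.graph.loops + 1 else D.graph.loops]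
        (P.glue (traceWire i j D.graph.wire) (lprod (decLab φ D))) := by
    rw [trace_eq]
    rfl
  rw [h5, labEval, ← loopMul_iterate _ (loopMul_rel hP _ _),
    ← loopMul_iterate _ (loopMul_ltr hP), ← h1, h4]
  by_cases h : D.graph.wire (Sum.inl i) = Sum.inl j
  · rw [if_pos h, if_pos (h3.mpr h)]
    rfl
  · rw [if_neg h, if_neg (h3.not.mpr h)]

theorem labEval_empty : labEval φ (empty X) =
    P.rel finZeroEquiv.symm finZeroEquiv.symm P.lone := by
  have h0 : lprod (decLab φ (empty X)) = _ := lprod_empty hP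
    (A := fun v => Fin (Empty.elim v)) (B := fun v => Fin (Empty.elim v)) (decLab φ (empty X))
  have h := glue_rel hP (Equiv.equivOfIsEmpty Empty (Σ v : Empty, Fin (Empty.elim v)))
    (Equiv.equivOfIsEmpty Empty (Σ v : Empty, Fin (Empty.elim v))) finZeroEquiv.symm
    finZeroEquiv.symm (Equiv.sumComm Empty Empty) (empty X).graph.wire
    (by rintro (⟨⟨⟩⟩ | ⟨⟨⟩⟩)) P.lone
  rw [glue_sumComm hP] at h
  exact (congrArg (P.glue (empty X).graph.wire) h0).trans h

/-- Without vertices the trace is over an empty type, so only the identity strand of the single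
input remains. -/
theorem labEval_edge : labEval φ (edge X) =
    P.rel finOneEquiv.symm finOneEquiv.symm P.lunit := by
  have h0 : lprod (decLab φ (edge X)) = _ := lprod_empty hP
    (A := fun v => Fin (Empty.elim v)) (B := fun v => Fin (Empty.elim v)) (decLab φ (edge X))
  have h := glue_rel hP (Equiv.equivOfIsEmpty Empty (Σ v : Empty, Fin (Empty.elim v)))
    (Equiv.equivOfIsEmpty Empty (Σ v : Empty, Fin (Empty.elim v))) finOneEquiv.symm
    finOneEquiv.symm (Equiv.refl (Unit ⊕ Empty)) (edge X).graph.wire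
    (by rintro (_ | ⟨⟨⟩⟩); rfl) P.lone
  refine (congrArg (P.glue (edge X).graph.wire) h0).trans (h.trans (congrArg _ ?_))
  rw [glue_apply, lmul_lone hP, ltrace_empty hP, lid_unit hP, rel_rel hP, rel_rel hP]
  exact (rel_congr (fun _ => rfl) (fun _ => rfl) _).trans (rel_refl hP _)

theorem labEval_corolla (x : X.obj k l) : labEval φ (corolla x) =
    P.lab (Equiv.refl _) (Equiv.refl _) (φ k l x) := by
  let y := P.lab (Equiv.refl (Fin k)) (Equiv.refl (Fin l)) (φ k l x)
  have h0 : lprod (decLab φ (corolla x)) =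
      P.rel (Equiv.uniqueSigma fun _ : Unit => Fin k).symm
        (Equiv.uniqueSigma fun _ : Unit => Fin l).symm y := by
    exact lprod_unit hP y
  have h := glue_rel hP (Equiv.uniqueSigma fun _ : Unit => Fin k).symm
    (Equiv.uniqueSigma fun _ : Unit => Fin l).symm (Equiv.refl (Fin k)) (Equiv.refl (Fin l))
    (Equiv.sumComm _ _) (corolla x).graph.wire (by rintro (_ | _) <;> rfl) y
  rw [glue_sumComm hP, rel_refl hP] at h
  exact (congrArg (P.glue (corolla x).graph.wire) h0).trans h

theorem labEval_linear (G : PlanarGraph k l) [DecidableEq G.V] (a b : K)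
    (d : ∀ v : G.V, X.obj (G.inn v) (G.out v)) (v : G.V) (x y z : X.obj (G.inn v) (G.out v))
    (h : x = a • y + b • z) :
    labEval φ ⟨G, Function.update d v x⟩ = a • labEval φ ⟨G, Function.update d v y⟩ +
      b • labEval φ ⟨G, Function.update d v z⟩ := by
  have hd : ∀ x, decLab φ ⟨G, Function.update d v x⟩ v =
      P.lab (Equiv.refl _) (Equiv.refl _) (φ _ _ x) := fun x =>
    congrArg (fun t => P.lab (Equiv.refl _) (Equiv.refl _) (φ _ _ t)) (Function.update_self v x d)
  have hd' : ∀ x y i, i ≠ v → decLab φ ⟨G, Function.update d v x⟩ i =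
      decLab φ ⟨G, Function.update d v y⟩ i := fun x y i hi =>
    congrArg (fun t => P.lab (Equiv.refl _) (Equiv.refl _) (φ _ _ t))
      ((Function.update_of_ne hi x d).trans (Function.update_of_ne hi y d).symm)
  have h1 := lprod_linear hP G.V a b v (decLab φ ⟨G, Function.update d v x⟩)
    (decLab φ ⟨G, Function.update d v y⟩) (decLab φ ⟨G, Function.update d v z⟩)
    (by rw [hd, hd, hd, h, map_add, map_add, map_smul, map_smul, map_smul, map_smul])
    (hd' x y) (hd' x z)
  have h2 : ∀ n (x y : P.Lab (Fin k) (Fin l)), loopMul^[n] (a • x + b • y) =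
      a • loopMul^[n] x + b • loopMul^[n] y := by
    intro n x y
    induction n with
    | zero => rfl
    | succ n ih => simp only [Function.iterate_succ_apply', ih, loopMul_smul_add]
  have h3 : P.glue G.wire (lprod (decLab φ ⟨G, Function.update d v x⟩)) =
      a • P.glue G.wire (lprod (decLab φ ⟨G, Function.update d v y⟩)) +
      b • P.glue G.wire (lprod (decLab φ ⟨G, Function.update d v z⟩)) :=
    (congrArg (P.glue G.wire) h1).trans ((map_add _ _ _).trans
      (congrArg₂ (· + ·) (map_smul _ _ _) (map_smul _ _ _)))
  exact (congrArg (loopMul^[G.loops]) h3).trans (h2 _ _ _)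

end DecGraph

/-! ### The evaluation as a morphism of TraPs -/

namespace DecGraph

open PlanarGraph TraPData

variable {K : Type w} [Field K] {X : SymData.{u, w} K} {P : TraPData.{v, w} K}
  {k l k' l' k'' l'' : ℕ} (φ : ∀ k l, X.obj k l →ₗ[K] P.obj k l) (hP : P.IsTraP)
include hP

theorem lab_refl_injective {p q : P.obj k l}
    (h : P.lab (Equiv.refl _) (Equiv.refl _) p = P.lab (Equiv.refl _) (Equiv.refl _) q) : p = q := by
  rw [← unlab_lab hP (Equiv.refl _) (Equiv.refl _) p, h, unlab_lab hP]

theorem eval_of_iso {D D' : DecGraph X k l} (f : Iso D D') : eval φ D = eval φ D' :=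
  congrArg (P.unlab _ _) (labEval_of_iso φ hP f)

theorem eval_linear (G : PlanarGraph k l) [DecidableEq G.V] (a b : K)
    (d : ∀ v : G.V, X.obj (G.inn v) (G.out v)) (v : G.V) (x y z : X.obj (G.inn v) (G.out v))
    (h : x = a • y + b • z) :
    eval φ ⟨G, Function.update d v x⟩ = a • eval φ ⟨G, Function.update d v y⟩ +
      b • eval φ ⟨G, Function.update d v z⟩ := by
  rw [eval, labEval_linear φ hP G a b d v x y z h, map_add, map_smul, map_smul]
  rfl

theorem eval_relabel (f : Fin k ≃ Fin k') (g : Fin l ≃ Fin l') (D : DecGraph X k l) :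
    eval φ (D.relabel f g) = P.re f g (eval φ D) := by
  refine lab_refl_injective hP ?_
  rw [lab_eval φ hP, labEval_relabel φ hP, ← lab_eval φ hP, rel_lab hP, lab_re hP]
  rfl

theorem eval_lact (σ : Equiv.Perm (Fin l)) (D : DecGraph X k l) :
    eval φ (D.lact σ) = P.lact σ (eval φ D) := by
  rw [lact_eq_relabel, eval_relabel φ hP, SymData.re_perm]
  exact congrArg _ (hP.ract_one _)

theorem eval_ract (τ : Equiv.Perm (Fin k)) (D : DecGraph X k l) :
    eval φ (D.ract τ) = P.ract τ (eval φ D) := by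
  rw [ract_eq_relabel, eval_relabel φ hP, SymData.re_perm]
  exact hP.one_lact _

theorem eval_hmul (D : DecGraph X k l) (E : DecGraph X k' l') :
    eval φ (D.hmul E) = P.mul (eval φ D) (eval φ E) := by
  refine lab_refl_injective hP ?_
  rw [lab_eval φ hP, labEval_hmul φ hP, ← lab_eval φ hP, ← lab_eval φ hP, lmul_lab hP, rel_lab hP]
  congr 2 <;> ext1 x <;> simp

theorem eval_trace (i : Fin (k + 1)) (j : Fin (l + 1)) (D : DecGraph X (k + 1) (l + 1)) :
    eval φ (D.trace i j) = P.tr i j (eval φ D) := by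
  refine lab_refl_injective hP ?_
  rw [lab_eval φ hP, labEval_trace φ hP, ← lab_eval φ hP, rel_lab hP]
  exact ltr_lab hP _ _ (finSuccEquiv'_at i) (finSuccEquiv'_at j)
    (fun x => finSuccEquiv'_succAbove i x) (fun x => finSuccEquiv'_succAbove j x) _

theorem eval_empty : eval φ (empty X) = P.one := by
  refine lab_refl_injective hP ?_
  rw [lab_eval φ hP, labEval_empty φ hP, lone, rel_lab hP]
  exact congrArg₂ (fun a b => P.lab a b P.one) (Equiv.ext fun x => x.elim0)
    (Equiv.ext fun x => x.elim0)

theorem eval_edge : eval φ (edge X) = P.unit := by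
  refine lab_refl_injective hP ?_
  rw [lab_eval φ hP, labEval_edge φ hP, lunit, rel_lab hP, Equiv.self_trans_symm]

theorem eval_corolla (x : X.obj k l) : eval φ (corolla x) = φ k l x := by
  refine lab_refl_injective hP ?_
  rw [lab_eval φ hP, labEval_corolla φ hP]

/-- The linear extension of the evaluation. -/
noncomputable def evalLin (k l : ℕ) : (PGr X).obj k l →ₗ[K] P.obj k l :=
  (relSpan X k l).liftQ (Finsupp.linearCombination K (eval φ))
    (Submodule.span_le.mpr fun r hr => by
      rw [SetLike.mem_coe, LinearMap.mem_ker]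
      cases hr with
      | iso D D' f =>
        simp [Finsupp.linearCombination_single, eval_of_iso φ hP f]
      | add G d v x y =>
        have h := eval_linear φ hP G 1 1 d v (x + y) x y (by simp)
        rw [one_smul, one_smul] at h
        simp [Finsupp.linearCombination_single, h]
      | smul G d v a x =>
        -- With the coefficient `0` the last decoration is arbitrary.
        have h := eval_linear φ hP G a 0 d v (a • x) x x (by simp)
        rw [zero_smul, add_zero] at h
        simp [Finsupp.linearCombination_single, h])

theorem evalLin_toPGr (D : DecGraph X k l) : evalLin φ hP k l D.toPGr = eval φ D :=
  (Finsupp.linearCombination_single K (1 : K) D).trans (one_smul _ _)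

/-- The morphism of TraPs that is given by the evaluation. -/
noncomputable def evalHom : (PGr X).Hom P where
  app := evalLin φ hP
  map_lact σ p := by
    refine PGr_eq (evalLin φ hP _ _ ∘ₗ (PGr X).lact σ) (P.lact σ ∘ₗ evalLin φ hP _ _)
      (fun D => ?_) p
    rw [LinearMap.comp_apply, LinearMap.comp_apply, PGr_lact, evalLin_toPGr, evalLin_toPGr,
      eval_lact φ hP]
  map_ract τ p := by
    refine PGr_eq (evalLin φ hP _ _ ∘ₗ (PGr X).ract τ) (P.ract τ ∘ₗ evalLin φ hP _ _)
      (fun D => ?_) p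
    rw [LinearMap.comp_apply, LinearMap.comp_apply, PGr_ract, evalLin_toPGr, evalLin_toPGr,
      eval_ract φ hP]
  map_mul p p' := by
    refine PGr_eq₂ ((PGr X).mul.compr₂ (evalLin φ hP _ _))
      (P.mul.compl₁₂ (evalLin φ hP _ _) (evalLin φ hP _ _)) (fun D D' => ?_) p p'
    rw [LinearMap.compr₂_apply, LinearMap.compl₁₂_apply, PGr_mul, evalLin_toPGr, evalLin_toPGr,
      evalLin_toPGr, eval_hmul φ hP]
  map_tr i j p := by
    refine PGr_eq (evalLin φ hP _ _ ∘ₗ (PGr X).tr i j) (P.tr i j ∘ₗ evalLin φ hP _ _)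
      (fun D => ?_) p
    rw [LinearMap.comp_apply, LinearMap.comp_apply, PGr_tr, evalLin_toPGr, evalLin_toPGr,
      eval_trace φ hP]
  map_one := (evalLin_toPGr φ hP _).trans (eval_empty φ hP)
  map_unit := (evalLin_toPGr φ hP _).trans (eval_edge φ hP)

theorem evalHom_incl (x : X.obj k l) : (evalHom φ hP).app k l (PGr.incl X k l x) = φ k l x :=
  (evalLin_toPGr φ hP _).trans (eval_corolla φ hP x)

end DecGraph

namespace DecGraph

open PlanarGraph

variable {K : Type w} [Field K] {X : SymData.{u, w} K} {k l k' l' : ℕ}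

/-! ### Generation of the decorated graphs by the corollas -/

/-- A property of decorated graphs that is inherited along the operations of TraPs. -/
structure IsClosed (C : ∀ {k l : ℕ}, DecGraph X k l → Prop) : Prop where
  iso : ∀ {k l : ℕ} {D D' : DecGraph X k l}, Iso D D' → C D → C D'
  relabel : ∀ {k l k' l' : ℕ} (f : Fin k ≃ Fin k') (g : Fin l ≃ Fin l') {D : DecGraph X k l},
    C D → C (D.relabel f g)
  hmul : ∀ {k l k' l' : ℕ} {D : DecGraph X k l} {E : DecGraph X k' l'}, C D → C E → C (D.hmul E)
  trace : ∀ {k l : ℕ} (i : Fin (k + 1)) (j : Fin (l + 1)) {D : DecGraph X (k + 1) (l + 1)},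
    C D → C (D.trace i j)
  empty : C (empty X)
  edge : C (edge X)
  corolla : ∀ {k l : ℕ} (x : X.obj k l), C (corolla x)

/-- The wiring of a disjoint union of corollas. -/
def corollasWire {S T : Type} (p : Fin k ≃ T) (q : S ≃ Fin l) : Fin k ⊕ S ≃ Fin l ⊕ T :=
  (Equiv.sumCongr p q).trans (Equiv.sumComm _ _)

/-- A disjoint union of corollas. -/
def corollas {V : Type} [Finite V] {a b : V → ℕ} (x : ∀ v, X.obj (a v) (b v))
    (p : Fin k ≃ Σ v, Fin (a v)) (q : (Σ v, Fin (b v)) ≃ Fin l) : DecGraph X k l where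
  graph := ⟨V, inferInstance, a, b, 0, corollasWire p q⟩
  dec := x

variable {C : ∀ {k l : ℕ}, DecGraph X k l → Prop} (hC : IsClosed C)
include hC

/-- Induction on the set of vertices: one corolla is split off as a factor. The bijections `p` and
`q` are arbitrary because relabellings are allowed. -/
theorem IsClosed.corollas (V : Type) [Finite V] : ∀ {k l : ℕ} {a b : V → ℕ}
    (x : ∀ v, X.obj (a v) (b v)) (p : Fin k ≃ Σ v, Fin (a v)) (q : (Σ v, Fin (b v)) ≃ Fin l),
    C (corollas x p q) := by
  refine TraPData.finite_induction (Q := fun V _ => ∀ {k l : ℕ} {a b : V → ℕ}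
    (x : ∀ v, X.obj (a v) (b v)) (p : Fin k ≃ Σ v, Fin (a v)) (q : (Σ v, Fin (b v)) ≃ Fin l),
    C (DecGraph.corollas x p q)) ?_ ?_ ?_ V
  · intro S T _ _ f h k l a b x p q
    refine hC.iso ?_ (h (fun v => x (f v))
      (p.trans (slotEquiv (a := fun v => a (f v)) f fun _ => rfl).symm)
      ((slotEquiv (a := fun v => b (f v)) f fun _ => rfl).trans q))
    exact
      { equiv := f
        inn_eq := fun _ => rfl
        out_eq := fun _ => rfl
        loops_eq := rfl
        wire_eq := by
          ext1 y
          rcases y with y | y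
          · exact congrArg Sum.inr (Equiv.apply_symm_apply (slotEquiv (a := fun v => a (f v)) f
              fun _ => rfl) (p y)).symm
          · rfl
        dec_eq := fun _ => rfl }
  · intro k l a b x p q
    have f : Fin 0 ≃ Fin k := finZeroEquiv.trans
      ((Equiv.equivOfIsEmpty Empty (Σ v, Fin (a v))).trans p.symm)
    have g : Fin 0 ≃ Fin l := finZeroEquiv.trans
      ((Equiv.equivOfIsEmpty Empty (Σ v, Fin (b v))).trans q)
    refine hC.iso (isoOfRelabel (D := DecGraph.empty X) (D' := DecGraph.corollas x p q) f g
      (Equiv.refl Empty) (fun v : Empty => v.elim) (fun v : Empty => v.elim) rfl ?_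
      (fun v : Empty => v.elim)) (hC.relabel f g hC.empty)
    rintro (y | ⟨⟨⟩, _⟩)
    exact y.elim0
  · intro S _ h k l a b x p q
    -- The slots of the remaining corollas are enumerated arbitrarily; `f` and `g` then translate to
    -- the prescribed `p` and `q`.
    let p' := (Finite.equivFin (Σ v, Fin (a (some v)))).symm
    let q' := Finite.equivFin (Σ v, Fin (b (some v)))
    let f : Fin (a none + Nat.card (Σ v, Fin (a (some v)))) ≃ Fin k :=
      ((finSumFinEquiv.symm.trans (Equiv.sumCongr (Equiv.refl (Fin (a none))) p')).trans
        (TraPData.sigmaOption fun v => Fin (a v))).trans p.symm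
    let g : Fin (b none + Nat.card (Σ v, Fin (b (some v)))) ≃ Fin l :=
      ((finSumFinEquiv.symm.trans (Equiv.sumCongr (Equiv.refl (Fin (b none))) q'.symm)).trans
        (TraPData.sigmaOption fun v => Fin (b v))).trans q
    have hf1 : ∀ i, f (Fin.castAdd _ i) = p.symm ⟨none, i⟩ := fun i => by
      simp [f, TraPData.sigmaOption]
    have hf2 : ∀ i, f (Fin.natAdd _ i) = p.symm ⟨some (p' i).1, (p' i).2⟩ := fun i => by
      simp [f, TraPData.sigmaOption]
    have hg1 : ∀ i, g (Fin.castAdd _ i) = q ⟨none, i⟩ := fun i => by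
      simp [g, TraPData.sigmaOption]
    have hg2 : ∀ o, g (Fin.natAdd _ (q' o)) = q ⟨some o.1, o.2⟩ := fun i => by
      simp [g, TraPData.sigmaOption]
    let e : Unit ⊕ S ≃ Option S := (Equiv.sumComm _ _).trans (TraPData.optionSumUnit S)
    let E := DecGraph.corollas (fun v => x (some v)) p' q'
    refine hC.iso (isoOfRelabel (D := (DecGraph.corolla (x none)).hmul E) f g e
      (by rintro (_ | _) <;> rfl) (by rintro (_ | _) <;> rfl) rfl ?_ (by rintro (_ | _) <;> rfl))
      (hC.relabel f g (hC.hmul (hC.corolla (x none)) (h (fun v => x (some v)) p' q')))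
    intro y
    rcases eq_endL_or_eq_endR _ _ _ _ y with ⟨z, rfl⟩ | ⟨z, rfl⟩
    · refine Eq.trans ?_ (congrArg _ (hmul_wire_endL (DecGraph.corolla (x none)).graph E.graph z)).symm
      rcases z with z | ⟨⟨⟩, z⟩
      · have : (DecGraph.corollas x p q).graph.wire (Sum.inl (f (Fin.castAdd _ z))) =
            Sum.inr ⟨none, z⟩ := by
          rw [hf1]
          exact congrArg Sum.inr (p.apply_symm_apply _)
        exact this
      · exact congrArg Sum.inl (hg1 z).symm
    · refine Eq.trans ?_ (congrArg _ (hmul_wire_endR (DecGraph.corolla (x none)).graph E.graph z)).symm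
      rcases z with z | z
      · have : (DecGraph.corollas x p q).graph.wire (Sum.inl (f (Fin.natAdd _ z))) =
            Sum.inr ⟨some (p' z).1, (p' z).2⟩ := by
          rw [hf2]
          exact congrArg Sum.inr (p.apply_symm_apply _)
        exact this
      · exact congrArg Sum.inl (hg2 z).symm

variable (D : DecGraph X k l)

/-- Neither internal edges nor input-output edges nor loops. -/
theorem IsClosed.rewire_of_corollas {k l : ℕ}
    (w : Fin k ⊕ (Σ v, Fin (D.graph.out v)) ≃ Fin l ⊕ (Σ v, Fin (D.graph.inn v)))
    (h1 : ∀ o, ∃ j, w (Sum.inr o) = Sum.inl j) (h2 : ∀ i, ∃ s, w (Sum.inl i) = Sum.inr s) :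
    C (D.rewire 0 w) := by
  choose q hq using h1
  choose p hp using h2
  -- No outgoing slot leads to an ingoing one, so every ingoing slot is reached from an input.
  -- Dually, no input leads to an output, so every output is reached from an outgoing slot.
  have hp' : Function.Bijective p := by
    constructor
    · intro i i' h
      have := w.injective (((hp i).trans (congrArg Sum.inr h)).trans (hp i').symm)
      exact Sum.inl_injective this
    · intro s
      obtain ⟨y, hy⟩ := w.surjective (Sum.inr s)
      rcases y with y | y
      · exact ⟨y, Sum.inr_injective ((hp y).symm.trans hy)⟩
      · exact absurd ((hq y).symm.trans hy) (by simp)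
  have hq' : Function.Bijective q := by
    constructor
    · intro i i' h
      have := w.injective (((hq i).trans (congrArg Sum.inl h)).trans (hq i').symm)
      exact Sum.inr_injective this
    · intro s
      obtain ⟨y, hy⟩ := w.surjective (Sum.inl s)
      rcases y with y | y
      · exact absurd ((hp y).symm.trans hy) (by simp)
      · exact ⟨y, Sum.inl_injective ((hq y).symm.trans hy)⟩
  have h : w = corollasWire (Equiv.ofBijective p hp') (Equiv.ofBijective q hq') := by
    ext1 y
    rcases y with y | y
    · exact hp y
    · exact hq y
  rw [h]
  exact hC.corollas D.graph.V D.dec _ _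

/-- Neither internal edges nor loops. -/
theorem IsClosed.rewire_of_inl (k : ℕ) : ∀ {l : ℕ}
    (w : Fin k ⊕ (Σ v, Fin (D.graph.out v)) ≃ Fin l ⊕ (Σ v, Fin (D.graph.inn v)))
    (_ : ∀ o, ∃ j, w (Sum.inr o) = Sum.inl j), C (D.rewire 0 w) := by
  induction k with
  | zero => exact fun w h => hC.rewire_of_corollas D w h fun i => i.elim0
  | succ k ih =>
    intro l w h
    by_cases h2 : ∀ i, ∃ s, w (Sum.inl i) = Sum.inr s
    · exact hC.rewire_of_corollas D w h h2
    · push Not at h2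
      obtain ⟨i, hi⟩ := h2
      rcases hj : w (Sum.inl i) with j | s
      · rcases l with _ | l
        · exact j.elim0
        -- As `i` leads to `j`, no other beginning does, and `traceWire` merely deletes this edge.
        -- The loop of an actual trace does not appear, since `rewire 0` prescribes the number of
        -- loops.
        have key : ∀ y, w (skip i y) = skip j (traceWire i j w y) := fun y => by
          rcases (traceWire_eq_iff i j w y _).mp rfl with h | ⟨h, _⟩
          · exact h
          · exact absurd (w.injective (h.trans hj.symm)) (skip_ne i y)
        have h3 : ∀ o, ∃ j', traceWire i j w (Sum.inr o) = Sum.inl j' := by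
          intro o
          obtain ⟨j', hj'⟩ := h o
          have := (key (Sum.inr o)).symm.trans hj'
          rcases ht : traceWire i j w (Sum.inr o) with t | t
          · exact ⟨t, rfl⟩
          · rw [ht] at this
            exact absurd this (by simp)
        -- In the product with `I` the deleted edge has the last indices; `f` and `g` move them back
        -- to `i` and `j`.
        let f : Fin (k + 1) ≃ Fin (k + 1) := finSuccEquivLast.trans (finSuccEquiv' i).symm
        let g : Fin (l + 1) ≃ Fin (l + 1) := finSuccEquivLast.trans (finSuccEquiv' j).symm
        have hf1 : ∀ y : Fin k, f (Fin.castAdd 1 y) = i.succAbove y := fun y =>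
          (congrArg _ (finSuccEquivLast_castSucc y)).trans (finSuccEquiv'_symm_some i y)
        have hf2 : f (Fin.natAdd k (0 : Fin 1)) = i :=
          (congrArg _ finSuccEquivLast_last).trans (finSuccEquiv'_symm_none i)
        have hg1 : ∀ y : Fin l, g (Fin.castAdd 1 y) = j.succAbove y := fun y =>
          (congrArg _ (finSuccEquivLast_castSucc y)).trans (finSuccEquiv'_symm_some j y)
        have hg2 : g (Fin.natAdd l (0 : Fin 1)) = j :=
          (congrArg _ finSuccEquivLast_last).trans (finSuccEquiv'_symm_none j)
        let E := D.rewire 0 (traceWire i j w)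
        refine hC.iso (isoOfRelabel (D := E.hmul (DecGraph.edge X)) (D' := D.rewire 0 w) f g
          (Equiv.sumEmpty D.graph.V Empty) (by rintro (_ | ⟨⟨⟩⟩); rfl) (by rintro (_ | ⟨⟨⟩⟩); rfl)
          rfl ?_ (by rintro (_ | ⟨⟨⟩⟩); rfl)) (hC.relabel f g (hC.hmul (ih _ h3) hC.edge))
        intro y
        rcases eq_endL_or_eq_endR _ _ _ _ y with ⟨z, rfl⟩ | ⟨z, rfl⟩
        · refine Eq.trans ?_ (congrArg _ (hmul_wire_endL E.graph (DecGraph.edge X).graph z)).symm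
          have e1 : Sum.map f (slotEquiv (Equiv.sumEmpty D.graph.V Empty)
              (by rintro (_ | ⟨⟨⟩⟩); rfl)) (endL k 1 D.graph.out Empty.elim z) = skip i z := by
            rcases z with z | z
            · exact congrArg Sum.inl (hf1 z)
            · rfl
          have e2 : ∀ z, Sum.map g (slotEquiv (Equiv.sumEmpty D.graph.V Empty)
              (by rintro (_ | ⟨⟨⟩⟩); rfl)) (endL l 1 D.graph.inn Empty.elim z) = skip j z := by
            rintro (z | z)
            · exact congrArg Sum.inl (hg1 z)
            · rfl
          exact (congrArg w e1).trans ((key z).trans (e2 _).symm)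
        · refine Eq.trans ?_ (congrArg _ (hmul_wire_endR E.graph (DecGraph.edge X).graph z)).symm
          rcases z with z | ⟨⟨⟩, _⟩
          obtain rfl : z = 0 := Subsingleton.elim _ _
          exact (congrArg (fun t => w (Sum.inl t)) hf2).trans
            (hj.trans (congrArg Sum.inl hg2.symm))
      · exact absurd hj (hi s)

/-- No loops. -/
theorem IsClosed.rewire_zero (n : ℕ) : ∀ {k l : ℕ}
    (w : Fin k ⊕ (Σ v, Fin (D.graph.out v)) ≃ Fin l ⊕ (Σ v, Fin (D.graph.inn v)))
    (_ : {o | ∃ s, w (Sum.inr o) = Sum.inr s}.ncard ≤ n), C (D.rewire 0 w) := by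
  classical
  induction n with
  | zero =>
    intro k l w h
    rw [Nat.le_zero, Set.ncard_eq_zero] at h
    refine hC.rewire_of_inl D k w fun o => ?_
    rcases ho : w (Sum.inr o) with j | s
    · exact ⟨j, rfl⟩
    · exact absurd (show o ∈ {o | ∃ s, w (Sum.inr o) = Sum.inr s} from ⟨s, ho⟩)
        (h ▸ Set.notMem_empty o)
  | succ n ih =>
    intro k l w h
    by_cases h2 : ∃ o s, w (Sum.inr o) = Sum.inr s
    · obtain ⟨o, s, hs⟩ := h2
      -- The edge from `o` to `s` is cut: `o` leads to a new last output, and a new last input leads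
      -- to `s`. With `none` for the new input and output, this is the transposition of `none` and
      -- `s` after `w`.
      let w' := ((extract (Fin.last k) _).trans
        ((Equiv.optionCongr w).trans (Equiv.swap none (some (Sum.inr s))))).trans
          (extract (Fin.last l) _).symm
      have h3 : w' (Sum.inl (Fin.last k)) = Sum.inr s := by
        simp only [w', Equiv.trans_apply, extract_self, Equiv.optionCongr_apply, Option.map_none,
          Equiv.swap_apply_left]
        rfl
      have h4 : ∀ y, w y = Sum.inr s → w' (skip (Fin.last k) y) = Sum.inl (Fin.last l) := by
        intro y hy
        simp only [w', Equiv.trans_apply, extract_skip, Equiv.optionCongr_apply, Option.map_some,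
          hy, Equiv.swap_apply_right]
        rfl
      have h5 : ∀ y, w y ≠ Sum.inr s → w' (skip (Fin.last k) y) = skip (Fin.last l) (w y) := by
        intro y hy
        simp only [w', Equiv.trans_apply, extract_skip, Equiv.optionCongr_apply, Option.map_some]
        rw [Equiv.swap_apply_of_ne_of_ne (by simp) (by simpa using hy)]
        rfl
      have h6 : traceWire (Fin.last k) (Fin.last l) w' = w := by
        refine traceWire_ext _ _ _ _ fun y => ?_
        by_cases hy : w y = Sum.inr s
        · exact Or.inr ⟨h4 y hy, by rw [h3, hy]; rfl⟩
        · exact Or.inl (h5 y hy)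
      have h7 : {o | ∃ s, w' (Sum.inr o) = Sum.inr s} ⊂ {o | ∃ s, w (Sum.inr o) = Sum.inr s} := by
        refine (Set.ssubset_iff_of_subset ?_).mpr ⟨o, ⟨s, hs⟩, ?_⟩
        · rintro o' ⟨s', hs'⟩
          by_cases ho : w (Sum.inr o') = Sum.inr s
          · exact ⟨s, ho⟩
          · have e := (h5 (Sum.inr o') ho).symm.trans hs'
            rcases ht : w (Sum.inr o') with t | t
            · rw [ht] at e
              exact absurd e (by simp)
            · exact ⟨t, ht⟩
        · rintro ⟨s', hs'⟩
          exact absurd ((h4 (Sum.inr o) hs).symm.trans hs') (by simp)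
      have h8 := hC.trace (Fin.last k) (Fin.last l) (ih w' (by
        have := Set.ncard_lt_ncard h7
        omega))
      rw [trace_eq] at h8
      -- Gluing the cut edge together creates no loop, because the new input leads to a vertex.
      have h9 : ¬ (D.rewire 0 w').graph.wire (Sum.inl (Fin.last k)) = Sum.inl (Fin.last l) := by
        intro h
        exact absurd (h3.symm.trans h) (by simp)
      rw [if_neg h9] at h8
      have h10 : C (D.rewire 0 (traceWire (Fin.last k) (Fin.last l) w')) := h8
      rwa [h6] at h10
    · refine ih w ?_
      have : {o | ∃ s, w (Sum.inr o) = Sum.inr s} = ∅ :=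
        Set.eq_empty_of_forall_notMem fun o ⟨s, hs⟩ => h2 ⟨o, s, hs⟩
      rw [this, Set.ncard_empty]
      exact Nat.zero_le n

theorem IsClosed.rewire (n : ℕ) {k l : ℕ}
    (w : Fin k ⊕ (Σ v, Fin (D.graph.out v)) ≃ Fin l ⊕ (Σ v, Fin (D.graph.inn v))) :
    C (D.rewire n w) := by
  induction n with
  | zero => exact hC.rewire_zero D _ w le_rfl
  | succ n ih =>
    -- The graph with one loop and nothing else: the trace of `I`.
    let O := (DecGraph.edge X).trace 0 0
    have hO : O.graph.loops = 1 := loops_trace_of_eq (D := DecGraph.edge X) rfl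
    let E := D.rewire n w
    refine hC.iso (isoOfRelabel (D := E.hmul O) (D' := D.rewire (n + 1) w) (Equiv.refl _)
      (Equiv.refl _) (Equiv.sumEmpty D.graph.V Empty) (by rintro (_ | ⟨⟨⟩⟩); rfl)
      (by rintro (_ | ⟨⟨⟩⟩); rfl) (congrArg (n + ·) hO) ?_ (by rintro (_ | ⟨⟨⟩⟩); rfl))
      (hC.relabel _ _ (hC.hmul ih (hC.trace 0 0 hC.edge)))
    intro y
    rcases eq_endL_or_eq_endR _ _ _ _ y with ⟨z, rfl⟩ | ⟨z, rfl⟩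
    · refine Eq.trans ?_ (congrArg _ (hmul_wire_endL E.graph O.graph z)).symm
      have e1 : ∀ {k : ℕ} {a : D.graph.V → ℕ} (h) (z : Fin k ⊕ Σ v, Fin (a v)),
          Sum.map (Equiv.refl _) (slotEquiv (Equiv.sumEmpty D.graph.V Empty) h)
            (endL k 0 a Empty.elim z) = z := by
        rintro k a h (z | z) <;> rfl
      exact (congrArg w (e1 _ z)).trans (e1 _ _).symm
    · rcases z with z | ⟨⟨⟩, _⟩
      exact z.elim0

theorem IsClosed.all : C D := hC.rewire D D.graph.loops D.graph.wire

end DecGraph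

/-! ### Uniqueness of the morphism -/

namespace DecGraph

variable {K : Type w} [Field K] {X : SymData.{u, w} K} {P : TraPData.{v, w} K} {k l : ℕ}

/-- Agreement of two morphisms on graphs is inherited along all operations, so the generation of
graphs by corollas turns agreement on `ι` into equality. -/
theorem isClosed_eq (Φ Ψ : (PGr X).Hom P)
    (h : ∀ (k l : ℕ) (x : X.obj k l),
      Φ.app k l (PGr.incl X k l x) = Ψ.app k l (PGr.incl X k l x)) :
    IsClosed fun {k l} (D : DecGraph X k l) => Φ.app k l D.toPGr = Ψ.app k l D.toPGr where
  iso f h := by rwa [← toPGr_eq_of_iso f]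
  relabel {k l k' l'} f g D h := by
    obtain rfl := Fin.eq_of_equiv f
    obtain rfl := Fin.eq_of_equiv g
    -- Once the arities are identified, a relabelling is a right action followed by a left action,
    -- which morphisms respect.
    have e : D.relabel f g = (D.relabel f (Equiv.refl _)).relabel (Equiv.refl _) g :=
      congrArg (D.rewire D.graph.loops) (by ext1 (x | x) <;>
        simp [PlanarGraph.relabelWire, relabel])
    have e2 := ract_eq_relabel f.symm D
    rw [Equiv.symm_symm] at e2
    rw [e, ← lact_eq_relabel, ← e2, ← PGr_lact, ← PGr_ract, Φ.map_lact, Φ.map_ract, Ψ.map_lact,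
      Ψ.map_ract, h]
  hmul h h' := by rw [← PGr_mul, Φ.map_mul, Ψ.map_mul, h, h']
  trace i j D h := by rw [← PGr_tr, Φ.map_tr, Ψ.map_tr, h]
  empty := Φ.map_one.trans Ψ.map_one.symm
  edge := Φ.map_unit.trans Ψ.map_unit.symm
  corolla x := h _ _ x

theorem hom_ext {Φ Ψ : (PGr X).Hom P}
    (h : ∀ (k l : ℕ) (x : X.obj k l),
      Φ.app k l (PGr.incl X k l x) = Ψ.app k l (PGr.incl X k l x)) : Φ = Ψ := by
  have e : Φ.app = Ψ.app := by
    funext k l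
    exact PGr_hom_ext fun D => (isClosed_eq Φ Ψ h).all D
  rcases Φ with ⟨⟨_, _, _⟩, _, _, _, _⟩
  rcases Ψ with ⟨⟨_, _, _⟩, _, _, _, _⟩
  cases e
  rfl

end DecGraph

theorem mainTheorem4 {K : Type w} [Field K] (X : SymModule.{u, w} K) :
    (PGr X.toSymData).IsTraP ∧
    (∀ k l : ℕ, Function.Injective (PGr.incl X.toSymData k l)) ∧
    ∀ (P : TraP.{v, w} K) (φ : X.toSymData.Hom P.toSymData),
      ∃! Φ : (PGr X.toSymData).Hom P.toTraPData,
        ∀ (k l : ℕ) (x : X.obj k l), Φ.app k l (PGr.incl X.toSymData k l x) = φ.app k l x := by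
  refine ⟨DecGraph.isTraP_PGr, fun k l => DecGraph.injective_incl, fun P φ => ?_⟩
  refine ⟨DecGraph.evalHom φ.app P.isTraP, fun k l => DecGraph.evalHom_incl φ.app P.isTraP,
    fun Ψ hΨ => DecGraph.hom_ext fun k l x => ?_⟩
  exact (hΨ k l x).trans (DecGraph.evalHom_incl φ.app P.isTraP x).symm
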